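/- **Setting.** Let $T>0$, $r\ge 0$, $N\ge 2$, and let $\mathbb F=(\mathcal F(t))_{t\in[0,T]}$ be the augmented filtration of a standard $d$-dimensional Brownian motion on a probability space $(\Omega,\mathcal F,\mathbf P)$. Let $\Sigma\in\mathbb R^{d\times d}$ be symmetric positive definite, let $\Lambda\in\mathbb R^{d\times d}$ be diagonal and positive definite, and let all $N$ investors have the same risk tolerance $\delta_m=\bar\delta>0$. Let $\mathcal H^\infty$ be the set of optional $\mathbb R^d$-valued processes $X$ on $[0,T]$ with $\operatorname{ess\,sup}_\omega\operatorname{ess\,sup}_t\|X(t)\|_2<\infty$. Let $\mathcal A$ be the set of $X\in\mathcal H^\infty$ with $dX=a^X\,dt+dM^X$ and $X(T)=0$, where $a^X\in\mathcal H^\infty$ and $M^X\in\mathcal H^\infty$ is a continuous $\mathbb F$-martingale. Let $\mathcal W_{\mathcal A}$ be the set of processes $\phi$ with $d\phi=\dot\phi\,dt$, $\phi(0)=0$ and $\dot\phi\in\mathcal A$. Suppose that the exposures satisfy $\zeta_1,\dots,\zeta_N\in\mathcal H^\infty$ and that the noise demand satisfies $\psi\in\mathcal W_{\mathcal A}$,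 and let $a^{\dot\psi}$ be the drift of $\dot\psi$. Fix an investor $n$ and put $\zeta_{-n}=\sum_{m\ne n}\zeta_m$. For $\dot\phi\in\mathcal A$ and $\phi(t)=\int_0^t\dot\phi(s)\,ds$, the frictional objective of the strategic investor $n$ is $$\widetilde{\mathcal F}_{\Lambda,n}(\dot\phi)=\mathbb E\bigg[\int_0^Te^{-rt}\bigg(\phi'\Big(\frac{\Sigma(\zeta_{-n}-\phi-\psi)}{\bar\delta(N-1)}+\frac{2\Lambda}{N-1}(a^{\dot\psi}-r\dot\psi)\Big)-\frac1{2\bar\delta}(\phi+\zeta_n)'\Sigma(\phi+\zeta_n)-\dot\phi'\Big(\Lambda+\frac{2\Lambda}{N-1}\Big)\dot\phi\bigg)dt\bigg].$$ **Proposition 4.2.** The functional $\widetilde{\mathcal F}_{\Lambda,n}:\mathcal A\to\mathbb R$ is well defined (its integrand is $dt\otimes\mathbf P$-integrable) and strictly concave on the convex set $\mathcal A$, processes being identified when they are indistinguishable. It has a maximizer over $\mathcal A$, and the maximizer is unique up to indistinguishability. Moreover, for processes $\phi,\dot\phi$ the following are equivalent: 1. $\phi\in\mathcal W_{\mathcal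 A}$ with rate $\dot\phi$, and $\dot\phi$ maximizes $\widetilde{\mathcal F}_{\Lambda,n}$ over $\mathcal A$; 2. $\dot\phi\in\mathcal H^\infty$ and $(\phi,\dot\phi)$ solves the linear FBSDE $$d\phi(t)=\dot\phi(t)\,dt,\quad\phi(0)=0,\qquad d\dot\phi(t)=d\widetilde M_n(t)+B\big(\phi(t)-\mathbb{TP}_n(t)\big)dt+r\dot\phi(t)\,dt,\quad\dot\phi(T)=0,$$ for some continuous $\mathbb F$-martingale $\widetilde M_n\in\mathcal H^\infty$, which is part of the solution. Here $$B=\frac{\Lambda^{-1}\Sigma}{2\bar\delta},\qquad \mathbb{TP}_n=\bar\phi_n+\frac{2\bar\delta\,\Sigma^{-1}\Lambda}{N+1}\big(a^{\dot\psi}-r\dot\psi\big),$$ where $$\bar\phi_n=\frac{\lambda_n(\zeta_{-n}-\psi)-(1-\lambda_n)\zeta_n}{\lambda_n+1},\qquad \lambda_n=\frac{\delta_n}{\sum_m\delta_m},$$ is the frictionless best response of investor $n$. -/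

import Mathlib

open MeasureTheory ProbabilityTheory
open scoped RealInnerProductSpace NNReal ENNReal

noncomputable section

namespace PriceImpact

/-- The time interval `[0,T]`. -/
abbrev Time (T : ℝ≥0) : Type := Set.Icc (0 : ℝ) (T : ℝ)

/-- Lebesgue measure `dt` on `[0,T]`. -/
def leb (T : ℝ≥0) : Measure (Time T) := Measure.comap Subtype.val volume

/-- The initial time `0` of `[0,T]`. -/
def tStart (T : ℝ≥0) : Time T := ⟨0, le_refl _, T.2⟩

/-- The terminal time `T` of `[0,T]`. -/
def tEnd (T : ℝ≥0) : Time T := ⟨T, T.2, le_refl _⟩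

/-- `ℝ^d` with the Euclidean norm. -/
abbrev Vec (d : ℕ) : Type := EuclideanSpace ℝ (Fin d)

/-- A standard `d`-dimensional Brownian motion on `[0,T]`: it starts at `0`, has almost surely
continuous paths and independent increments, and `W t - W s` is a centred Gaussian vector with
covariance `(t - s) I` (independent `N(0, t - s)` coordinates). -/
structure IsStandardBrownian {Ω : Type*} [MeasurableSpace Ω] {T : ℝ≥0} {d : ℕ}
    (W : Time T → Ω → Fin d → ℝ) (P : Measure Ω) : Prop where
  measurable : ∀ t, Measurable (W t)
  start : ∀ᵐ ω ∂P, W (tStart T) ω = 0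
  continuous_paths : ∀ᵐ ω ∂P, Continuous fun t => W t ω
  indep_increments : HasIndepIncrements W P
  law_increments : ∀ s t : Time T, s ≤ t →
    HasLaw (fun ω => W t ω - W s ω)
      (Measure.pi fun _ : Fin d => gaussianReal 0 (Real.toNNReal ((t : ℝ) - (s : ℝ)))) P

/-- The augmented filtration generated by `W`: at time `t` it is generated by `W s`, `s ≤ t`,
together with all `P`-null events. -/
def augmentedFiltration {Ω : Type*} [mΩ : MeasurableSpace Ω] {T : ℝ≥0} {d : ℕ}
    (W : Time T → Ω → Fin d → ℝ) (hW : ∀ t, Measurable (W t)) (P : Measure Ω) :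
    Filtration (Time T) mΩ where
  seq t := (⨆ s : Time T, ⨆ _ : s ≤ t, MeasurableSpace.comap (W s) inferInstance) ⊔
    MeasurableSpace.generateFrom {A : Set Ω | MeasurableSet A ∧ P A = 0}
  mono' := by
    intro s t hst
    refine sup_le_sup_right (iSup_le fun u => iSup_le fun hu => ?_) _
    exact le_iSup_of_le u (le_iSup_of_le (hu.trans hst) le_rfl)
  le' := by
    intro t
    refine sup_le (iSup_le fun s => iSup_le fun _ => (hW s).comap_le) ?_
    exact MeasurableSpace.generateFrom_le fun A hA => hA.1

section Processes

variable {Ω : Type*} [mΩ : MeasurableSpace Ω] {T : ℝ≥0} {d : ℕ}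

/-- Right-continuous paths with left limits. -/
def IsCadlag (f : Time T → ℝ) : Prop :=
  (∀ t, ContinuousWithinAt f (Set.Ici t) t) ∧
    ∀ t, ∃ l : ℝ, Filter.Tendsto f (nhdsWithin t (Set.Iio t)) (nhds l)

/-- The optional σ-algebra on `[0,T] × Ω`: the one generated by the real-valued adapted processes
with càdlàg paths. -/
abbrev optionalSigma (F : Filtration (Time T) mΩ) : MeasurableSpace (Time T × Ω) :=
  ⨆ (Y : Time T → Ω → ℝ) (_ : StronglyAdapted F Y ∧ ∀ ω, IsCadlag fun t => Y t ω),
    MeasurableSpace.comap (fun p : Time T × Ω => Y p.1 p.2) inferInstance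

/-- Optional `ℝ^d`-valued processes. -/
def IsOptional (F : Filtration (Time T) mΩ) (X : Time T → Ω → Vec d) : Prop :=
  Measurable[optionalSigma F] fun p : Time T × Ω => X p.1 p.2

/-- The norm `ess sup_ω ess sup_t ‖X t ω‖₂`. -/
def normHInf (P : Measure Ω) (X : Time T → Ω → Vec d) : ℝ≥0∞ :=
  essSup (fun ω => essSup (fun t : Time T => ‖X t ω‖ₑ) (leb T)) P

/-- The class `H^∞` of bounded optional processes. -/
def MemHInf (F : Filtration (Time T) mΩ) (P : Measure Ω) (X : Time T → Ω → Vec d) : Prop :=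
  IsOptional F X ∧ normHInf P X < ∞

/-- Continuous `F`-martingales on `[0,T]` belonging to `H^∞`. -/
def IsBoundedContMartingale (F : Filtration (Time T) mΩ) (P : Measure Ω)
    (M : Time T → Ω → Vec d) : Prop :=
  Martingale M F P ∧ (∀ᵐ ω ∂P, Continuous fun t => M t ω) ∧ MemHInf F P M

/-- The process `t ↦ ∫_0^t X(s) ds`. -/
def primitive (X : Time T → Ω → Vec d) (t : Time T) (ω : Ω) : Vec d :=
  ∫ s in Set.Iic t, X s ω ∂(leb T)

/-- `dX(t) = a(t) dt + dM(t)` on `[0,T]`, in integrated form. -/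
def HasDynamics (P : Measure Ω) (X a M : Time T → Ω → Vec d) : Prop :=
  ∀ᵐ ω ∂P, ∀ t : Time T,
    X t ω = X (tStart T) ω + primitive a t ω + (M t ω - M (tStart T) ω)

/-- `X` belongs to `H^∞` and has dynamics `dX = a dt + dM` with drift `a ∈ H^∞` and a continuous
martingale `M ∈ H^∞`. -/
def HasDecomposition (F : Filtration (Time T) mΩ) (P : Measure Ω)
    (X a M : Time T → Ω → Vec d) : Prop :=
  MemHInf F P X ∧ MemHInf F P a ∧ IsBoundedContMartingale F P M ∧ HasDynamics P X a M

/-- The class `𝒜` of semimartingales with bounded drift, bounded martingale part and terminal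
value `0`. -/
def classA (d : ℕ) (F : Filtration (Time T) mΩ) (P : Measure Ω) : Set (Time T → Ω → Vec d) :=
  {X | (∃ a M, HasDecomposition F P X a M) ∧ ∀ᵐ ω ∂P, X (tEnd T) ω = 0}

/-- `dφ(t) = φ'(t) dt` on `[0,T]` and `φ(0) = 0`. -/
def HasRate (P : Measure Ω) (φ φdot : Time T → Ω → Vec d) : Prop :=
  ∀ᵐ ω ∂P, φ (tStart T) ω = 0 ∧ ∀ t : Time T, φ t ω = φ (tStart T) ω + primitive φdot t ω

/-- `φ` belongs to the class `𝒲_𝒜`, with rate `φdot ∈ 𝒜`. -/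
def MemW (F : Filtration (Time T) mΩ) (P : Measure Ω) (φ φdot : Time T → Ω → Vec d) : Prop :=
  φdot ∈ classA d F P ∧ HasRate P φ φdot

/-- Equality of processes up to indistinguishability. -/
def Indistinguishable (P : Measure Ω) (X Y : Time T → Ω → Vec d) : Prop :=
  ∀ᵐ ω ∂P, ∀ t : Time T, X t ω = Y t ω

end Processes

section Market

variable {Ω : Type*} [mΩ : MeasurableSpace Ω] {T : ℝ≥0} {d N : ℕ}

/-- Aggregate exposure of all investors other than `n`. -/
def exposureOthers (ζ : Fin N → Time T → Ω → Vec d) (n : Fin N) (t : Time T) (ω : Ω) : Vec d :=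
  ∑ m ∈ Finset.univ.erase n, ζ m t ω

/-- Relative risk tolerance of investor `n`. -/
def relTolerance (δ : Fin N → ℝ) (n : Fin N) : ℝ := δ n / ∑ m, δ m

/-- The frictionless best response `(λ_n (ζ_{-n} - ψ) - (1 - λ_n) ζ_n) / (λ_n + 1)`. -/
def bestResponse (δ : Fin N → ℝ) (ζ : Fin N → Time T → Ω → Vec d) (ψ : Time T → Ω → Vec d)
    (n : Fin N) (t : Time T) (ω : Ω) : Vec d :=
  (relTolerance δ n + 1)⁻¹ •
    (relTolerance δ n • (exposureOthers ζ n t ω - ψ t ω) - (1 - relTolerance δ n) • ζ n t ω)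

/-- The target portfolio `TP_n`: the frictionless best response plus
`(2 δbar / (N + 1)) Σ⁻¹ Λ (a - r ψ')`. -/
def targetPortfolio (r δbar : ℝ) (Sig Lam : Matrix (Fin d) (Fin d) ℝ) (δ : Fin N → ℝ)
    (ζ : Fin N → Time T → Ω → Vec d) (ψ ψdot aψ : Time T → Ω → Vec d)
    (n : Fin N) (t : Time T) (ω : Ω) : Vec d :=
  bestResponse δ ζ ψ n t ω +
    (2 * δbar / ((N : ℝ) + 1)) •
      Matrix.toEuclideanLin (Sig⁻¹ * Lam) (aψ t ω - r • ψdot t ω)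

/-- The matrix `B = Λ⁻¹ Σ / (2 δbar)`. -/
def matB (δbar : ℝ) (Sig Lam : Matrix (Fin d) (Fin d) ℝ) : Matrix (Fin d) (Fin d) ℝ :=
  (2 * δbar)⁻¹ • (Lam⁻¹ * Sig)

/-- The integrand of the frictional objective of the strategic investor `n`, for the trading rate
`X` and the position `φ = ∫ X dt`. -/
def objectiveIntegrand (r δbar : ℝ) (Sig Lam : Matrix (Fin d) (Fin d) ℝ)
    (ζ : Fin N → Time T → Ω → Vec d) (ψ ψdot aψ : Time T → Ω → Vec d) (n : Fin N)
    (X : Time T → Ω → Vec d) (t : Time T) (ω : Ω) : ℝ :=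
  Real.exp (-r * (t : ℝ)) *
    (⟪primitive X t ω,
        (δbar * ((N : ℝ) - 1))⁻¹ •
            Matrix.toEuclideanLin Sig (exposureOthers ζ n t ω - primitive X t ω - ψ t ω) +
          Matrix.toEuclideanLin ((2 / ((N : ℝ) - 1)) • Lam) (aψ t ω - r • ψdot t ω)⟫ -
      1 / (2 * δbar) *
        ⟪primitive X t ω + ζ n t ω,
          Matrix.toEuclideanLin Sig (primitive X t ω + ζ n t ω)⟫ -
      ⟪X t ω, Matrix.toEuclideanLin (Lam + (2 / ((N : ℝ) - 1)) • Lam) (X t ω)⟫)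

/-- The frictional objective of the strategic investor `n`, as a functional of the trading rate. -/
def objective (P : Measure Ω) (r δbar : ℝ) (Sig Lam : Matrix (Fin d) (Fin d) ℝ)
    (ζ : Fin N → Time T → Ω → Vec d) (ψ ψdot aψ : Time T → Ω → Vec d) (n : Fin N)
    (X : Time T → Ω → Vec d) : ℝ :=
  ∫ ω, (∫ t : Time T, objectiveIntegrand r δbar Sig Lam ζ ψ ψdot aψ n X t ω ∂(leb T)) ∂P

/-- `(φ, φdot)` solves the FBSDE
`dφ = φdot dt`, `φ(0) = 0`, `dφdot = dM + B (φ - TP) dt + r φdot dt`, `φdot(T) = 0`,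
where `φdot ∈ H^∞` and the continuous martingale `M ∈ H^∞` is part of the solution. -/
def SolvesFBSDE (F : Filtration (Time T) mΩ) (P : Measure Ω) (r : ℝ)
    (B : Matrix (Fin d) (Fin d) ℝ) (TP φ φdot : Time T → Ω → Vec d) : Prop :=
  MemHInf F P φdot ∧ HasRate P φ φdot ∧
    (∃ M, IsBoundedContMartingale F P M ∧
      HasDynamics P φdot
        (fun t ω => Matrix.toEuclideanLin B (φ t ω - TP t ω) + r • φdot t ω) M) ∧
    ∀ᵐ ω ∂P, φdot (tEnd T) ω = 0

end Market

end PriceImpact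

end

open PriceImpact

/-! The objective is a quadratic functional of the trading rate, so its expansion at `X` is exact:
the value at `Y` minus the value at `X` is a term linear in `Y - X` (`firstVariation`) minus a
nonnegative quadratic form in `Y - X` (`quadraticLoss`); this is `objective_sub`. With c =
(N+1)/(N-1), the form has weight c/(2δbar) on Σ for the position and c on Λ for the rate, and
collecting the linear terms in the position produces the target portfolio. If the loss vanishes, the
rates agree almost everywhere, hence are indistinguishable since their paths are continuous. This
yields strict concavity and uniqueness.

If `X` solves the FBSDE, the first variation at `X` vanishes in every direction h = Y - X
(`firstVariation_eq_zero`). Discounting removes the drift r X, integration by parts along each path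
moves the integral from ∫h onto the rate, and X(T) = 0 fixes the integration constant. What is left
is E∫⟪h(t), Λ(Z(t) - Z(T))⟫dt with Z the martingale part of the discounted rate; it is zero because
h is adapted. Hence solutions of the FBSDE are maximizers.

For existence a bounded solution is constructed. Conjugation by Λ^{1/2} turns B into a symmetric
positive definite matrix, so B is diagonalisable with positive eigenvalues b and the system splits
into scalar ones with target f. If G > 0 solves G'' = rG' + bG, G'(T) = 0, the scalar position is φ
= GA with GA'(t) = (e^{rt}/G(t)) E[∫_t^T e^{-rs}G(s) b f(s) ds | F(t)], which is bounded. The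
martingale part must be continuous. That bounded martingales of the augmented Brownian filtration
have continuous versions is proved directly: it is explicit for functions of finitely many values of
`W`, by independence of increments, and survives L¹ limits by Doob's maximal inequality. Integrals
of deterministic C¹ functions against martingales are defined by parts, so no stochastic integration
is used.

Finally, a maximizer is indistinguishable from the constructed one by uniqueness, and therefore
solves the FBSDE itself; no perturbation of the maximizer is needed. -/

namespace PriceImpact

open scoped BoundedContinuousFunction

/-! ### Primitives and integration by parts on [0,T]. -/

section Paths

variable {T : ℝ≥0} {E F G : Type*} [NormedAddCommGroup E] [NormedSpace ℝ E]
  [NormedAddCommGroup F] [NormedSpace ℝ F] [NormedAddCommGroup G] [NormedSpace ℝ G]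

instance leb_isFiniteMeasure (T : ℝ≥0) : IsFiniteMeasure (leb T) := by
  refine ⟨?_⟩
  rw [leb, (MeasurableEmbedding.subtype_coe measurableSet_Icc).comap_apply, Set.image_univ,
    Subtype.range_coe]
  exact measure_Icc_lt_top

instance leb_noAtoms (T : ℝ≥0) : NullSingletonClass (leb T) := by
  refine ⟨fun x => ?_⟩
  rw [leb, (MeasurableEmbedding.subtype_coe measurableSet_Icc).comap_apply]
  simp

lemma leb_real_univ (T : ℝ≥0) : (leb T).real Set.univ = T := by
  rw [measureReal_def, leb, (MeasurableEmbedding.subtype_coe measurableSet_Icc).comap_apply,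
    Set.image_univ, Subtype.range_coe]
  simp

lemma le_tEnd (t : Time T) : t ≤ tEnd T := t.2.2

lemma tStart_le (t : Time T) : tStart T ≤ t := t.2.1

lemma Iic_tEnd : Set.Iic (tEnd T) = Set.univ := Set.eq_univ_of_forall le_tEnd

/-- Lebesgue measure on `[0,T]` charges every nonempty open set when `T > 0`. -/
lemma leb_isOpenPosMeasure (hT : 0 < T) : (leb T).IsOpenPosMeasure := by
  refine ⟨fun U hU hne => ?_⟩
  obtain ⟨V, hV, rfl⟩ := isOpen_induced_iff.1 hU
  obtain ⟨⟨x, hx⟩, hxV⟩ := hne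
  rw [leb, (MeasurableEmbedding.subtype_coe measurableSet_Icc).comap_apply,
    Subtype.image_preimage_coe]
  have hx' : x ∈ closure (Set.Ioo (0 : ℝ) T) := by
    rw [closure_Ioo (by exact_mod_cast hT.ne)]; exact hx
  obtain ⟨y, hyV, hy⟩ := mem_closure_iff.1 hx' V hV hxV
  have h1 : (0 : ℝ≥0∞) < volume (V ∩ Set.Ioo (0 : ℝ) T) :=
    (hV.inter isOpen_Ioo).measure_pos _ ⟨y, hyV, hy⟩
  refine (h1.trans_le (measure_mono ?_)).ne'
  rintro z ⟨hz, hz'⟩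
  exact ⟨Set.Ioo_subset_Icc_self hz', hz⟩

/-- The path `t ↦ ∫_0^t f(s) ds` on `[0,T]`. -/
noncomputable def pathPrim (f : Time T → E) (t : Time T) : E := ∫ s in Set.Iic t, f s ∂(leb T)

lemma pathPrim_congr {f g : Time T → E} (h : f =ᵐ[leb T] g) : pathPrim f = pathPrim g := by
  funext t
  exact integral_congr_ae (ae_restrict_of_ae h)

lemma pathPrim_start (f : Time T → E) : pathPrim f (tStart T) = 0 := by
  have : Set.Iic (tStart T) = {tStart T} := by
    ext t; exact ⟨fun h => le_antisymm h (tStart_le t), fun h => h.le⟩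
  rw [pathPrim, this, Measure.restrict_singleton, measure_singleton]
  simp

lemma pathPrim_end (f : Time T → E) : pathPrim f (tEnd T) = ∫ s, f s ∂(leb T) := by
  rw [pathPrim, Iic_tEnd, Measure.restrict_univ]

lemma pathPrim_add {f g : Time T → E} (hf : Integrable f (leb T)) (hg : Integrable g (leb T))
    (t : Time T) : pathPrim (fun s => f s + g s) t = pathPrim f t + pathPrim g t :=
  integral_add hf.restrict hg.restrict

lemma pathPrim_sub {f g : Time T → E} (hf : Integrable f (leb T)) (hg : Integrable g (leb T))
    (t : Time T) : pathPrim (fun s => f s - g s) t = pathPrim f t - pathPrim g t :=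
  integral_sub hf.restrict hg.restrict

lemma pathPrim_smul (c : ℝ) (f : Time T → E) (t : Time T) :
    pathPrim (fun s => c • f s) t = c • pathPrim f t :=
  integral_smul c f

lemma pathPrim_clm [CompleteSpace E] [CompleteSpace F] (L : E →L[ℝ] F) {f : Time T → E}
    (hf : Integrable f (leb T)) (t : Time T) :
    pathPrim (fun s => L (f s)) t = L (pathPrim f t) :=
  L.integral_comp_comm hf.restrict

/-- Dominated convergence: for fixed `s ≠ t₀` the indicator of `s ≤ t` is constant for `t` near
`t₀`, and `leb T` has no atoms. -/
lemma continuous_pathPrim {f : Time T → E} (hf : Integrable f (leb T)) :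
    Continuous (pathPrim f) := by
  have h : pathPrim f = fun t => ∫ s, (Set.Iic t).indicator f s ∂(leb T) := by
    funext t; rw [integral_indicator measurableSet_Iic]; rfl
  rw [h, continuous_iff_continuousAt]
  intro t₀
  refine continuousAt_of_dominated (bound := fun s => ‖f s‖)
    (.of_forall fun t => hf.aestronglyMeasurable.indicator measurableSet_Iic)
    (.of_forall fun t => .of_forall fun s => norm_indicator_le_norm_self _ _) hf.norm ?_
  filter_upwards [(leb T).ae_ne t₀] with s hs
  rcases lt_or_gt_of_ne hs with h | h
  · refine (continuousAt_const (y := f s)).congr ?_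
    filter_upwards [lt_mem_nhds h] with t ht
    rw [Set.indicator_of_mem (Set.mem_Iic.2 (le_of_lt ht))]
  · refine (continuousAt_const (y := (0 : E))).congr ?_
    filter_upwards [gt_mem_nhds h] with t ht
    rw [Set.indicator_of_notMem (by simpa using ht)]

lemma norm_pathPrim_le {f : Time T → E} {C : ℝ} (h : ∀ᵐ s ∂(leb T), ‖f s‖ ≤ C) (t : Time T) :
    ‖pathPrim f t‖ ≤ C * T := by
  rcases (norm_setIntegral_le_of_norm_le_const_ae (s := Set.Iic t) (measure_lt_top _ _)
    (ae_restrict_of_ae h)) with h1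
  -- For the zero measure the hypothesis is void and `C` may be negative, but then `T = 0`.
  by_cases hT : (leb T) Set.univ = 0
  · have : leb T = 0 := Measure.measure_univ_eq_zero.1 hT
    have hT' : (T : ℝ) = 0 := by rw [← leb_real_univ T, measureReal_def, hT]; rfl
    simp [pathPrim, this, hT']
  · have hC : 0 ≤ C := by
      have : NeZero (leb T) := ⟨fun h => hT (by simp [h])⟩
      obtain ⟨s, hs⟩ := h.exists
      exact (norm_nonneg _).trans hs
    refine h1.trans (mul_le_mul_of_nonneg_left ?_ hC)
    exact (measureReal_mono (Set.subset_univ _)).trans_eq (leb_real_univ T)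

/-- Integration by parts for two primitives on `[0,T]`. -/
lemma pathPrim_by_parts [CompleteSpace E] [CompleteSpace F] [CompleteSpace G]
    (B : E →L[ℝ] F →L[ℝ] G) {u : Time T → E} {v : Time T → F}
    (hu : Integrable u (leb T)) (hv : Integrable v (leb T)) (t : Time T) :
    pathPrim (fun s => B (u s) (pathPrim v s)) t + pathPrim (fun s => B (pathPrim u s) (v s)) t =
      B (pathPrim u t) (pathPrim v t) := by
  set ν := (leb T).restrict (Set.Iic t) with hν
  have huν : Integrable u ν := hu.restrict
  have hvν : Integrable v ν := hv.restrict
  have hres : ∀ s ∈ Set.Iic t, (leb T).restrict (Set.Iic s) = ν.restrict (Set.Iic s) := by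
    intro s hs
    rw [hν, Measure.restrict_restrict measurableSet_Iic,
      Set.inter_eq_left.2 (Set.Iic_subset_Iic.2 hs)]
  have hint : Integrable (fun p : Time T × Time T => B (u p.1) (v p.2)) (ν.prod ν) := by
    refine Integrable.mono' ((huν.norm.mul_prod hvν.norm).const_mul ‖B‖) ?_ ?_
    · exact B.aestronglyMeasurable_comp₂ huν.aestronglyMeasurable.comp_fst
        hvν.aestronglyMeasurable.comp_snd
    · refine .of_forall fun p => ?_
      rw [← mul_assoc]
      exact B.le_opNorm₂ _ _
  -- By Fubini the two terms on the left are the integrals of `B (u p.1) (v p.2)` over the two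
  -- closed triangles of the square [0,t]². These cover the square and overlap only on the diagonal,
  -- which is null.
  have hm1 : MeasurableSet {p : Time T × Time T | p.2 ≤ p.1} :=
    measurableSet_le measurable_snd measurable_fst
  have hm2 : MeasurableSet {p : Time T × Time T | p.1 ≤ p.2} :=
    measurableSet_le measurable_fst measurable_snd
  have h1 : pathPrim (fun s => B (u s) (pathPrim v s)) t =
      ∫ p in {p : Time T × Time T | p.2 ≤ p.1}, B (u p.1) (v p.2) ∂(ν.prod ν) := by
    rw [← integral_indicator hm1, integral_prod _ (hint.indicator hm1)]
    refine setIntegral_congr_fun measurableSet_Iic fun s hs => ?_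
    have : ∀ r, {p : Time T × Time T | p.2 ≤ p.1}.indicator
        (fun p : Time T × Time T => B (u p.1) (v p.2)) (s, r) =
        (Set.Iic s).indicator (fun r => B (u s) (v r)) r := fun r => by
      by_cases h : r ≤ s <;> simp [Set.indicator, h]
    simp_rw [this]
    rw [integral_indicator measurableSet_Iic, ← hres s hs,
      (B (u s)).integral_comp_comm hv.restrict]
    rfl
  have h2 : pathPrim (fun s => B (pathPrim u s) (v s)) t =
      ∫ p in {p : Time T × Time T | p.1 ≤ p.2}, B (u p.1) (v p.2) ∂(ν.prod ν) := by
    rw [← integral_indicator hm2, integral_prod_symm _ (hint.indicator hm2)]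
    refine setIntegral_congr_fun measurableSet_Iic fun s hs => ?_
    have : ∀ r, {p : Time T × Time T | p.1 ≤ p.2}.indicator
        (fun p : Time T × Time T => B (u p.1) (v p.2)) (r, s) =
        (Set.Iic s).indicator (fun r => B.flip (v s) (u r)) r := fun r => by
      by_cases h : r ≤ s <;> simp [Set.indicator, h]
    simp_rw [this]
    rw [integral_indicator measurableSet_Iic, ← hres s hs,
      (B.flip (v s)).integral_comp_comm hu.restrict]
    rfl
  have h3 : B (pathPrim u t) (pathPrim v t) = ∫ p, B (u p.1) (v p.2) ∂(ν.prod ν) := by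
    rw [integral_prod _ hint]
    change B (∫ s, u s ∂ν) (∫ s, v s ∂ν) = _
    have : ∀ s, ∫ r, B (u s) (v r) ∂ν = B.flip (∫ r, v r ∂ν) (u s) := fun s => by
      rw [(B (u s)).integral_comp_comm hvν]; rfl
    simp_rw [this]
    rw [(B.flip (∫ r, v r ∂ν)).integral_comp_comm huν]; rfl
  rw [h1, h2, h3, ← setIntegral_union₀ ?_ hm2.nullMeasurableSet hint.integrableOn
    hint.integrableOn]
  · rw [show {p : Time T × Time T | p.2 ≤ p.1} ∪ {p | p.1 ≤ p.2} = Set.univ from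
      Set.eq_univ_of_forall fun p => (le_total p.2 p.1), Measure.restrict_univ]
  · have : {p : Time T × Time T | p.2 ≤ p.1} ∩ {p | p.1 ≤ p.2} = Set.diagonal (Time T) := by
      ext ⟨a, b⟩
      simp [le_antisymm_iff, and_comm]
    rw [AEDisjoint, this, Measure.measure_prod_null measurableSet_diagonal]
    refine .of_forall fun x => ?_
    have : Prod.mk x ⁻¹' Set.diagonal (Time T) = {x} := by
      ext y; simp [eq_comm]
    simp only [this, measure_singleton, Pi.zero_apply]

/-- The fundamental theorem of calculus along `[0,T]`. -/
lemma pathPrim_deriv [CompleteSpace E] {k k' : ℝ → E} (hk : ∀ t, HasDerivAt k (k' t) t)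
    (hk' : Continuous k') (t : Time T) :
    pathPrim (fun s : Time T => k' s) t = k t - k 0 := by
  rw [← intervalIntegral.integral_eq_sub_of_hasDerivAt (fun x _ => hk x)
    (hk'.intervalIntegrable _ _), intervalIntegral.integral_of_le t.2.1, pathPrim,
    ← integral_Icc_eq_integral_Ioc, leb]
  have := (MeasurableEmbedding.subtype_coe (measurableSet_Icc (a := (0 : ℝ)) (b := (T : ℝ))))
  rw [show Set.Iic t = Subtype.val ⁻¹' (Set.Icc (0 : ℝ) t) from
    Set.ext fun x => ⟨fun h => ⟨x.2.1, h⟩, fun h => h.2⟩]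
  rw [← this.setIntegral_map, this.map_comap, Measure.restrict_restrict measurableSet_Icc]
  congr 2
  ext x
  simp only [Subtype.range_coe_subtype, Set.mem_inter_iff, Set.mem_Icc, Set.mem_ofPred_eq]
  exact ⟨fun h => h.1, fun h => ⟨h, h.1, h.2.trans t.2.2⟩⟩

end Paths

/-! ### Optional processes are progressively measurable. -/

section Optional

variable {Ω : Type*} [mΩ : MeasurableSpace Ω] {T : ℝ≥0} {d : ℕ} {F : Filtration (Time T) mΩ}
  {E : Type*} [MeasurableSpace E]

/-- Optional processes with values in an arbitrary measurable space. -/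
def IsOpt (F : Filtration (Time T) mΩ) (X : Time T → Ω → E) : Prop :=
  Measurable[optionalSigma F] fun p : Time T × Ω => X p.1 p.2

/-- Discretisation of `[0,i]` from the right. -/
lemma exists_right_approx (i : Time T) :
    ∃ (h : ℕ → ℕ → Time T) (c : ℕ → Time T → ℕ), (∀ n m, h n m ≤ i) ∧ (∀ n, Measurable (c n)) ∧
      ∀ s ≤ i, Filter.Tendsto (fun n => h n (c n s)) Filter.atTop (nhdsWithin s (Set.Ici s)) := by
  -- A grid of mesh 1/(n+1); `c n s` is the index of the first grid point not before `s`. Capping at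
  -- `i` keeps every sampled time in the past of `i`.
  let h : ℕ → ℕ → Time T := fun n m =>
    min i (Set.projIcc (0 : ℝ) T T.coe_nonneg ((m : ℝ) / (n + 1)))
  let c : ℕ → Time T → ℕ := fun n s => ⌈(s : ℝ) * (n + 1)⌉₊
  have hle : ∀ n (s : Time T), s ≤ i → s ≤ h n (c n s) := fun n s hs => by
    refine le_min hs ?_
    change (s : ℝ) ≤ _
    rw [Set.coe_projIcc]
    refine le_max_of_le_right (le_min s.2.2 ?_)
    rw [le_div_iff₀ (by positivity)]
    exact Nat.le_ceil _
  have hge : ∀ n (s : Time T), ((h n (c n s) : Time T) : ℝ) ≤ s + 1 / (n + 1) := fun n s => by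
    refine (show ((h n (c n s) : Time T) : ℝ) ≤
      (Set.projIcc (0 : ℝ) T T.coe_nonneg ((c n s : ℝ) / (n + 1)) : ℝ) from
        min_le_right _ _).trans ?_
    rw [Set.coe_projIcc]
    have h0 : (0 : ℝ) ≤ s := s.2.1
    refine max_le (by positivity) ((min_le_right _ _).trans ?_)
    rw [div_le_iff₀ (by positivity), add_mul, div_mul_cancel₀ _ (by positivity)]
    exact (Nat.ceil_lt_add_one (by positivity)).le
  refine ⟨h, c, fun n m => min_le_left _ _,
    fun n => Nat.measurable_ceil.comp (measurable_subtype_coe.mul_const _), fun s hs => ?_⟩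
  refine tendsto_nhdsWithin_iff.2 ⟨?_, .of_forall fun n => hle n s hs⟩
  rw [tendsto_subtype_rng]
  refine tendsto_of_tendsto_of_tendsto_of_le_of_le tendsto_const_nhds ?_
    (fun n => hle n s hs) (fun n => hge n s)
  simpa using (tendsto_const_nhds (x := (s : ℝ))).add tendsto_one_div_add_atTop_nhds_zero_nat

-- By right continuity `Y` is the pointwise limit of its values sampled on the grids, and each
-- sampled process involves countably many variables observed no later than `i`. Left limits play no
-- role.
omit mΩ in
lemma measurable_prod_of_isCadlag {m : MeasurableSpace Ω} {Y : Time T → Ω → ℝ} {i : Time T}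
    (hY : ∀ t ≤ i, Measurable (Y t)) (hc : ∀ ω, IsCadlag fun t => Y t ω) :
    Measurable fun p : Set.Iic i × Ω => Y p.1 p.2 := by
  obtain ⟨h, c, hi, hcm, hlim⟩ := exists_right_approx i
  refine measurable_of_tendsto_metrizable
    (f := fun n (p : Set.Iic i × Ω) => Y (h n (c n p.1)) p.2) (fun n => ?_) ?_
  · have h1 : Measurable fun q : ℕ × Ω => Y (h n q.1) q.2 :=
      measurable_from_prod_countable_right fun m => hY _ (hi n m)
    exact h1.comp (((hcm n).comp (measurable_subtype_coe.comp measurable_fst)).prodMk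
      measurable_snd)
  · rw [tendsto_pi_nhds]
    rintro ⟨⟨s, hs⟩, ω⟩
    exact ((hc ω).1 s).tendsto.comp (hlim s hs)

/-- Measurability is checked on the generators of the optional σ-algebra, since pulling back
commutes with suprema. Composition with this map is what makes optional processes progressive. -/
lemma measurable_optionalSigma_restrict (F : Filtration (Time T) mΩ) (i : Time T) :
    @Measurable _ _ (Subtype.instMeasurableSpace.prod (F i)) (optionalSigma F)
      fun p : Set.Iic i × Ω => ((p.1 : Time T), p.2) := by
  rw [measurable_iff_comap_le]
  simp only [optionalSigma, MeasurableSpace.comap_iSup, MeasurableSpace.comap_comp]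
  refine iSup₂_le fun Y hY => ?_
  rw [← measurable_iff_comap_le]
  exact measurable_prod_of_isCadlag (m := F i)
    (fun t ht => (hY.1.stronglyMeasurable_le ht).measurable) hY.2

lemma IsOpt.progressive {X : Time T → Ω → E} (hX : IsOpt F X) (i : Time T) :
    Measurable[Subtype.instMeasurableSpace.prod (F i)]
      fun p : Set.Iic i × Ω => X p.1 p.2 :=
  @Measurable.comp _ _ _ _ (optionalSigma F) _ _ _ hX (measurable_optionalSigma_restrict F i)

lemma IsOpt.measurable_uncurry {X : Time T → Ω → E} (hX : IsOpt F X) :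
    Measurable fun p : Time T × Ω => X p.1 p.2 := by
  have h : @Measurable _ _ _ (Subtype.instMeasurableSpace.prod (F (tEnd T)))
      fun p : Time T × Ω => ((⟨p.1, le_tEnd p.1⟩ : Set.Iic (tEnd T)), p.2) :=
    Measurable.prodMk measurable_fst.subtype_mk (measurable_snd.mono le_rfl (F.le _))
  exact (hX.progressive (tEnd T)).comp h

lemma IsOpt.measurable_path {X : Time T → Ω → E} (hX : IsOpt F X) (ω : Ω) :
    Measurable fun t => X t ω :=
  hX.measurable_uncurry.comp measurable_prodMk_right

lemma IsOpt.adapted {X : Time T → Ω → E} (hX : IsOpt F X) (t : Time T) :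
    Measurable[F t] (X t) := by
  have : @Measurable _ _ (F t) (Subtype.instMeasurableSpace.prod (F t))
      fun ω : Ω => ((⟨t, Set.mem_Iic.2 le_rfl⟩ : Set.Iic t), ω) :=
    @measurable_prodMk_left _ _ _ (F t) _
  exact (hX.progressive t).comp this

lemma IsOpt.comp {E' : Type*} [MeasurableSpace E'] {X : Time T → Ω → E} (hX : IsOpt F X)
    {g : E → E'} (hg : Measurable g) : IsOpt F fun t ω => g (X t ω) :=
  Measurable.comp hg hX

lemma IsOpt.comp₂ {E' E'' : Type*} [MeasurableSpace E'] [MeasurableSpace E'']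
    {X : Time T → Ω → E} {Y : Time T → Ω → E'} (hX : IsOpt F X) (hY : IsOpt F Y)
    {g : E → E' → E''} (hg : Measurable fun p : E × E' => g p.1 p.2) :
    IsOpt F fun t ω => g (X t ω) (Y t ω) :=
  hg.comp (Measurable.prodMk (m := optionalSigma F) hX hY)

lemma isOpt_of_continuous {Y : Time T → Ω → ℝ} (hY : StronglyAdapted F Y)
    (hc : ∀ ω, Continuous fun t => Y t ω) : IsOpt F Y := by
  rw [IsOpt, measurable_iff_comap_le]
  refine le_iSup₂_of_le Y ⟨hY, fun ω => ⟨fun t => (hc ω).continuousWithinAt, fun t =>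
    ⟨Y t ω, (hc ω).continuousWithinAt⟩⟩⟩ le_rfl

lemma isOpt_vec {X : Time T → Ω → Vec d} (h : ∀ i, IsOpt F fun t ω => X t ω i) : IsOpt F X := by
  have : Measurable[optionalSigma F] fun p : Time T × Ω => fun i => X p.1 p.2 i := by
    refine @measurable_pi_lambda _ _ _ (optionalSigma F) _ _ h
  exact (WithLp.measurable_toLp 2 (Fin d → ℝ)).comp this

lemma isOpt_vec_of_continuous {Y : Time T → Ω → Vec d} (hY : StronglyAdapted F Y)
    (hc : ∀ ω, Continuous fun t => Y t ω) : IsOpt F Y :=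
  isOpt_vec fun i => isOpt_of_continuous
    (fun t => (EuclideanSpace.proj (𝕜 := ℝ) i : Vec d →L[ℝ] ℝ).continuous.comp_stronglyMeasurable (hY t))
    fun ω => (EuclideanSpace.proj (𝕜 := ℝ) i : Vec d →L[ℝ] ℝ).continuous.comp (hc ω)

lemma isOpt_deterministic {f : Time T → ℝ} (hf : Continuous f) : IsOpt F fun t (_ : Ω) => f t :=
  isOpt_of_continuous (fun _ => stronglyMeasurable_const) fun _ => hf

section Primitive

variable {V : Type*} [NormedAddCommGroup V] [NormedSpace ℝ V] [MeasurableSpace V] [BorelSpace V]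
  [SecondCountableTopology V]

omit [NormedSpace ℝ V] in
lemma IsOpt.integrable_path {X : Time T → Ω → V} (hX : IsOpt F X) {C : ℝ} {ω : Ω}
    (hC : ∀ᵐ t ∂(leb T), ‖X t ω‖ ≤ C) : Integrable (fun t => X t ω) (leb T) :=
  Integrable.of_bound (hX.measurable_path ω).aestronglyMeasurable C hC

/-- The integral up to `t` sees only the restriction to [0,t] × Ω, which is measurable for `F t` by
progressive measurability; Fubini does the rest. -/
lemma IsOpt.stronglyAdapted_pathPrim {X : Time T → Ω → V} (hX : IsOpt F X) :
    StronglyAdapted F fun t ω => pathPrim (fun s => X s ω) t := by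
  intro t
  have h : (fun ω => pathPrim (fun s => X s ω) t) =
      fun ω => ∫ s : Set.Iic t, X s ω ∂(Measure.comap Subtype.val (leb T)) := by
    funext ω
    exact (integral_subtype_comap measurableSet_Iic fun s => X s ω).symm
  change StronglyMeasurable[F t] fun ω => pathPrim (fun s => X s ω) t
  rw [h]
  have : IsFiniteMeasure (Measure.comap (Subtype.val : Set.Iic t → Time T) (leb T)) := by
    refine ⟨?_⟩
    rw [(MeasurableEmbedding.subtype_coe measurableSet_Iic).comap_apply]
    exact measure_lt_top _ _
  exact @StronglyMeasurable.integral_prod_left' _ _ _ _ (F t) _ _ _ _ (fun p : Set.Iic t × Ω => X p.1 p.2)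
    (hX.progressive t).stronglyMeasurable

end Primitive

end Optional

/-! ### The class H^∞ and its continuous members. -/

section HInf

variable {Ω : Type*} [mΩ : MeasurableSpace Ω] {T : ℝ≥0} {d : ℕ} {F : Filtration (Time T) mΩ}
  {P : Measure Ω}

/-- Replaces the nested essential suprema by one real constant; later boundedness arguments use this
form. -/
lemma memHInf_iff {X : Time T → Ω → Vec d} :
    MemHInf F P X ↔
      IsOpt F X ∧ ∃ C : ℝ, 0 ≤ C ∧ ∀ᵐ ω ∂P, ∀ᵐ t ∂(leb T), ‖X t ω‖ ≤ C := by
  refine and_congr Iff.rfl ⟨fun h => ?_, ?_⟩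
  · refine ⟨(normHInf P X).toReal, ENNReal.toReal_nonneg, ?_⟩
    filter_upwards [ENNReal.ae_le_essSup
      (fun ω => essSup (fun t : Time T => ‖X t ω‖ₑ) (leb T)) (μ := P)] with ω hω
    filter_upwards [ENNReal.ae_le_essSup (fun t : Time T => ‖X t ω‖ₑ) (μ := leb T)] with t ht
    have := ENNReal.toReal_mono h.ne (ht.trans hω)
    simpa using this
  · rintro ⟨C, hC, h⟩
    refine lt_of_le_of_lt (essSup_le_of_ae_le (ENNReal.ofReal C) ?_) ENNReal.ofReal_lt_top
    filter_upwards [h] with ω hω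
    refine essSup_le_of_ae_le _ ?_
    filter_upwards [hω] with t ht
    rw [← ofReal_norm]
    exact ENNReal.ofReal_le_ofReal ht

lemma memHInf_of_bound {X : Time T → Ω → Vec d} (hX : IsOpt F X) {C : ℝ}
    (hC : ∀ t ω, ‖X t ω‖ ≤ C) : MemHInf F P X :=
  memHInf_iff.2 ⟨hX, max C 0, le_max_right _ _,
    .of_forall fun ω => .of_forall fun t => (hC t ω).trans (le_max_left _ _)⟩

lemma MemHInf.add {X Y : Time T → Ω → Vec d} (hX : MemHInf F P X) (hY : MemHInf F P Y) :
    MemHInf F P fun t ω => X t ω + Y t ω := by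
  obtain ⟨hXo, C, hC, hX⟩ := memHInf_iff.1 hX
  obtain ⟨hYo, D, hD, hY⟩ := memHInf_iff.1 hY
  refine memHInf_iff.2 ⟨hXo.comp₂ hYo measurable_add, C + D, by positivity, ?_⟩
  filter_upwards [hX, hY] with ω h1 h2
  filter_upwards [h1, h2] with t h3 h4
  exact (norm_add_le _ _).trans (add_le_add h3 h4)

lemma MemHInf.clm {d' : ℕ} {X : Time T → Ω → Vec d} (hX : MemHInf F P X)
    (L : Vec d →L[ℝ] Vec d') : MemHInf F P fun t ω => L (X t ω) := by
  obtain ⟨hXo, C, hC, hX⟩ := memHInf_iff.1 hX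
  refine memHInf_iff.2 ⟨hXo.comp L.measurable, ‖L‖ * C, by positivity, ?_⟩
  filter_upwards [hX] with ω h1
  filter_upwards [h1] with t h3
  exact (L.le_opNorm _).trans (mul_le_mul_of_nonneg_left h3 (norm_nonneg _))

lemma MemHInf.smul {X : Time T → Ω → Vec d} (hX : MemHInf F P X) (c : ℝ) :
    MemHInf F P fun t ω => c • X t ω :=
  hX.clm (c • ContinuousLinearMap.id ℝ (Vec d))

lemma MemHInf.sub {X Y : Time T → Ω → Vec d} (hX : MemHInf F P X) (hY : MemHInf F P Y) :
    MemHInf F P fun t ω => X t ω - Y t ω := by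
  simpa [sub_eq_add_neg] using hX.add (hY.smul (-1))

lemma memHInf_zero : MemHInf F P fun _ _ => (0 : Vec d) :=
  memHInf_of_bound (C := 0) measurable_const fun _ _ => by simp

lemma MemHInf.sum {ι : Type*} (s : Finset ι) {X : ι → Time T → Ω → Vec d}
    (hX : ∀ i, MemHInf F P (X i)) : MemHInf F P fun t ω => ∑ i ∈ s, X i t ω := by
  classical
  induction s using Finset.induction_on with
  | empty => simpa using memHInf_zero
  | insert a s ha ih =>
    simp_rw [Finset.sum_insert ha]
    exact (hX a).add ih

/-- Every process of class `H^∞` has a version that is bounded everywhere. -/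
lemma MemHInf.exists_bounded {X : Time T → Ω → Vec d} (hX : MemHInf F P X) :
    ∃ (Y : Time T → Ω → Vec d) (C : ℝ), IsOpt F Y ∧ (∀ t ω, ‖Y t ω‖ ≤ C) ∧
      ∀ᵐ ω ∂P, ∀ᵐ t ∂(leb T), Y t ω = X t ω := by
  obtain ⟨hXo, C, hC, hX⟩ := memHInf_iff.1 hX
  refine ⟨fun t ω => (Metric.closedBall (0 : Vec d) C).indicator id (X t ω), C,
    hXo.comp (measurable_id.indicator measurableSet_closedBall), fun t ω => ?_, ?_⟩
  · change ‖(Metric.closedBall (0 : Vec d) C).indicator id (X t ω)‖ ≤ C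
    by_cases h : X t ω ∈ Metric.closedBall (0 : Vec d) C
    · rw [Set.indicator_of_mem h]; simpa using h
    · rw [Set.indicator_of_notMem h]; simpa using hC
  · filter_upwards [hX] with ω h1
    filter_upwards [h1] with t h3
    rw [Set.indicator_of_mem (by simpa using h3)]
    rfl

lemma MemHInf.ae_integrable {X : Time T → Ω → Vec d} (hX : MemHInf F P X) :
    ∀ᵐ ω ∂P, Integrable (fun t => X t ω) (leb T) := by
  obtain ⟨hXo, C, hC, hX⟩ := memHInf_iff.1 hX
  filter_upwards [hX] with ω hω
  exact hXo.integrable_path hω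

/-- The primitive of a process of class `H^∞` is indistinguishable from a bounded continuous
adapted process. -/
lemma MemHInf.exists_primitive {X : Time T → Ω → Vec d} (hX : MemHInf F P X) :
    ∃ Y : Time T → Ω → Vec d, MemHInf F P Y ∧ (∀ ω, Continuous fun t => Y t ω) ∧
      (∃ C, ∀ t ω, ‖Y t ω‖ ≤ C) ∧ ∀ᵐ ω ∂P, ∀ t, Y t ω = primitive X t ω := by
  -- The primitive of `X` is known to be continuous only on almost every path. That of a bounded
  -- version is continuous on every path, which `isOpt_vec_of_continuous` requires.
  obtain ⟨X', C, hX', hC, h⟩ := hX.exists_bounded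
  have hb : ∀ t ω, ‖pathPrim (fun s => X' s ω) t‖ ≤ C * T := fun t ω =>
    norm_pathPrim_le (.of_forall fun s => hC s ω) t
  have hc : ∀ ω, Continuous fun t => pathPrim (fun s => X' s ω) t := fun ω =>
    continuous_pathPrim (hX'.integrable_path (.of_forall fun s => hC s ω))
  refine ⟨fun t ω => pathPrim (fun s => X' s ω) t,
    memHInf_of_bound (isOpt_vec_of_continuous hX'.stronglyAdapted_pathPrim hc) hb, hc,
    ⟨_, hb⟩, ?_⟩
  filter_upwards [h] with ω hω t
  exact congrFun (pathPrim_congr hω) t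

/-- Almost surely continuous processes of class `H^∞` are bounded uniformly in time. -/
lemma MemHInf.ae_bound (hT : 0 < T) {X : Time T → Ω → Vec d} (hX : MemHInf F P X)
    (hc : ∀ᵐ ω ∂P, Continuous fun t => X t ω) : ∃ C, 0 ≤ C ∧ ∀ᵐ ω ∂P, ∀ t, ‖X t ω‖ ≤ C := by
  obtain ⟨hXo, C, hC, hX⟩ := memHInf_iff.1 hX
  refine ⟨C, hC, ?_⟩
  have := leb_isOpenPosMeasure hT
  filter_upwards [hX, hc] with ω h1 h2 t
  have hd : Dense {t | ‖X t ω‖ ≤ C} := Measure.dense_of_ae h1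
  have hcl : IsClosed {t | ‖X t ω‖ ≤ C} := isClosed_le h2.norm continuous_const
  have := hd.closure_eq
  rw [hcl.closure_eq] at this
  exact this.ge (Set.mem_univ t)

/-- The exceptional set is made measurable so that, once null events lie in each `F t`, a process
can be set to zero on it without losing adaptedness. -/
lemma exists_null_of_ae {p : Ω → Prop} (h : ∀ᵐ ω ∂P, p ω) :
    ∃ A, MeasurableSet A ∧ P A = 0 ∧ ∀ ω ∉ A, p ω := by
  obtain ⟨A, hA, hAm, hA0⟩ := exists_measurable_superset_of_null (ae_iff.1 h)
  exact ⟨A, hAm, hA0, fun ω hω => by_contra fun hp => hω (hA hp)⟩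

lemma HasDynamics.ae_continuous {X a M : Time T → Ω → Vec d} (h : HasDynamics P X a M)
    (ha : ∀ᵐ ω ∂P, Integrable (fun t => a t ω) (leb T))
    (hM : ∀ᵐ ω ∂P, Continuous fun t => M t ω) : ∀ᵐ ω ∂P, Continuous fun t => X t ω := by
  filter_upwards [h, ha, hM] with ω h1 h2 h3
  have : (fun t => X t ω) =
      fun t => X (tStart T) ω + pathPrim (fun s => a s ω) t + (M t ω - M (tStart T) ω) :=
    funext h1
  rw [this]
  exact (continuous_const.add (continuous_pathPrim h2)).add (h3.sub continuous_const)

lemma ae_continuous_of_mem_classA {X : Time T → Ω → Vec d} (h : X ∈ classA d F P) :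
    ∀ᵐ ω ∂P, Continuous fun t => X t ω := by
  obtain ⟨⟨a, M, -, ha, hM, hd⟩, -⟩ := h
  exact hd.ae_continuous ha.ae_integrable hM.2.1

end HInf

/-! ### Linear structure of the admissible class. -/

section Convexity

variable {Ω : Type*} [mΩ : MeasurableSpace Ω] {T : ℝ≥0} {d : ℕ} {F : Filtration (Time T) mΩ}
  {P : Measure Ω}

lemma IsBoundedContMartingale.add {M N : Time T → Ω → Vec d}
    (hM : IsBoundedContMartingale F P M) (hN : IsBoundedContMartingale F P N) :
    IsBoundedContMartingale F P (M + N) :=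
  ⟨hM.1.add hN.1, by filter_upwards [hM.2.1, hN.2.1] with ω h1 h2 using h1.add h2,
    hM.2.2.add hN.2.2⟩

lemma IsBoundedContMartingale.smul {M : Time T → Ω → Vec d}
    (hM : IsBoundedContMartingale F P M) (c : ℝ) : IsBoundedContMartingale F P (c • M) :=
  ⟨hM.1.smul c, by filter_upwards [hM.2.1] with ω h1 using h1.const_smul c, hM.2.2.smul c⟩

lemma add_smul_mem_classA {X Y : Time T → Ω → Vec d} (hX : X ∈ classA d F P)
    (hY : Y ∈ classA d F P) (p q : ℝ) : p • X + q • Y ∈ classA d F P := by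
  obtain ⟨⟨a, M, hX1, ha, hM, hd⟩, hX0⟩ := hX
  obtain ⟨⟨b, N, hY1, hb, hN, he⟩, hY0⟩ := hY
  refine ⟨⟨fun t ω => p • a t ω + q • b t ω, p • M + q • N, (hX1.smul p).add (hY1.smul q),
    (ha.smul p).add (hb.smul q), (hM.smul p).add (hN.smul q), ?_⟩, ?_⟩
  · filter_upwards [hd, he, ha.ae_integrable, hb.ae_integrable] with ω h1 h2 h3 h4 t
    have h5 : primitive (fun t ω => p • a t ω + q • b t ω) t ω =
        p • primitive a t ω + q • primitive b t ω := by
      change pathPrim (fun s => p • a s ω + q • b s ω) t = _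
      rw [pathPrim_add (f := fun s => p • a s ω) (g := fun s => q • b s ω) (h3.smul p) (h4.smul q), pathPrim_smul, pathPrim_smul]; rfl
    simp only [Pi.add_apply, Pi.smul_apply]
    rw [h1 t, h2 t, h5]
    module
  · filter_upwards [hX0, hY0] with ω h1 h2
    simp [h1, h2]

lemma convex_classA : Convex ℝ (classA d F P) :=
  fun _ hX _ hY p q _ _ _ => add_smul_mem_classA hX hY p q

end Convexity

/-! ### Continuous versions of closed martingales and their stability under L¹ limits. -/

section ContinuousVersions

variable {Ω : Type*} [mΩ : MeasurableSpace Ω] {T : ℝ≥0} {F : Filtration (Time T) mΩ}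
  {P : Measure Ω}

/-- The martingale closed by `ξ` has an adapted version with continuous paths. -/
def HasContVersion (F : Filtration (Time T) mΩ) (P : Measure Ω) (ξ : Ω → ℝ) : Prop :=
  ∃ N : Time T → Ω → ℝ, StronglyAdapted F N ∧ (∀ ω, Continuous fun t => N t ω) ∧
    ∀ t, N t =ᵐ[P] P[ξ | F t]

lemma martingale_of_condExp [IsFiniteMeasure P] {N : Time T → Ω → ℝ} {ξ : Ω → ℝ}
    (hN : StronglyAdapted F N) (h : ∀ t, N t =ᵐ[P] P[ξ | F t]) : Martingale N F P := by
  refine ⟨hN, fun i j hij => ?_⟩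
  exact (condExp_congr_ae (h j)).trans
    ((condExp_condExp_of_le (F.mono hij) (F.le j)).trans (h i).symm)

/-- Uniform grids of mesh T/n, frozen at T after the index n. They reduce a maximum over [0,T] to
finite maxima, to which the discrete maximal inequality applies. -/
lemma exists_grid_subset (hT : 0 < T) :
    ∃ τ : ℕ → ℕ → Time T, (∀ n, Monotone (τ n)) ∧
      ∀ U : Set (Time T), IsOpen U → U.Nonempty → ∀ᶠ n in Filter.atTop, ∃ i ≤ n, τ n i ∈ U := by
  have hT' : (0 : ℝ) < T := hT
  refine ⟨fun n i => Set.projIcc (0 : ℝ) T T.coe_nonneg (i * (T / n)),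
    fun n i j hij => Set.monotone_projIcc _ (by gcongr), fun U hU hne => ?_⟩
  obtain ⟨x, hx⟩ := hne
  let i : ℕ → ℕ := fun n => ⌊(x : ℝ) / (T / n)⌋₊
  have hx0 : (0 : ℝ) ≤ x := x.2.1
  have hi : Filter.Tendsto (fun n : ℕ => Set.projIcc (0 : ℝ) T T.coe_nonneg (i n * (T / n)))
      Filter.atTop (nhds x) := by
    have h1 : Filter.Tendsto (fun n : ℕ => (i n : ℝ) * (T / n)) Filter.atTop (nhds (x : ℝ)) := by
      have h0 : Filter.Tendsto (fun n : ℕ => (x : ℝ) - T / n) Filter.atTop (nhds (x : ℝ)) := by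
        simpa using (tendsto_const_nhds (x := (x : ℝ))).sub (tendsto_const_div_atTop_nhds_zero_nat (T : ℝ))
      refine tendsto_of_tendsto_of_tendsto_of_le_of_le' h0 tendsto_const_nhds ?_ ?_
      · filter_upwards [Filter.eventually_gt_atTop 0] with n hn
        have hn' : (0 : ℝ) < T / n := by positivity
        have := Nat.lt_floor_add_one ((x : ℝ) / (T / n))
        rw [div_lt_iff₀ hn'] at this
        change (x : ℝ) - T / n ≤ (⌊(x : ℝ) / (T / n)⌋₊ : ℝ) * (T / n)
        linarith
      · filter_upwards [Filter.eventually_gt_atTop 0] with n hn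
        have hn' : (0 : ℝ) < T / n := by positivity
        have := Nat.floor_le (a := (x : ℝ) / (T / n)) (by positivity)
        rwa [le_div_iff₀ hn'] at this
    have h2 := (continuous_projIcc (h := T.coe_nonneg)).continuousAt.tendsto.comp h1
    rwa [Set.projIcc_val] at h2
  filter_upwards [hi.eventually (hU.mem_nhds hx), Filter.eventually_gt_atTop 0] with n hn hn0
  refine ⟨i n, ?_, hn⟩
  have hn' : (0 : ℝ) < T / n := by positivity
  refine Nat.floor_le_of_le ?_
  rw [div_le_iff₀ hn', mul_div_cancel₀ _ (by positivity)]
  exact x.2.2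

/-- Doob's maximal inequality for continuous martingales on `[0,T]`. -/
lemma measure_exists_lt_abs_le [IsFiniteMeasure P] (hT : 0 < T) {N : Time T → Ω → ℝ} {ξ : Ω → ℝ}
    (hN : StronglyAdapted F N) (hc : ∀ ω, Continuous fun t => N t ω)
    (h : ∀ t, N t =ᵐ[P] P[ξ | F t]) {ε : ℝ≥0} (hε : 0 < ε) :
    P {ω | ∃ t, (ε : ℝ) < |N t ω|} ≤ ENNReal.ofReal (∫ ω, |ξ ω| ∂P) / ε := by
  obtain ⟨τ, hτ, hgrid⟩ := exists_grid_subset hT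
  have hmart := martingale_of_condExp hN h
  let A : ℕ → Set Ω := fun n =>
    {ω | (ε : ℝ) ≤ (Finset.range (n + 1)).sup' Finset.nonempty_range_add_one
      fun k => |N (τ n k) ω|}
  have hA : ∀ n, P (A n) ≤ ENNReal.ofReal (∫ ω, |ξ ω| ∂P) / ε := fun n => by
    let G : Filtration ℕ mΩ := ⟨fun i => F (τ n i), fun i j hij => F.mono (hτ n hij),
      fun i => F.le _⟩
    have hm : Martingale (fun i => N (τ n i)) G P :=
      ⟨fun i => hN _, fun i j hij => hmart.2 _ _ (hτ n hij)⟩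
    have hs : Submartingale (fun i ω => |N (τ n i) ω|) G P :=
      hm.submartingale.sup hm.neg.submartingale
    have := maximal_ineq hs (fun i ω => abs_nonneg _) (ε := ε) n
    rw [ENNReal.le_div_iff_mul_le (.inl (by simpa using hε.ne')) (.inl (by simp)), mul_comm]
    refine this.trans (ENNReal.ofReal_le_ofReal ?_)
    refine (setIntegral_le_integral (hs.integrable n) (.of_forall fun ω => abs_nonneg _)).trans ?_
    refine (integral_congr_ae ?_).trans_le (integral_abs_condExp_le (m := F (τ n n)) ξ)
    filter_upwards [h (τ n n)] with ω hω
    rw [hω]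
  -- The inequality is strict and the path continuous, so it holds on an open set of times, which
  -- all sufficiently fine grids meet. The event thus lies in the lower limit of the `A n`, whose
  -- probabilities share one bound.
  have hsub : {ω | ∃ t, (ε : ℝ) < |N t ω|} ⊆ ⋃ n, ⋂ m ≥ n, A m := by
    rintro ω ⟨t, ht⟩
    have hU : IsOpen {t | (ε : ℝ) < |N t ω|} := isOpen_lt continuous_const (hc ω).abs
    obtain ⟨n, hn⟩ := Filter.eventually_atTop.1 (hgrid _ hU ⟨t, ht⟩)
    refine Set.mem_iUnion.2 ⟨n, Set.mem_iInter₂.2 fun m hm => ?_⟩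
    obtain ⟨i, him, hi⟩ := hn m hm
    exact (le_of_lt hi).trans (Finset.le_sup' (fun k => |N (τ m k) ω|)
      (Finset.mem_range.2 (Nat.lt_succ_of_le him)))
  refine (measure_mono hsub).trans ?_
  have hmono : Monotone fun n => ⋂ m ≥ n, A m := fun i j hij =>
    Set.biInter_mono (fun m hm => le_trans hij hm) fun _ _ => le_rfl
  rw [hmono.measure_iUnion]
  refine iSup_le fun n => (measure_mono (Set.biInter_subset_of_mem (le_refl n))).trans (hA n)

lemma HasContVersion.congr {ξ η : Ω → ℝ} (h : HasContVersion F P ξ) (hξ : ξ =ᵐ[P] η) :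
    HasContVersion F P η := by
  obtain ⟨N, h1, h2, h3⟩ := h
  exact ⟨N, h1, h2, fun t => (h3 t).trans (condExp_congr_ae hξ)⟩

lemma HasContVersion.add {ξ η : Ω → ℝ} (h : HasContVersion F P ξ) (h' : HasContVersion F P η)
    (hξ : Integrable ξ P) (hη : Integrable η P) : HasContVersion F P (ξ + η) := by
  obtain ⟨N, h1, h2, h3⟩ := h
  obtain ⟨N', h1', h2', h3'⟩ := h'
  exact ⟨N + N', h1.add h1', fun ω => (h2 ω).add (h2' ω),
    fun t => ((h3 t).add (h3' t)).trans (condExp_add hξ hη _).symm⟩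

lemma HasContVersion.smul {ξ : Ω → ℝ} (h : HasContVersion F P ξ) (c : ℝ) :
    HasContVersion F P (c • ξ) := by
  obtain ⟨N, h1, h2, h3⟩ := h
  exact ⟨c • N, h1.smul c, fun ω => (h2 ω).const_smul c,
    fun t => ((h3 t).const_smul c).trans (condExp_smul c ξ _).symm⟩

lemma hasContVersion_const [IsFiniteMeasure P] (c : ℝ) : HasContVersion F P fun _ => c :=
  ⟨fun _ _ => c, fun _ => stronglyMeasurable_const, fun _ => continuous_const,
    fun t => by rw [condExp_const (F.le t)]⟩

/-- The class of random variables whose closed martingale has a continuous version is closed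
under limits in `L¹`. -/
lemma HasContVersion.of_tendsto [IsFiniteMeasure P] (hT : 0 < T)
    (hnull : ∀ A, MeasurableSet A → P A = 0 → ∀ t, MeasurableSet[F t] A)
    {ξ : ℕ → Ω → ℝ} {η : Ω → ℝ} (h : ∀ n, HasContVersion F P (ξ n))
    (hξ : ∀ n, Integrable (ξ n) P) (hη : Integrable η P)
    (hlim : Filter.Tendsto (fun n => ∫ ω, |ξ n ω - η ω| ∂P) Filter.atTop (nhds 0)) :
    HasContVersion F P η := by
  -- Along this subsequence consecutive L¹ distances are at most 2·4^{-k}. Doob's inequality at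
  -- level 2^{-k} then gives probabilities at most 2·2^{-k}, which are summable.
  obtain ⟨φ, hφ⟩ : ∃ φ : ℕ → ℕ, ∀ k, ∫ ω, |ξ (φ k) ω - η ω| ∂P < (1 / 4 : ℝ) ^ k := by
    choose φ hφ using fun k : ℕ => (hlim.eventually (gt_mem_nhds
      (show (0 : ℝ) < (1 / 4 : ℝ) ^ k by positivity))).exists
    exact ⟨φ, hφ⟩
  choose N hN hc hN' using fun k => h (φ k)
  have hdiff : ∀ k, ∫ ω, |(ξ (φ (k + 1)) - ξ (φ k)) ω| ∂P ≤ 2 * (1 / 4 : ℝ) ^ k := fun k => by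
    have hi : ∀ n, Integrable (fun ω => |ξ n ω - η ω|) P := fun n => ((hξ n).sub hη).abs
    calc ∫ ω, |(ξ (φ (k + 1)) - ξ (φ k)) ω| ∂P
        ≤ ∫ ω, (|ξ (φ (k + 1)) ω - η ω| + |ξ (φ k) ω - η ω|) ∂P := by
          refine integral_mono ((hξ _).sub (hξ _)).abs ((hi _).add (hi _)) fun ω => ?_
          change |ξ (φ (k + 1)) ω - ξ (φ k) ω| ≤ |ξ (φ (k + 1)) ω - η ω| + |ξ (φ k) ω - η ω|
          rw [abs_sub_comm (ξ (φ k) ω)]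
          exact abs_sub_le _ _ _
      _ = ∫ ω, |ξ (φ (k + 1)) ω - η ω| ∂P + ∫ ω, |ξ (φ k) ω - η ω| ∂P :=
          integral_add (hi _) (hi _)
      _ ≤ (1 / 4 : ℝ) ^ (k + 1) + (1 / 4 : ℝ) ^ k := add_le_add (hφ _).le (hφ _).le
      _ ≤ 2 * (1 / 4 : ℝ) ^ k := by
          rw [pow_succ]; nlinarith [show (0 : ℝ) < (1 / 4 : ℝ) ^ k by positivity]
  let B : ℕ → Set Ω := fun k => {ω | ∃ t, (((1 / 2 : ℝ≥0) ^ k : ℝ≥0) : ℝ) <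
    |N (k + 1) t ω - N k t ω|}
  have hB : ∀ k, P (B k) ≤ 2 * (1 / 2 : ℝ≥0∞) ^ k := fun k => by
    have h1 := measure_exists_lt_abs_le (P := P) hT (N := N (k + 1) - N k)
      (ξ := ξ (φ (k + 1)) - ξ (φ k)) ((hN _).sub (hN _))
      (fun ω => (hc _ ω).sub (hc _ ω))
      (fun t => ((hN' (k + 1) t).sub (hN' k t)).trans (condExp_sub (hξ _) (hξ _) _).symm)
      (ε := (1 / 2 : ℝ≥0) ^ k) (by positivity)
    refine h1.trans ?_
    rw [ENNReal.div_le_iff_le_mul (.inl (by simp)) (.inl (by simp))]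
    refine (ENNReal.ofReal_le_ofReal (hdiff k)).trans_eq ?_
    rw [mul_assoc, ENNReal.coe_pow, ← mul_pow, ENNReal.ofReal_mul (by norm_num),
      ENNReal.ofReal_pow (by norm_num)]
    congr 1
    · simp
    · congr 1
      rw [show (1 / 4 : ℝ) = 1 / 2 * (1 / 2) by norm_num, ENNReal.ofReal_mul (by norm_num),
        ENNReal.ofReal_div_of_pos (by norm_num)]
      simp
  have hsum : ∑' k, P (B k) ≠ ∞ := by
    refine ne_top_of_le_ne_top ?_ (ENNReal.tsum_le_tsum hB)
    rw [ENNReal.tsum_mul_left, ENNReal.tsum_geometric]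
    simpa using ENNReal.mul_ne_top ENNReal.ofNat_ne_top ENNReal.ofNat_ne_top
  -- Borel–Cantelli: almost every sequence of paths is eventually Cauchy in the uniform norm, at a
  -- geometric rate, so its limit is continuous.
  have hgood : ∀ᵐ ω ∂P, ∃ g : C(Time T, ℝ), ∀ t,
      Filter.Tendsto (fun k => N k t ω) Filter.atTop (nhds (g t)) := by
    filter_upwards [ae_eventually_notMem hsum] with ω hω
    obtain ⟨K, hK⟩ := Filter.eventually_atTop.1 hω
    let f : ℕ → C(Time T, ℝ) := fun k => ⟨fun t => N (k + K) t ω, hc _ ω⟩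
    have hf : ∀ k, dist (f k) (f (k + 1)) ≤ 1 * (1 / 2 : ℝ) ^ k := fun k => by
      rw [ContinuousMap.dist_le (by positivity)]
      intro t
      have h2 : ¬ ∃ t, (((1 / 2 : ℝ≥0) ^ (k + K) : ℝ≥0) : ℝ) <
          |N (k + K + 1) t ω - N (k + K) t ω| := hK (k + K) (by omega)
      push Not at h2
      have h3 := h2 t
      change dist (N (k + K) t ω) (N (k + 1 + K) t ω) ≤ _
      rw [dist_comm, Real.dist_eq, show k + 1 + K = k + K + 1 by ring]
      refine h3.trans ?_
      push_cast
      rw [one_mul]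
      exact pow_le_pow_of_le_one (by norm_num) (by norm_num) (by omega)
    obtain ⟨g, hg⟩ := cauchySeq_tendsto_of_complete (cauchySeq_of_le_geometric _ _ (by norm_num) hf)
    refine ⟨g, fun t => ?_⟩
    have h4 := ((continuous_eval_const (F := C(Time T, ℝ)) t).tendsto g).comp hg
    exact (Filter.tendsto_add_atTop_iff_nat K).1 h4
  obtain ⟨A, hAm, hA0, hA⟩ := exists_null_of_ae hgood
  choose! g hg using hA
  -- The limit is set to zero on the exceptional null set, which belongs to every `F t` by `hnull`;
  -- so `M` is continuous everywhere and still adapted.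
  let M : Time T → Ω → ℝ := fun t => Aᶜ.indicator fun ω => g ω t
  have hMlim : ∀ t ω, Filter.Tendsto (fun k => Aᶜ.indicator (N k t) ω) Filter.atTop
      (nhds (M t ω)) := fun t ω => by
    by_cases hω : ω ∈ A
    · simp [M, hω]
    · simpa [M, hω] using hg ω hω t
  refine ⟨M, fun t => ?_, fun ω => ?_, fun t => ?_⟩
  · exact stronglyMeasurable_of_tendsto _
      (fun k => (hN k t).indicator (hnull A hAm hA0 t).compl) (tendsto_pi_nhds.2 (hMlim t))
  · by_cases hω : ω ∈ A
    · simpa [M, hω] using continuous_const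
    · simpa [M, hω] using (g ω).continuous
  · have hae : ∀ᵐ ω ∂P, ω ∉ A := measure_eq_zero_iff_ae_notMem.1 hA0
    -- At a fixed time `N k t` tends to `M t` almost surely and to the conditional expectation of
    -- `η` in L¹, by contractivity; limits in measure are unique.
    have h1 : TendstoInMeasure P (fun k => N k t) Filter.atTop (M t) := by
      refine tendstoInMeasure_of_tendsto_ae
        (fun k => ((hN k t).mono (F.le t)).aestronglyMeasurable) ?_
      filter_upwards [hae] with ω hω
      simpa [hω] using hMlim t ω
    have h2 : TendstoInMeasure P (fun k => N k t) Filter.atTop (P[η | F t]) := by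
      refine tendstoInMeasure_of_tendsto_eLpNorm one_ne_zero
        (fun k => ((hN k t).mono (F.le t)).aestronglyMeasurable)
        (stronglyMeasurable_condExp.mono (F.le t)).aestronglyMeasurable ?_
      have hle : ∀ k, eLpNorm (N k t - P[η | F t]) 1 P ≤ ENNReal.ofReal ((1 / 4 : ℝ) ^ k) :=
        fun k => by
        have h3 : N k t - P[η | F t] =ᵐ[P] P[ξ (φ k) - η | F t] :=
          ((hN' k t).sub (Filter.EventuallyEq.refl _ _)).trans (condExp_sub (hξ _) hη _).symm
        rw [eLpNorm_congr_ae h3]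
        refine (eLpNorm_condExp_le_eLpNorm _ le_rfl).trans ?_
        rw [eLpNorm_one_eq_lintegral_enorm,
          ← ofReal_integral_norm_eq_lintegral_enorm ((hξ _).sub hη)]
        exact ENNReal.ofReal_le_ofReal (hφ k).le
      refine tendsto_of_tendsto_of_tendsto_of_le_of_le tendsto_const_nhds ?_
        (fun _ => zero_le) hle
      have := ENNReal.tendsto_ofReal (tendsto_pow_atTop_nhds_zero_of_lt_one
        (show (0 : ℝ) ≤ 1 / 4 by norm_num) (by norm_num))
      simpa using this
    exact tendstoInMeasure_ae_unique h1 h2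

lemma HasContVersion.of_tendsto_of_bound [IsFiniteMeasure P] (hT : 0 < T)
    (hnull : ∀ A, MeasurableSet A → P A = 0 → ∀ t, MeasurableSet[F t] A)
    {ξ : ℕ → Ω → ℝ} {η : Ω → ℝ} {C : ℝ} (h : ∀ n, HasContVersion F P (ξ n))
    (hm : ∀ n, AEStronglyMeasurable (ξ n) P) (hC : ∀ n ω, ‖ξ n ω‖ ≤ C)
    (hlim : ∀ ω, Filter.Tendsto (fun n => ξ n ω) Filter.atTop (nhds (η ω))) :
    HasContVersion F P η := by
  have hηm : AEStronglyMeasurable η P :=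
    aestronglyMeasurable_of_tendsto_ae _ hm (.of_forall hlim)
  have hηC : ∀ ω, ‖η ω‖ ≤ C := fun ω =>
    le_of_tendsto (hlim ω).norm (.of_forall fun n => hC n ω)
  have hξi : ∀ n, Integrable (ξ n) P := fun n => .of_bound (hm n) C (.of_forall (hC n))
  have hηi : Integrable η P := .of_bound hηm C (.of_forall hηC)
  refine HasContVersion.of_tendsto hT hnull h hξi hηi ?_
  have := tendsto_integral_of_dominated_convergence (μ := P)
    (F := fun n ω => |ξ n ω - η ω|) (f := fun _ => 0) (fun _ => C + C)
    (fun n => ((hξi n).sub hηi).abs.aestronglyMeasurable) (integrable_const _)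
    (fun n => .of_forall fun ω => ?_) (.of_forall fun ω => ?_)
  · simpa using this
  · rw [Real.norm_eq_abs, abs_abs]
    exact (norm_sub_le _ _).trans (add_le_add (hC n ω) (hηC ω))
  · simpa using ((hlim ω).sub_const (η ω)).abs

end ContinuousVersions

/-! ### Bounded martingales of the augmented Brownian filtration have continuous versions. -/

section Brownian

variable {Ω : Type*} [mΩ : MeasurableSpace Ω] {T : ℝ≥0} {d : ℕ}
  {P : Measure Ω} [IsProbabilityMeasure P] {W : Time T → Ω → Fin d → ℝ}

/-- A finite set of times is covered by a monotone sequence. -/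
lemma exists_monotone_cover {α : Type*} [LinearOrder α] (K : Finset α) (hK : K.Nonempty) :
    ∃ τ : ℕ → α, Monotone τ ∧ ∀ x ∈ K, ∃ n, τ n = x := by
  have hpos : 0 < K.card := hK.card_pos
  refine ⟨fun n => K.orderEmbOfFin rfl ⟨min n (K.card - 1), by omega⟩, fun i j hij => ?_,
    fun x hx => ?_⟩
  · refine (K.orderEmbOfFin rfl).monotone ?_
    simp only [Fin.mk_le_mk]
    omega
  · obtain ⟨i, hi⟩ : ∃ i, K.orderEmbOfFin rfl i = x := by
      have : x ∈ Set.range (K.orderEmbOfFin rfl) := by simpa using hx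
      exact this
    refine ⟨i, hi ▸ congrArg _ (Fin.ext ?_)⟩
    change min (i : ℕ) (K.card - 1) = i
    omega

-- All times involved, with 0 and `t` added, are listed in one monotone sequence. As `W` starts at
-- 0, values up to `t` are sums of the increments with index below `kt`; increments after `t` are
-- sums of those with index at least `kt`. Disjoint blocks of independent increments are
-- independent.
omit [IsProbabilityMeasure P] in
lemma indepFun_past_increments_finset (hW : IsStandardBrownian W P) (t : Time T)
    (J : Finset (Set.Iic t)) (I : Finset (Time T)) :
    IndepFun (fun ω (j : J) => W (j : Set.Iic t) ω)
      (fun ω (s : I) => W s ω - W (min (s : Time T) t) ω) P := by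
  classical
  obtain ⟨τ, hτ, hcov⟩ := exists_monotone_cover
    (insert (tStart T) (insert t (J.image Subtype.val ∪ I))) ⟨_, Finset.mem_insert_self _ _⟩
  obtain ⟨k₀, hk₀⟩ := hcov (tStart T) (Finset.mem_insert_self _ _)
  have hτ0 : τ 0 = tStart T := le_antisymm ((hτ (Nat.zero_le k₀)).trans_eq hk₀) (tStart_le _)
  obtain ⟨kt, hkt⟩ := hcov t (by simp)
  have hJ : ∀ j : J, ∃ k, τ k = (j : Set.Iic t) := fun j => hcov _
    (Finset.mem_insert_of_mem (Finset.mem_insert_of_mem (Finset.mem_union_left _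
      (Finset.mem_image_of_mem _ j.2))))
  have hI : ∀ s : I, ∃ k, τ k = s := fun s => hcov _ (by simp)
  choose kJ hkJ using hJ
  choose kI hkI using hI
  obtain ⟨M, hM⟩ : ∃ M, ∀ s, kI s ≤ M := ⟨Finset.univ.sup kI, fun s => Finset.le_sup (by simp)⟩
  set D : ℕ → Ω → Fin d → ℝ := fun i ω => W (τ (i + 1)) ω - W (τ i) ω with hD
  have hDm : ∀ i, Measurable (D i) := fun i => (hW.measurable _).sub (hW.measurable _)
  have hind : iIndepFun D P := hW.indep_increments.nat hτ
  have hdisj : Disjoint (Finset.range kt) (Finset.Ico kt (max kt M)) := by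
    rw [Finset.disjoint_left]
    intro a ha hb
    simp only [Finset.mem_range, Finset.mem_Ico] at ha hb
    omega
  have h1 := hind.indepFun_finset _ _ hdisj hDm
  let f : (Finset.range kt → Fin d → ℝ) → J → Fin d → ℝ := fun x j =>
    ∑ i : Finset.range kt, if (i : ℕ) < kJ j then x i else 0
  let g : (Finset.Ico kt (max kt M) → Fin d → ℝ) → I → Fin d → ℝ := fun x s =>
    ∑ i : Finset.Ico kt (max kt M), if (i : ℕ) < kI s then x i else 0
  have hf : Measurable f := by
    refine measurable_pi_lambda _ fun j => Finset.measurable_sum _ fun i _ => ?_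
    split_ifs
    · exact measurable_pi_apply i
    · exact measurable_const
  have hg : Measurable g := by
    refine measurable_pi_lambda _ fun j => Finset.measurable_sum _ fun i _ => ?_
    split_ifs
    · exact measurable_pi_apply i
    · exact measurable_const
  refine (h1.comp hf hg).congr ?_ ?_
  · filter_upwards [hW.start] with ω hω
    funext j
    change (∑ i : Finset.range kt, if (i : ℕ) < kJ j then D i ω else 0) = _
    rw [Finset.sum_coe_sort (Finset.range kt) (fun i => if i < kJ j then D i ω else 0),
      ← Finset.sum_filter]
    have : (Finset.range kt).filter (fun i => i < kJ j) = Finset.range (min kt (kJ j)) := by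
      ext i; simp
    rw [this, Finset.sum_range_sub (fun i => W (τ i) ω), hτ0, hω, sub_zero, hτ.map_min, hkt,
      hkJ, min_eq_right (show ((j : Set.Iic t) : Time T) ≤ t from j.1.2)]
  · refine .of_forall fun ω => ?_
    funext s
    change (∑ i : Finset.Ico kt (max kt M), if (i : ℕ) < kI s then D i ω else 0) = _
    rw [Finset.sum_coe_sort (Finset.Ico kt (max kt M)) (fun i => if i < kI s then D i ω else 0),
      ← Finset.sum_filter]
    have : (Finset.Ico kt (max kt M)).filter (fun i => i < kI s) =
        Finset.Ico kt (max kt (kI s)) := by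
      ext i
      have := hM s
      simp only [Finset.mem_filter, Finset.mem_Ico]
      omega
    rw [this, Finset.sum_Ico_sub (fun i => W (τ i) ω) (le_max_left _ _), hτ.map_max, hkt, hkI]
    change _ = W s ω - W (min (s : Time T) t) ω
    rcases le_total (s : Time T) t with h | h
    · rw [max_eq_left h, min_eq_left h]; simp
    · rw [max_eq_right h, min_eq_right h]

/-- The path of `W` up to time `t` is independent of the increments of `W` after time `t`. -/
lemma indepFun_past_increments (hW : IsStandardBrownian W P) (t : Time T) (I : Finset (Time T)) :
    IndepFun (fun ω (u : Set.Iic t) => W u ω)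
      (fun ω (s : I) => W s ω - W (min (s : Time T) t) ω) P :=
  IndepFun.process_indepFun (fun i => hW.measurable i)
    (measurable_pi_lambda _ fun _ => (hW.measurable _).sub (hW.measurable _))
    fun J => indepFun_past_increments_finset hW t J I

omit [IsProbabilityMeasure P] in
/-- Events of the augmented filtration agree almost surely with events of the raw one. -/
lemma exists_ae_eq_of_measurableSet_augmented (hW : ∀ t, Measurable (W t)) (t : Time T)
    {A : Set Ω} (hA : MeasurableSet[augmentedFiltration W hW P t] A) :
    ∃ C : Set (Set.Iic t → Fin d → ℝ), MeasurableSet C ∧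
      A =ᵐ[P] (fun ω (u : Set.Iic t) => W u ω) ⁻¹' C := by
  -- The sets almost surely equal to a raw path event already form a σ-algebra, so only the
  -- generators need checking; a null event is equivalent to ∅.
  have hle : augmentedFiltration W hW P t ≤ eventuallyMeasurableSpace
      (MeasurableSpace.comap (fun ω (u : Set.Iic t) => W u ω) MeasurableSpace.pi) (ae P) := by
    refine sup_le (iSup₂_le fun s hs => ?_) (MeasurableSpace.generateFrom_le fun B hB => ?_)
    · rintro - ⟨C, hC, rfl⟩
      exact ⟨_, ⟨Function.eval (⟨s, hs⟩ : Set.Iic t) ⁻¹' C, measurable_pi_apply _ hC, rfl⟩,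
        Filter.EventuallyEq.refl _ _⟩
    · exact ⟨∅, @MeasurableSet.empty _ (_), ae_eq_empty.2 hB.2⟩
  obtain ⟨B, ⟨C, hC, rfl⟩, hB⟩ := hle A hA
  exact ⟨C, hC, hB⟩

omit [IsProbabilityMeasure P] in
lemma measurable_augmented (hW : ∀ t, Measurable (W t)) {s t : Time T} (hst : s ≤ t) :
    Measurable[augmentedFiltration W hW P t] (W s) := by
  rw [measurable_iff_comap_le]
  exact le_sup_of_le_left (le_iSup₂_of_le s hst le_rfl)

omit [IsProbabilityMeasure P] in
lemma measurableSet_augmented_of_null (hW : ∀ t, Measurable (W t)) {A : Set Ω}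
    (hA : MeasurableSet A) (h0 : P A = 0) (t : Time T) :
    MeasurableSet[augmentedFiltration W hW P t] A := by
  have h : MeasurableSpace.generateFrom {A : Set Ω | MeasurableSet A ∧ P A = 0} ≤
      augmentedFiltration W hW P t := le_sup_right
  exact h A (MeasurableSpace.measurableSet_generateFrom ⟨hA, h0⟩)

/-- The martingale closed by a bounded continuous function of finitely many values of `W`. -/
lemma hasContVersion_cylinder (hW : IsStandardBrownian W P) (I : Finset (Time T))
    (f : (I → Fin d → ℝ) →ᵇ ℝ) :
    HasContVersion (augmentedFiltration W hW.measurable P) P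
      fun ω => f fun s : I => W s ω := by
  -- The values of `W` split as `X t + Y t`, with `X t` known at time `t` and `Y t` independent of
  -- the past. The conditional expectation is therefore `g t (X t)`, where `g t` averages over `Y t`
  -- alone; it is continuous in `t` because `f` is bounded and continuous.
  let X : Time T → Ω → I → Fin d → ℝ := fun t ω s => W (min (s : Time T) t) ω
  let Y : Time T → Ω → I → Fin d → ℝ := fun t ω s => W s ω - W (min (s : Time T) t) ω
  have hYm : ∀ t, Measurable (Y t) := fun t =>
    measurable_pi_lambda _ fun s => (hW.measurable _).sub (hW.measurable _)
  let g : Time T → (I → Fin d → ℝ) → ℝ := fun t x => ∫ ω', f (x + Y t ω') ∂P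
  have hgm : ∀ t, StronglyMeasurable (g t) := fun t =>
    StronglyMeasurable.integral_prod_right (f := fun x ω' => f (x + Y t ω'))
      (f.continuous.measurable.comp
        (measurable_fst.add ((hYm t).comp measurable_snd))).stronglyMeasurable
  obtain ⟨A, hAm, hA0, hA⟩ := exists_null_of_ae hW.continuous_paths
  have hXm : ∀ t, Measurable[augmentedFiltration W hW.measurable P t] (X t) := fun t =>
    @measurable_pi_lambda _ _ _ (augmentedFiltration W hW.measurable P t) _ _
      fun s => measurable_augmented hW.measurable (min_le_right _ _)
  have hbound : ∀ t x, ‖g t x‖ ≤ ‖f‖ := fun t x => by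
    refine (norm_integral_le_of_norm_le_const (.of_forall fun ω' => f.norm_coe_le_norm _)).trans ?_
    simp
  have hae : ∀ᵐ ω ∂P, ω ∉ A := measure_eq_zero_iff_ae_notMem.1 hA0
  refine ⟨fun t => Aᶜ.indicator fun ω => g t (X t ω), fun t => ?_, fun ω => ?_, fun t => ?_⟩
  · exact ((hgm t).comp_measurable (hXm t)).indicator
      (measurableSet_augmented_of_null hW.measurable hAm hA0 t).compl
  · by_cases hω : ω ∈ A
    · simpa [hω] using continuous_const
    · simp only [Set.indicator_of_mem (show ω ∈ Aᶜ from hω)]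
      refine continuous_of_dominated (bound := fun _ => ‖f‖) (fun t => ?_)
        (fun t => .of_forall fun ω' => f.norm_coe_le_norm _) (integrable_const _) ?_
      · exact (f.continuous.measurable.comp (measurable_const.add (hYm t))).aestronglyMeasurable
      · filter_upwards [hW.continuous_paths] with ω' hω'
        refine f.continuous.comp (continuous_pi fun s => ?_)
        have hmin : Continuous fun t : Time T => min (s : Time T) t := continuous_const.min continuous_id
        exact ((hA ω hω).comp hmin).add (continuous_const.sub (hω'.comp hmin))
  · have hN : (Aᶜ.indicator fun ω => g t (X t ω)) =ᵐ[P] fun ω => g t (X t ω) := by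
      filter_upwards [hae] with ω hω
      simp [hω]
    refine hN.trans ?_
    have hfm : Measurable fun ω => f fun s : I => W s ω :=
      f.continuous.measurable.comp (measurable_pi_lambda _ fun s => hW.measurable s)
    have hgXm := (hgm t).comp_measurable (hXm t)
    refine ae_eq_condExp_of_forall_setIntegral_eq ((augmentedFiltration W hW.measurable P).le t)
      (Integrable.of_bound hfm.aestronglyMeasurable ‖f‖ (.of_forall fun ω => f.norm_coe_le_norm _))
      (fun s _ _ => (Integrable.of_bound
        (hgXm.mono ((augmentedFiltration W hW.measurable P).le t)).aestronglyMeasurable ‖f‖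
        (.of_forall fun ω => hbound _ _)).integrableOn) (fun B hB _ => ?_)
      hgXm.aestronglyMeasurable
    obtain ⟨C, hC, hBC⟩ := exists_ae_eq_of_measurableSet_augmented hW.measurable t hB
    let Z : Ω → Set.Iic t → Fin d → ℝ := fun ω u => W u ω
    have hZm : Measurable Z := measurable_pi_lambda _ fun u => hW.measurable u
    let pr : (Set.Iic t → Fin d → ℝ) → I → Fin d → ℝ := fun z s =>
      z ⟨min (s : Time T) t, Set.mem_Iic.2 (min_le_right _ _)⟩
    have hpr : Measurable pr := measurable_pi_lambda _ fun s => measurable_pi_apply _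
    rw [setIntegral_congr_set hBC, setIntegral_congr_set hBC,
      ← integral_indicator (hZm hC), ← integral_indicator (hZm hC)]
    have hind := indepFun_past_increments hW t I
    rw [indepFun_iff_map_prod_eq_prod_map_map hZm.aemeasurable (hYm t).aemeasurable] at hind
    -- After passing to a raw path event `C`, both set integrals equal the integral of `Φ` against
    -- the product law of past path and later increments: one by independence, the other by Fubini.
    let Φ : (Set.Iic t → Fin d → ℝ) × (I → Fin d → ℝ) → ℝ := fun p =>
      C.indicator (fun z => f (pr z + p.2)) p.1
    have hΦ : Measurable Φ := by
      have : Φ = (Prod.fst ⁻¹' C).indicator fun p => f (pr p.1 + p.2) := by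
        funext p
        by_cases h : p.1 ∈ C <;> simp [Φ, h]
      rw [this]
      exact (f.continuous.measurable.comp ((hpr.comp measurable_fst).add measurable_snd)).indicator
        (measurable_fst hC)
    have hΦb : ∀ p, ‖Φ p‖ ≤ ‖f‖ := fun p =>
      (norm_indicator_le_norm_self (fun z => f (pr z + p.2)) p.1).trans (f.norm_coe_le_norm _)
    have : IsProbabilityMeasure (P.map Z) := Measure.isProbabilityMeasure_map hZm.aemeasurable
    have : IsProbabilityMeasure (P.map (Y t)) :=
      Measure.isProbabilityMeasure_map (hYm t).aemeasurable
    have h1 : ∫ ω, (Z ⁻¹' C).indicator (fun ω => f fun s : I => W s ω) ω ∂P =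
        ∫ p, Φ p ∂((P.map Z).prod (P.map (Y t))) := by
      rw [← hind, integral_map (hZm.prodMk (hYm t)).aemeasurable hΦ.aestronglyMeasurable]
      refine integral_congr_ae (.of_forall fun ω => ?_)
      have hsum : (fun s : I => W s ω) = pr (Z ω) + Y t ω := by
        funext s
        simp [pr, Z, Y]
      by_cases h : Z ω ∈ C
      · simp only [Φ, Set.indicator_of_mem h,
          Set.indicator_of_mem (show ω ∈ Z ⁻¹' C from h), hsum]
      · simp only [Φ, Set.indicator_of_notMem h,
          Set.indicator_of_notMem (show ω ∉ Z ⁻¹' C from h)]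
    have h2 : ∫ ω, (Z ⁻¹' C).indicator (fun ω => g t (X t ω)) ω ∂P =
        ∫ p, Φ p ∂((P.map Z).prod (P.map (Y t))) := by
      rw [integral_prod _ (Integrable.of_bound hΦ.aestronglyMeasurable ‖f‖ (.of_forall hΦb)),
        integral_map hZm.aemeasurable
          (hΦ.stronglyMeasurable.integral_prod_right (f := fun z y => Φ (z, y))).aestronglyMeasurable]
      refine integral_congr_ae (.of_forall fun ω => ?_)
      by_cases h : Z ω ∈ C
      · simp only [Φ, Set.indicator_of_mem h, Set.indicator_of_mem (show ω ∈ Z ⁻¹' C from h)]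
        rw [integral_map (hYm t).aemeasurable (f := fun y => f (pr (Z ω) + y))
          (f.continuous.measurable.comp
            (measurable_const.add measurable_id)).aestronglyMeasurable]
      · simp only [Φ, Set.indicator_of_notMem h,
          Set.indicator_of_notMem (show ω ∉ Z ⁻¹' C from h), integral_zero]
    exact h2.trans h1.symm

/-- Cylinder sets with closed base. -/
def closedCylinders (W : Time T → Ω → Fin d → ℝ) : Set (Set Ω) :=
  {A | ∃ (I : Finset (Time T)) (C : Time T → Set (Fin d → ℝ)), (∀ s, IsClosed (C s)) ∧
    A = {ω | ∀ s ∈ I, W s ω ∈ C s}}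

omit mΩ in
lemma isPiSystem_closedCylinders : IsPiSystem (closedCylinders W) := by
  classical
  rintro - ⟨I, C, hC, rfl⟩ - ⟨J, D, hD, rfl⟩ -
  refine ⟨I ∪ J, fun s => (if s ∈ I then C s else Set.univ) ∩ if s ∈ J then D s else Set.univ,
    fun s => ?_, ?_⟩
  · refine IsClosed.inter ?_ ?_ <;> split_ifs
    exacts [hC s, isClosed_univ, hD s, isClosed_univ]
  · ext ω
    simp only [Set.mem_inter_iff, Set.mem_ofPred_eq, Finset.mem_union]
    constructor
    · rintro ⟨h1, h2⟩ s -
      refine ⟨?_, ?_⟩ <;> split_ifs with h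
      exacts [h1 s h, Set.mem_univ _, h2 s h, Set.mem_univ _]
    · intro h
      refine ⟨fun s hs => ?_, fun s hs => ?_⟩
      · simpa [hs] using (h s (.inl hs)).1
      · simpa [hs] using (h s (.inr hs)).2

omit mΩ in
lemma generateFrom_closedCylinders :
    (⨆ s : Time T, MeasurableSpace.comap (W s) inferInstance) =
      MeasurableSpace.generateFrom (closedCylinders W) := by
  refine le_antisymm (iSup_le fun s => ?_) (MeasurableSpace.generateFrom_le ?_)
  · rw [← measurable_iff_comap_le, BorelSpace.measurable_eq (α := Fin d → ℝ)]
    rw [borel_eq_generateFrom_isClosed]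
    refine @measurable_generateFrom _ _ (MeasurableSpace.generateFrom (closedCylinders W)) _ _
      fun C hC => MeasurableSpace.measurableSet_generateFrom ⟨{s}, fun _ => C, fun _ => hC, ?_⟩
    ext ω
    simp
  · rintro - ⟨I, C, hC, rfl⟩
    rw [show {ω | ∀ s ∈ I, W s ω ∈ C s} = ⋂ s ∈ I, W s ⁻¹' C s by ext ω; simp]
    refine @Finset.measurableSet_biInter _ _
      (⨆ s : Time T, MeasurableSpace.comap (W s) inferInstance) _ I fun s _ => ?_
    exact le_iSup (fun s => MeasurableSpace.comap (W s) inferInstance) s _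
      ⟨C s, (hC s).measurableSet, rfl⟩

/-- The indicator of a closed set is a pointwise limit of continuous functions with values in [0,1],
so the cylinder case passes to the limit. -/
lemma hasContVersion_closedCylinder (hT : 0 < T) (hW : IsStandardBrownian W P) {A : Set Ω}
    (hA : A ∈ closedCylinders W) :
    HasContVersion (augmentedFiltration W hW.measurable P) P (A.indicator fun _ => 1) := by
  obtain ⟨I, C, hC, rfl⟩ := hA
  set D : Set (I → Fin d → ℝ) := {x | ∀ s : I, x s ∈ C s} with hD
  have hDc : IsClosed D := by
    have : D = ⋂ s : I, (fun x => x s) ⁻¹' C s := by ext; simp [hD]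
    rw [this]
    exact isClosed_iInter fun s => (hC s).preimage (continuous_apply s)
  let f : ℕ → (I → Fin d → ℝ) →ᵇ ℝ := fun n =>
    BoundedContinuousFunction.ofNormedAddCommGroup (fun x => (hDc.apprSeq n x : ℝ))
      (NNReal.continuous_coe.comp (hDc.apprSeq n).continuous) 1 fun x => by
        simpa using HasOuterApproxClosed.apprSeq_apply_le_one hDc n x
  have hfb : ∀ n x, ‖f n x‖ ≤ 1 := fun n x => by
    simpa [f] using HasOuterApproxClosed.apprSeq_apply_le_one hDc n x
  have hWm : Measurable fun ω (s : I) => W s ω := measurable_pi_lambda _ fun s => hW.measurable s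
  have hfm : ∀ n, Measurable fun ω => f n fun s : I => W s ω := fun n =>
    (f n).continuous.measurable.comp hWm
  refine HasContVersion.of_tendsto_of_bound hT
    (fun A h1 h2 t => measurableSet_augmented_of_null hW.measurable h1 h2 t)
    (fun n => hasContVersion_cylinder hW I (f n))
    (fun n => (hfm n).aestronglyMeasurable) (fun n ω => hfb n _) fun ω => ?_
  have h1 := (tendsto_pi_nhds.1 (HasOuterApproxClosed.tendsto_apprSeq hDc)) fun s : I => W s ω
  have h3 := (NNReal.continuous_coe.tendsto _).comp h1
  have h4 : {ω | ∀ s ∈ I, W s ω ∈ C s}.indicator (fun _ => (1 : ℝ)) ω =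
      ((D.indicator (fun _ => (1 : ℝ≥0)) fun s : I => W s ω : ℝ≥0) : ℝ) := by
    by_cases h : ω ∈ {ω | ∀ s ∈ I, W s ω ∈ C s}
    · rw [Set.indicator_of_mem h, Set.indicator_of_mem (show _ ∈ D from fun s => h s s.2)]
      rfl
    · rw [Set.indicator_of_notMem h,
        Set.indicator_of_notMem (show _ ∉ D from fun h' => h fun s hs => h' ⟨s, hs⟩)]
      rfl
  rw [h4]
  exact h3

/-- A π-λ argument from closed cylinders: complements follow by linearity, disjoint unions as
bounded limits of partial sums. An event of the augmented σ-algebra agrees almost surely with a raw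
one, and the property depends only on the almost sure class. -/
lemma hasContVersion_indicator (hT : 0 < T) (hW : IsStandardBrownian W P) {A : Set Ω}
    (hA : MeasurableSet[augmentedFiltration W hW.measurable P (tEnd T)] A) :
    HasContVersion (augmentedFiltration W hW.measurable P) P (A.indicator fun _ => (1 : ℝ)) := by
  have hnull : ∀ A, MeasurableSet A → P A = 0 → ∀ t,
      MeasurableSet[augmentedFiltration W hW.measurable P t] A := fun A h1 h2 t =>
    measurableSet_augmented_of_null hW.measurable h1 h2 t
  have hle : (⨆ s : Time T, MeasurableSpace.comap (W s) inferInstance) ≤ mΩ :=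
    iSup_le fun s => (hW.measurable s).comap_le
  have hint : ∀ {B : Set Ω}, MeasurableSet B →
      Integrable (B.indicator fun _ => (1 : ℝ)) P := fun hB => (integrable_const 1).indicator hB
  have key : ∀ B, MeasurableSet[⨆ s : Time T, MeasurableSpace.comap (W s) inferInstance] B →
      HasContVersion (augmentedFiltration W hW.measurable P) P (B.indicator fun _ => (1 : ℝ)) := by
    intro B hB
    induction B, hB using MeasurableSpace.induction_on_inter generateFrom_closedCylinders
      isPiSystem_closedCylinders with
    | empty => simpa using hasContVersion_const (F := augmentedFiltration W hW.measurable P) (0 : ℝ)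
    | basic B hB => exact hasContVersion_closedCylinder hT hW hB
    | compl B hB ih =>
      have h := (hasContVersion_const (F := augmentedFiltration W hW.measurable P)
        (P := P) (1 : ℝ)).add (ih.smul (-1)) (integrable_const 1) ((hint (hle _ hB)).smul (-1))
      refine h.congr (.of_forall fun ω => ?_)
      by_cases h : ω ∈ B <;> simp [h]
    | iUnion B hd hB ih =>
      have hBm : ∀ n, MeasurableSet (B n) := fun n => hle _ (hB n)
      have hfin : ∀ n, HasContVersion (augmentedFiltration W hW.measurable P) P
          (∑ i ∈ Finset.range n, (B i).indicator fun _ => (1 : ℝ)) := by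
        intro n
        induction n with
        | zero =>
          rw [Finset.range_zero, Finset.sum_empty]
          exact hasContVersion_const (0 : ℝ)
        | succ n ihn =>
          rw [Finset.sum_range_succ]
          exact ihn.add (ih n) (integrable_finsetSum' _ fun i _ => hint (hBm i)) (hint (hBm n))
      have hsum : ∀ n, (∑ i ∈ Finset.range n, (B i).indicator fun _ => (1 : ℝ)) =
          (⋃ i ∈ Finset.range n, B i).indicator (fun _ => 1) := fun n => by
        rw [Finset.indicator_biUnion _ _ fun i _ j _ hij => hd hij]
        ext ω
        rw [Finset.sum_apply]
      refine HasContVersion.of_tendsto_of_bound (C := 1) hT hnull hfin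
        (fun n => (integrable_finsetSum' _ fun i _ => hint (hBm i)).aestronglyMeasurable)
        (fun n ω => ?_) fun ω => ?_
      · rw [hsum]
        exact (norm_indicator_le_norm_self _ _).trans (by simp)
      · refine tendsto_const_nhds.congr' ?_
        by_cases h : ω ∈ ⋃ i, B i
        · obtain ⟨i, hi⟩ := Set.mem_iUnion.1 h
          filter_upwards [Filter.eventually_gt_atTop i] with n hn
          rw [hsum, Set.indicator_of_mem h, Set.indicator_of_mem
            (Set.mem_iUnion₂.2 ⟨i, Finset.mem_range.2 hn, hi⟩)]
        · refine .of_forall fun n => ?_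
          beta_reduce
          rw [hsum, Set.indicator_of_notMem h, Set.indicator_of_notMem
            fun h' => h (Set.mem_iUnion.2 ?_)]
          obtain ⟨i, -, hi⟩ := Set.mem_iUnion₂.1 h'
          exact ⟨i, hi⟩
  obtain ⟨C, hC, hAC⟩ := exists_ae_eq_of_measurableSet_augmented hW.measurable (tEnd T) hA
  refine (key _ ?_).congr (indicator_ae_eq_of_ae_eq_set hAC.symm)
  refine @measurable_pi_lambda _ _ _ (⨆ s : Time T, MeasurableSpace.comap (W s) inferInstance) _ _
    (fun u => ?_) _ hC
  rw [measurable_iff_comap_le]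
  exact le_iSup (fun s => MeasurableSpace.comap (W s) inferInstance) (u : Time T)

/-- Bounded martingales of the augmented Brownian filtration have continuous versions. -/
lemma hasContVersion_of_bounded (hT : 0 < T) (hW : IsStandardBrownian W P) {ξ : Ω → ℝ}
    (hξ : StronglyMeasurable[augmentedFiltration W hW.measurable P (tEnd T)] ξ) {C : ℝ}
    (hC : ∀ ω, ‖ξ ω‖ ≤ C) : HasContVersion (augmentedFiltration W hW.measurable P) P ξ := by
  have hle := (augmentedFiltration W hW.measurable P).le (tEnd T)
  have hC0 : 0 ≤ C := by
    obtain ⟨ω⟩ := nonempty_of_isProbabilityMeasure P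
    exact (norm_nonneg _).trans (hC ω)
  have hsf : ∀ g : @SimpleFunc Ω (augmentedFiltration W hW.measurable P (tEnd T)) ℝ,
      HasContVersion (augmentedFiltration W hW.measurable P) P g ∧ Integrable g P := by
    intro g
    refine @SimpleFunc.induction _ _ (augmentedFiltration W hW.measurable P (tEnd T)) _
      (fun g => HasContVersion (augmentedFiltration W hW.measurable P) P g ∧ Integrable g P)
      (fun c s hs => ?_) (fun f g _ hf hg => ⟨hf.1.add hg.1 hf.2 hg.2, hf.2.add hg.2⟩) g
    have h1 : Integrable (s.indicator fun _ => (1 : ℝ)) P :=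
      (integrable_const 1).indicator (hle _ hs)
    have h2 : c • (s.indicator fun _ => (1 : ℝ)) = @SimpleFunc.piecewise _ _
        (augmentedFiltration W hW.measurable P (tEnd T)) s hs
        (@SimpleFunc.const _ _ (_) c) (@SimpleFunc.const _ _ (_) 0) := by
      funext ω
      by_cases h : ω ∈ s <;> simp [h]
    exact ⟨h2 ▸ (hasContVersion_indicator hT hW hs).smul c, h2 ▸ h1.smul c⟩
  exact HasContVersion.of_tendsto_of_bound (C := C) hT
    (fun A h1 h2 t => measurableSet_augmented_of_null hW.measurable h1 h2 t)
    (fun n => (hsf (hξ.approxBounded C n)).1)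
    (fun n => (hsf (hξ.approxBounded C n)).2.aestronglyMeasurable)
    (fun n ω => hξ.norm_approxBounded_le hC0 n ω)
    fun ω => hξ.tendsto_approxBounded_of_norm_le (hC ω)

end Brownian

/-! ### Continuous functions on [0,T] and the product rule. -/

section Deterministic

variable {T : ℝ≥0} {E : Type*} [NormedAddCommGroup E]

lemma exists_bound_of_continuous {g : Time T → E} (hg : Continuous g) : ∃ C, ∀ t, ‖g t‖ ≤ C := by
  obtain ⟨C, hC⟩ := (isCompact_univ.image hg).isBounded.exists_norm_le
  exact ⟨C, fun t => hC _ (Set.mem_image_of_mem _ (Set.mem_univ t))⟩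

lemma integrable_leb_of_continuous {g : Time T → E} (hg : Continuous g) :
    Integrable g (leb T) := by
  obtain ⟨C, hC⟩ := exists_bound_of_continuous hg
  exact Integrable.of_bound (hg.stronglyMeasurable_of_hasCompactSupport
    (HasCompactSupport.of_compactSpace _)).aestronglyMeasurable C (.of_forall hC)

variable [NormedSpace ℝ E]

lemma integrable_continuous_smul {g : Time T → ℝ} (hg : Continuous g) {w : Time T → E}
    (hw : Integrable w (leb T)) : Integrable (fun s => g s • w s) (leb T) := by
  obtain ⟨C, hC⟩ := exists_bound_of_continuous hg
  exact hw.bdd_smul C hg.aestronglyMeasurable (.of_forall hC)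

lemma pathPrim_sub_eq {f : Time T → E} (hf : Integrable f (leb T)) {s t : Time T} (hst : s ≤ t) :
    pathPrim f t - pathPrim f s = ∫ r in Set.Ioc s t, f r ∂(leb T) := by
  have h : Set.Ioc s t = Set.Iic t \ Set.Iic s := by
    ext r; simp [and_comm]
  rw [h, setIntegral_sdiff measurableSet_Iic hf.integrableOn (Set.Iic_subset_Iic.2 hst)]
  rfl

/-- This is `pathPrim_by_parts` with `u = k'`, whose primitive is `k - k 0`; the terms with `k 0`
cancel. The decoupling ansatz and the discounting are differentiated with it. -/
lemma pathPrim_deriv_smul [CompleteSpace E] {k k' : ℝ → ℝ} (hk : ∀ t, HasDerivAt k (k' t) t)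
    (hk' : Continuous k') {v : Time T → E} (hv : Integrable v (leb T)) (t : Time T) :
    pathPrim (fun s : Time T => k' s • pathPrim v s + k s • v s) t = k t • pathPrim v t := by
  have hkc : Continuous k := continuous_iff_continuousAt.2 fun t => (hk t).continuousAt
  have hk'T : Continuous fun s : Time T => k' s := hk'.comp continuous_subtype_val
  have hkT : Continuous fun s : Time T => k s := hkc.comp continuous_subtype_val
  have h := pathPrim_by_parts (ContinuousLinearMap.lsmul ℝ ℝ : ℝ →L[ℝ] E →L[ℝ] E)
    (u := fun s : Time T => k' s) (v := v) (integrable_leb_of_continuous hk'T) hv t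
  simp only [ContinuousLinearMap.lsmul_apply, pathPrim_deriv hk hk'] at h
  have h2 : pathPrim (fun s : Time T => (k s - k 0) • v s) t =
      pathPrim (fun s : Time T => k s • v s) t - k 0 • pathPrim v t := by
    rw [← pathPrim_smul, ← pathPrim_sub (integrable_continuous_smul hkT hv)
      (show Integrable (fun s => k 0 • v s) (leb T) from hv.smul (k 0))]
    simp_rw [sub_smul]
  rw [pathPrim_add (integrable_continuous_smul hk'T
    (integrable_leb_of_continuous (continuous_pathPrim hv))) (integrable_continuous_smul hkT hv)]
  rw [h2, sub_smul, ← add_sub_assoc] at h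
  exact sub_left_injective h

end Deterministic

/-! ### Integrals of deterministic functions against martingales. -/

section Martingales

variable {Ω : Type*} [mΩ : MeasurableSpace Ω] {T : ℝ≥0} {F : Filtration (Time T) mΩ}
  {P : Measure Ω} [IsFiniteMeasure P]
  {V : Type*} [NormedAddCommGroup V] [MeasurableSpace V] [BorelSpace V]
  [SecondCountableTopology V]

omit [SecondCountableTopology V] in
lemma IsOpt.ae_prod {X : Time T → Ω → V} (hX : IsOpt F X) {C : ℝ}
    (hC : ∀ᵐ ω ∂P, ∀ᵐ t ∂(leb T), ‖X t ω‖ ≤ C) :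
    ∀ᵐ p ∂((leb T).prod P), ‖X p.1 p.2‖ ≤ C := by
  have hm : MeasurableSet {p : Time T × Ω | ‖X p.1 p.2‖ ≤ C} :=
    measurableSet_le hX.measurable_uncurry.norm measurable_const
  rw [Measure.ae_prod_iff_ae_ae hm, Measure.ae_ae_comm hm]
  exact hC

lemma IsOpt.integrable_prod {X : Time T → Ω → V} (hX : IsOpt F X) {C : ℝ}
    (hC : ∀ᵐ ω ∂P, ∀ᵐ t ∂(leb T), ‖X t ω‖ ≤ C) :
    Integrable (fun p : Time T × Ω => X p.1 p.2) ((leb T).prod P) :=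
  Integrable.of_bound hX.measurable_uncurry.aestronglyMeasurable C (hX.ae_prod hC)

variable [NormedSpace ℝ V] [CompleteSpace V]

/-- Integration of a deterministic function against a martingale, by parts. -/
lemma martingale_by_parts {M : Time T → Ω → V} (hM : Martingale M F P) (ho : IsOpt F M) {C : ℝ}
    (hC : ∀ᵐ ω ∂P, ∀ᵐ t ∂(leb T), ‖M t ω‖ ≤ C) {k u : Time T → ℝ} (hu : Continuous u)
    (hk : ∀ t, k t = k (tStart T) + pathPrim u t) :
    Martingale (fun t ω => k t • M t ω - pathPrim (fun s => u s • M s ω) t) F P := by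
  obtain ⟨D, hD⟩ := exists_bound_of_continuous hu
  have huo : IsOpt F fun t ω => u t • M t ω := (isOpt_deterministic hu).comp₂ ho measurable_smul
  have hub : ∀ᵐ ω ∂P, ∀ᵐ t ∂(leb T), ‖u t • M t ω‖ ≤ D * C := by
    filter_upwards [hC] with ω hω
    filter_upwards [hω] with t ht
    rw [norm_smul]
    exact mul_le_mul (hD t) ht (norm_nonneg _) ((norm_nonneg _).trans (hD t))
  have hprimm : ∀ t, StronglyMeasurable[F t] fun ω => pathPrim (fun s => u s • M s ω) t :=
    huo.stronglyAdapted_pathPrim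
  have hprimi : ∀ t, Integrable (fun ω => pathPrim (fun s => u s • M s ω) t) P := fun t => by
    refine Integrable.of_bound ((hprimm t).mono (F.le t)).aestronglyMeasurable (D * C * T) ?_
    filter_upwards [hub] with ω hω using norm_pathPrim_le hω t
  have hint : ∀ t, Integrable (fun ω => k t • M t ω - pathPrim (fun s => u s • M s ω) t) P :=
    fun t => ((hM.integrable t).smul (k t)).sub (hprimi t)
  have hadapt : ∀ t, StronglyMeasurable[F t]
      fun ω => k t • M t ω - pathPrim (fun s => u s • M s ω) t := fun t =>
    ((hM.stronglyAdapted t).const_smul (k t)).sub (hprimm t)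
  refine ⟨hadapt, fun s t hst => ?_⟩
  refine (ae_eq_condExp_of_forall_setIntegral_eq (F.le s) (hint t)
    (fun _ _ _ => (hint s).integrableOn) (fun A hA _ => ?_) (hadapt s).aestronglyMeasurable).symm
  -- For `A` in `F s`, the mean of `M r` on `A` is constant for `r ≥ s`. After Fubini the mean
  -- increment from `s` to `t` is `(k t - k s) • f s` minus the integral of `u` over (s,t] times `f
  -- s`, which is zero.
  let f : Time T → V := fun r => ∫ ω in A, M r ω ∂P
  have hconst : ∀ r, s ≤ r → f r = f s := fun r hr => by
    have h1 := setIntegral_condExp (F.le s) (hM.integrable r) hA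
    change ∫ ω in A, M r ω ∂P = ∫ ω in A, M s ω ∂P
    rw [← h1]
    exact setIntegral_congr_ae (F.le s _ hA) ((hM.2 s r hr).mono fun ω h _ => h)
  have hprodA : Integrable (fun p : Time T × Ω => u p.1 • M p.1 p.2)
      ((leb T).prod (P.restrict A)) :=
    huo.integrable_prod (ae_restrict_of_ae hub)
  have hf : Integrable (fun r => u r • f r) (leb T) := by
    refine hprodA.integral_prod_left.congr (.of_forall fun r => ?_)
    change ∫ ω in A, u r • M r ω ∂P = u r • ∫ ω in A, M r ω ∂P
    exact integral_smul _ _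
  have hswap : ∀ r, ∫ ω in A, pathPrim (fun s => u s • M s ω) r ∂P =
      pathPrim (fun r => u r • f r) r := fun r => by
    have h1 : Integrable (fun p : Time T × Ω => u p.1 • M p.1 p.2)
        (((leb T).restrict (Set.Iic r)).prod (P.restrict A)) := by
      have := hprodA.restrict (s := Set.Iic r ×ˢ Set.univ)
      rwa [← Measure.prod_restrict, Measure.restrict_univ] at this
    change ∫ ω in A, (∫ s in Set.Iic r, u s • M s ω ∂(leb T)) ∂P = _
    rw [← integral_integral_swap h1]
    refine integral_congr_ae (.of_forall fun r => ?_)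
    change ∫ ω in A, u r • M r ω ∂P = u r • ∫ ω in A, M r ω ∂P
    exact integral_smul _ _
  have hsplit : ∀ r, ∫ ω in A, (k r • M r ω - pathPrim (fun s => u s • M s ω) r) ∂P =
      k r • f r - pathPrim (fun r => u r • f r) r := fun r => by
    rw [← hswap, ← integral_smul]
    exact integral_sub ((hM.integrable r).smul (k r)).integrableOn (hprimi r).integrableOn
  rw [hsplit, hsplit]
  have h3 : pathPrim (fun r => u r • f r) t - pathPrim (fun r => u r • f r) s =
      (k t - k s) • f s := by
    rw [pathPrim_sub_eq hf hst, setIntegral_congr_fun measurableSet_Ioc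
      (g := fun r => u r • f s) (fun r hr => by
        change u r • f r = u r • f s
        rw [hconst r hr.1.le]), integral_smul_const,
      ← pathPrim_sub_eq (integrable_leb_of_continuous hu) hst, hk t, hk s]
    congr 1
    ring
  rw [hconst t hst, ← sub_eq_zero]
  rw [sub_smul] at h3
  rw [← sub_eq_zero] at h3
  rw [← h3]
  abel

end Martingales

/-- A positive solution of `G'' = r G' + b G` with `G'(T) = 0`. -/
lemma exists_positive_solution (r T : ℝ) {b : ℝ} (hb : 0 < b) :
    ∃ G G1 : ℝ → ℝ, (∀ t, 0 < G t) ∧ (∀ t, HasDerivAt G (G1 t) t) ∧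
      (∀ t, HasDerivAt G1 (r * G1 t + b * G t) t) ∧ G1 T = 0 := by
  set q := Real.sqrt (r ^ 2 + 4 * b) with hq
  have hq2 : q ^ 2 = r ^ 2 + 4 * b := Real.sq_sqrt (by positivity)
  have hrq : |r| < q := Real.lt_sqrt_of_sq_lt (by rw [sq_abs]; linarith)
  -- `p > 0 > m` are the roots of λ² = rλ + b. In the combination p e^{m(t-T)} - m e^{p(t-T)} both
  -- terms are positive and the derivatives cancel at T.
  set p := (r + q) / 2 with hp
  set m := (r - q) / 2 with hm
  have hp0 : 0 < p := by have := neg_abs_le r; simp only [hp]; linarith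
  have hm0 : m < 0 := by have := le_abs_self r; simp only [hm]; linarith
  have hp2 : p ^ 2 = r * p + b := by simp only [hp]; linear_combination hq2 / 4
  have hm2 : m ^ 2 = r * m + b := by simp only [hm]; linear_combination hq2 / 4
  have he : ∀ c t : ℝ, HasDerivAt (fun t => Real.exp (c * (t - T))) (c * Real.exp (c * (t - T))) t :=
    fun c t => by
      have := (((hasDerivAt_id t).sub_const T).const_mul c).exp
      simpa [mul_comm] using this
  refine ⟨fun t => p * Real.exp (m * (t - T)) - m * Real.exp (p * (t - T)),
    fun t => p * m * (Real.exp (m * (t - T)) - Real.exp (p * (t - T))), fun t => ?_, fun t => ?_,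
    fun t => ?_, by simp⟩
  · have h1 := mul_pos hp0 (Real.exp_pos (m * (t - T)))
    have h2 := mul_pos (neg_pos.2 hm0) (Real.exp_pos (p * (t - T)))
    linarith
  · exact (((he m t).const_mul p).sub ((he p t).const_mul m)).congr_deriv (by ring)
  · refine (((he m t).sub (he p t)).const_mul (p * m)).congr_deriv ?_
    linear_combination (p * Real.exp (m * (t - T))) * hm2 - (m * Real.exp (p * (t - T))) * hp2

/-! ### Decoupling of the scalar forward-backward system along a path. -/

section ScalarPath

variable {T : ℝ≥0}

/-- The linear forward-backward system along a single path, solved by decoupling. -/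
lemma scalar_system_path {r b : ℝ} {G G1 : ℝ → ℝ} (hG : ∀ t, 0 < G t)
    (hG1 : ∀ t, HasDerivAt G (G1 t) t) (hG2 : ∀ t, HasDerivAt G1 (r * G1 t + b * G t) t)
    {k k' : ℝ → ℝ} (hk : ∀ t, k t = Real.exp (r * t) / G t)
    (hk' : ∀ t, k' t = k t * (r - G1 t / G t)) (hkd : ∀ t, HasDerivAt k (k' t) t)
    (hk'c : Continuous k')
    {N f w η A x m : Time T → ℝ} (hN : Continuous N) (hf : Integrable f (leb T))
    (hw : ∀ s, w s = Real.exp (-r * s) * G s * b * f s)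
    (hη : ∀ t, η t = k t * (N t - pathPrim w t)) (hA : ∀ t, A t = pathPrim (fun s => (G s)⁻¹ * η s) t)
    (hx : ∀ t, x t = G1 t * A t + η t)
    (hm : ∀ t, m t = k t * N t - pathPrim (fun s => k' s * N s) t) :
    Continuous x ∧ (∀ t, pathPrim x t = G t * A t) ∧
      ∀ t, x t = x (tStart T) + pathPrim (fun s => b * (pathPrim x s - f s) + r * x s) t +
        (m t - m (tStart T)) := by
  have cG : Continuous G := continuous_iff_continuousAt.2 fun t => (hG1 t).continuousAt
  have cG1 : Continuous G1 := continuous_iff_continuousAt.2 fun t => (hG2 t).continuousAt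
  have ck : Continuous k := continuous_iff_continuousAt.2 fun t => (hkd t).continuousAt
  have cv : Continuous (Subtype.val : Time T → ℝ) := continuous_subtype_val
  have hwi : Integrable w (leb T) := by
    have h1 : Continuous fun s : Time T => Real.exp (-r * s) * G s * b := by fun_prop
    exact (integrable_continuous_smul h1 hf).congr (.of_forall fun s => (hw s).symm)
  have cFp : Continuous (pathPrim w) := continuous_pathPrim hwi
  have cη : Continuous η := by rw [funext hη]; fun_prop
  have cGi : Continuous fun s : Time T => (G s)⁻¹ :=
    (cG.comp cv).inv₀ fun s => (hG _).ne'
  have cv' : Continuous fun s : Time T => (G s)⁻¹ * η s := cGi.mul cη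
  have hvi := integrable_leb_of_continuous cv'
  have cA : Continuous A := by rw [funext hA]; exact continuous_pathPrim hvi
  have cx : Continuous x := by rw [funext hx]; fun_prop
  -- The ansatz is that the position is `G * A` with `A' = η / G`; then its rate `G1 * A + η` is
  -- `x`.
  have hprim : ∀ t, pathPrim x t = G t * A t := fun t => by
    have h := pathPrim_deriv_smul hG1 cG1 hvi t
    rw [hA t, ← smul_eq_mul, ← h]
    congr 1
    funext s
    rw [hx, hA, smul_eq_mul, smul_eq_mul, mul_inv_cancel_left₀ (hG _).ne']
  refine ⟨cx, hprim, fun t => ?_⟩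
  have h1 := pathPrim_deriv_smul hG2 (by fun_prop) hvi t
  have h2 := pathPrim_deriv_smul hkd hk'c hwi t
  rw [← hA t, smul_eq_mul] at h1
  rw [smul_eq_mul] at h2
  have hA0 : A (tStart T) = 0 := by rw [hA, pathPrim_start]
  have hx0 : x (tStart T) = m (tStart T) := by
    rw [hx, hm, hη, hA0, pathPrim_start, pathPrim_start]; ring
  have i1 : Integrable (fun s : Time T => (r * G1 s + b * G s) • pathPrim (fun s => (G s)⁻¹ * η s) s +
      G1 s • ((G s)⁻¹ * η s)) (leb T) := by
    refine integrable_leb_of_continuous ?_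
    have : Continuous (pathPrim fun s : Time T => (G s)⁻¹ * η s) := continuous_pathPrim hvi
    fun_prop
  have i2 : Integrable (fun s : Time T => k' s • pathPrim w s + k s • w s) (leb T) :=
    (integrable_leb_of_continuous (by fun_prop)).add
      (integrable_continuous_smul (ck.comp cv) hwi)
  have i3 : Integrable (fun s : Time T => k' s * N s) (leb T) :=
    integrable_leb_of_continuous (by fun_prop)
  -- Formally dx = (rG1 + bG)A dt + G1 (η/G) dt + dη and dη = (rη - G1 η/G) dt - b f dt + k dN,
  -- because k' = k(r - G1/G) and k w = b f. The terms G1 η/G cancel, leaving the drift b(GA - f) +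
  -- r x. The identity states this with k dN, that is `m`, moved to the other side by parts.
  have key : pathPrim (fun s => b * (pathPrim x s - f s) + r * x s) t =
      G1 t * A t - k t * pathPrim w t + pathPrim (fun s => k' s * N s) t := by
    have i12 : Integrable (fun s : Time T =>
        ((r * G1 s + b * G s) • pathPrim (fun s => (G s)⁻¹ * η s) s + G1 s • ((G s)⁻¹ * η s)) -
          (k' s • pathPrim w s + k s • w s)) (leb T) := i1.sub i2
    rw [← h1, ← h2, ← pathPrim_sub i1 i2, ← pathPrim_add i12 i3]
    congr 1
    funext s
    simp only [smul_eq_mul]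
    rw [hprim, hx, ← hA, hη, hw, hk', hk]
    have hGs := (hG s).ne'
    have he : Real.exp (r * s) * Real.exp (-r * s) = 1 := by
      rw [← Real.exp_add]; simp
    field_simp
    rw [neg_mul] at he
    linear_combination (b * f s * G s ^ 2) * he
  rw [key, hx0, hm t, hx t, hη t]
  ring

end ScalarPath

/-! ### Bounded solutions of the scalar forward-backward system. -/

section ScalarExistence

variable {Ω : Type*} [mΩ : MeasurableSpace Ω] {T : ℝ≥0} {F : Filtration (Time T) mΩ}
  {P : Measure Ω} [IsProbabilityMeasure P]

omit [IsProbabilityMeasure P] in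
lemma ae_forall_abs_le (C : ℝ) {N : Time T → Ω → ℝ} (hc : ∀ ω, Continuous fun t => N t ω)
    (h : ∀ t, ∀ᵐ ω ∂P, |N t ω| ≤ C) : ∀ᵐ ω ∂P, ∀ t, |N t ω| ≤ C := by
  have : Nonempty (Time T) := ⟨tStart T⟩
  filter_upwards [ae_all_iff.2 fun n => h (TopologicalSpace.denseSeq (Time T) n)] with ω hω t
  have hcl : IsClosed {t | |N t ω| ≤ C} := isClosed_le (hc ω).abs continuous_const
  have : closure (Set.range (TopologicalSpace.denseSeq (Time T))) ⊆ {t | |N t ω| ≤ C} :=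
    hcl.closure_subset_iff.2 (by rintro - ⟨n, rfl⟩; exact hω n)
  exact this (TopologicalSpace.denseRange_denseSeq (Time T) t)

/-- Bounded solutions of the scalar linear forward-backward system. -/
lemma exists_scalar_solution
    (hcv : ∀ (ξ : Ω → ℝ) (C : ℝ), StronglyMeasurable[F (tEnd T)] ξ → (∀ ω, ‖ξ ω‖ ≤ C) →
      HasContVersion F P ξ)
    (r : ℝ) {b : ℝ} (hb : 0 < b) {f : Time T → Ω → ℝ} (hf : IsOpt F f) {C : ℝ}
    (hC : ∀ t ω, ‖f t ω‖ ≤ C) :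
    ∃ x m : Time T → Ω → ℝ, IsOpt F x ∧ (∀ ω, Continuous fun t => x t ω) ∧
      (∃ D, ∀ᵐ ω ∂P, ∀ t, |x t ω| ≤ D) ∧ Martingale m F P ∧ (∀ ω, Continuous fun t => m t ω) ∧
      (∃ D, ∀ᵐ ω ∂P, ∀ t, |m t ω| ≤ D) ∧
      ∀ᵐ ω ∂P, (∀ t, x t ω = x (tStart T) ω + pathPrim (fun s =>
        b * (pathPrim (fun s => x s ω) s - f s ω) + r * x s ω) t + (m t ω - m (tStart T) ω)) ∧
        x (tEnd T) ω = 0 := by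
  obtain ⟨G, G1, hG, hG1, hG2, hGT⟩ := exists_positive_solution r T hb
  have cG : Continuous G := continuous_iff_continuousAt.2 fun t => (hG1 t).continuousAt
  have cG1 : Continuous G1 := continuous_iff_continuousAt.2 fun t => (hG2 t).continuousAt
  have cv : Continuous (Subtype.val : Time T → ℝ) := continuous_subtype_val
  let k : ℝ → ℝ := fun t => Real.exp (r * t) / G t
  let k' : ℝ → ℝ := fun t => k t * (r - G1 t / G t)
  have ck : Continuous k := Continuous.div (by fun_prop) cG fun t => (hG t).ne'
  have hk'c : Continuous k' := ck.mul (continuous_const.sub (cG1.div cG fun t => (hG t).ne'))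
  have hkd : ∀ t, HasDerivAt k (k' t) t := fun t => by
    have he : HasDerivAt (fun t => Real.exp (r * t)) (r * Real.exp (r * t)) t := by
      have := ((hasDerivAt_id t).const_mul r).exp
      simpa [mul_comm] using this
    refine (he.div (hG1 t) (hG t).ne').congr_deriv ?_
    have := (hG t).ne'
    simp only [k', k]
    field_simp
  let c : Time T → ℝ := fun s => Real.exp (-r * s) * G s * b
  have cc : Continuous c := by fun_prop
  let w : Time T → Ω → ℝ := fun s ω => c s * f s ω
  have hwo : IsOpt F w := (isOpt_deterministic cc).comp₂ hf measurable_mul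
  obtain ⟨Cc, hCc⟩ := exists_bound_of_continuous cc
  have hwb : ∀ s ω, ‖w s ω‖ ≤ Cc * C := fun s ω => by
    rw [norm_mul]
    exact mul_le_mul (hCc s) (hC s ω) (norm_nonneg _) ((norm_nonneg _).trans (hCc s))
  have hFb : ∀ t ω, ‖pathPrim (fun s => w s ω) t‖ ≤ Cc * C * T := fun t ω =>
    norm_pathPrim_le (.of_forall fun s => hwb s ω) t
  have hFa := hwo.stronglyAdapted_pathPrim
  have hFc : ∀ ω, Continuous (pathPrim fun s => w s ω) := fun ω =>
    continuous_pathPrim (hwo.integrable_path (.of_forall fun s => hwb s ω))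
  -- `N` is closed by the integral of `w` over all of [0,T], so `N` minus the running integral
  -- predicts the future integral and vanishes at T. Together with `G1 T = 0` this gives the
  -- terminal condition for `x`.
  obtain ⟨N, hNa, hNc, hN⟩ := hcv _ _ (hFa (tEnd T)) (hFb (tEnd T))
  set K := Cc * C * T with hK
  have hNb : ∀ᵐ ω ∂P, ∀ t, |N t ω| ≤ K := by
    refine ae_forall_abs_le K hNc fun t => ?_
    have := ae_bdd_abs_condExp_of_ae_bdd_abs (m := F t) (μ := P) (R := K)
      (f := fun ω => pathPrim (fun s => w s ω) (tEnd T)) (.of_forall fun ω => hFb (tEnd T) ω)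
    filter_upwards [this, hN t] with ω h1 h2
    rw [h2]; exact h1
  have hNT : ∀ᵐ ω ∂P, N (tEnd T) ω = pathPrim (fun s => w s ω) (tEnd T) := by
    have hint : Integrable (fun ω => pathPrim (fun s => w s ω) (tEnd T)) P :=
      Integrable.of_bound ((hFa (tEnd T)).mono (F.le _)).aestronglyMeasurable K
        (.of_forall fun ω => hFb (tEnd T) ω)
    have := condExp_of_stronglyMeasurable (F.le (tEnd T)) (hFa (tEnd T)) hint
    filter_upwards [hN (tEnd T)] with ω h2
    rw [h2, this]
  have hNo : IsOpt F N := isOpt_of_continuous hNa hNc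
  have ckT : Continuous fun t : Time T => k t := ck.comp cv
  have ck'T : Continuous fun t : Time T => k' t := hk'c.comp cv
  have cG1T : Continuous fun t : Time T => G1 t := cG1.comp cv
  have cGi : Continuous fun t : Time T => (G t)⁻¹ := (cG.comp cv).inv₀ fun s => (hG _).ne'
  let η : Time T → Ω → ℝ := fun t ω => k t * (N t ω - pathPrim (fun s => w s ω) t)
  let A : Time T → Ω → ℝ := fun t ω => pathPrim (fun s => (G s)⁻¹ * η s ω) t
  let x : Time T → Ω → ℝ := fun t ω => G1 t * A t ω + η t ω
  let m : Time T → Ω → ℝ := fun t ω => k t * N t ω - pathPrim (fun s => k' s * N s ω) t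
  have hηo : IsOpt F η := (isOpt_deterministic ckT).comp₂
    (hNo.comp₂ (isOpt_of_continuous hFa hFc) measurable_sub) measurable_mul
  have cη : ∀ ω, Continuous fun t => η t ω := fun ω => ckT.mul ((hNc ω).sub (hFc ω))
  have hgo : IsOpt F fun t ω => (G t)⁻¹ * η t ω :=
    (isOpt_deterministic cGi).comp₂ hηo measurable_mul
  have cg : ∀ ω, Continuous fun t : Time T => (G t)⁻¹ * η t ω := fun ω => cGi.mul (cη ω)
  have cA : ∀ ω, Continuous fun t => A t ω := fun ω =>
    continuous_pathPrim (integrable_leb_of_continuous (cg ω))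
  have hAo : IsOpt F A := isOpt_of_continuous hgo.stronglyAdapted_pathPrim cA
  have hxo : IsOpt F x :=
    ((isOpt_deterministic cG1T).comp₂ hAo measurable_mul).comp₂ hηo measurable_add
  have hpath : ∀ ω, _ := fun ω => scalar_system_path (f := fun t => f t ω) (w := fun t => w t ω)
    (N := fun t => N t ω) (η := fun t => η t ω) (A := fun t => A t ω) (x := fun t => x t ω)
    (m := fun t => m t ω) hG hG1 hG2 (fun t => rfl) (fun t => rfl) hkd hk'c (hNc ω)
    (hf.integrable_path (.of_forall fun s => hC s ω)) (fun s => rfl) (fun t => rfl)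
    (fun t => rfl) (fun t => rfl) (fun t => rfl)
  have hmart : Martingale m F P := by
    refine martingale_by_parts (k := fun t => k t) (u := fun t => k' t)
      (martingale_of_condExp hNa hN) hNo (C := K) ?_ ck'T fun t => ?_
    · filter_upwards [hNb] with ω hω using .of_forall hω
    · rw [pathPrim_deriv hkd hk'c]
      simp [tStart]
  obtain ⟨D1, hD1⟩ := exists_bound_of_continuous ckT
  obtain ⟨D2, hD2⟩ := exists_bound_of_continuous ck'T
  obtain ⟨D3, hD3⟩ := exists_bound_of_continuous cGi
  obtain ⟨D4, hD4⟩ := exists_bound_of_continuous cG1T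
  have hmul : ∀ {a b A B : ℝ}, ‖a‖ ≤ A → ‖b‖ ≤ B → ‖a * b‖ ≤ A * B := fun h1 h2 => by
    rw [norm_mul]; exact mul_le_mul h1 h2 (norm_nonneg _) ((norm_nonneg _).trans h1)
  refine ⟨x, m, hxo, fun ω => (hpath ω).1, ⟨D4 * (D3 * (D1 * (K + K)) * T) + D1 * (K + K), ?_⟩,
    hmart, fun ω => ?_, ⟨D1 * K + D2 * K * T, ?_⟩, ?_⟩
  · filter_upwards [hNb] with ω hω t
    have h1 : ∀ t, ‖η t ω‖ ≤ D1 * (K + K) := fun t =>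
      hmul (hD1 t) ((norm_sub_le _ _).trans (add_le_add (hω t) (hFb t ω)))
    have h2 : ‖A t ω‖ ≤ D3 * (D1 * (K + K)) * T :=
      norm_pathPrim_le (.of_forall fun s => hmul (hD3 s) (h1 s)) t
    exact (norm_add_le _ _).trans (add_le_add (hmul (hD4 t) h2) (h1 t))
  · exact (ckT.mul (hNc ω)).sub
      (continuous_pathPrim (integrable_leb_of_continuous (ck'T.mul (hNc ω))))
  · filter_upwards [hNb] with ω hω t
    exact (norm_sub_le _ _).trans (add_le_add (hmul (hD1 t) (hω t))
      (norm_pathPrim_le (.of_forall fun s => hmul (hD2 s) (hω s)) t))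
  · filter_upwards [hNT] with ω hω
    refine ⟨(hpath ω).2.2, ?_⟩
    change G1 T * A (tEnd T) ω + k T * (N (tEnd T) ω - pathPrim (fun s => w s ω) (tEnd T)) = 0
    rw [hGT, hω]
    ring

end ScalarExistence

/-! ### Diagonalisation of the matrix B. -/

section Diagonalisation

variable {d : ℕ}

lemma toEuclideanLin_mul_apply (A B : Matrix (Fin d) (Fin d) ℝ) (v : Vec d) :
    Matrix.toEuclideanLin (A * B) v = Matrix.toEuclideanLin A (Matrix.toEuclideanLin B v) := by
  rw [Matrix.toLpLin_mul_same]; rfl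

/-- The matrix `B` is diagonalisable with positive eigenvalues. -/
lemma exists_diagonalisation {Sig Lam : Matrix (Fin d) (Fin d) ℝ} (hSig : Sig.PosDef)
    (hLam : Lam.PosDef) (hLamDiag : Lam.IsDiag) {δbar : ℝ} (hδbar : 0 < δbar) :
    ∃ (Q : Vec d ≃L[ℝ] Vec d) (D : Fin d → ℝ), (∀ i, 0 < D i) ∧
      ∀ v i, Q (Matrix.toEuclideanLin (matB δbar Sig Lam) v) i = D i * Q v i := by
  obtain ⟨l, rfl⟩ : ∃ l, Lam = Matrix.diagonal l := ⟨_, hLamDiag.diagonal_diag.symm⟩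
  have hl : ∀ i, 0 < l i := Matrix.posDef_diagonal_iff.1 hLam
  let s : Fin d → ℝ := fun i => Real.sqrt (l i)
  have hs : ∀ i, 0 < s i := fun i => Real.sqrt_pos.2 (hl i)
  have hss : ∀ i, s i * s i = l i := fun i => Real.mul_self_sqrt (hl i).le
  let s' : Fin d → ℝ := fun i => (s i)⁻¹
  have h1 : Matrix.diagonal s * Matrix.diagonal s' = 1 := by
    rw [Matrix.diagonal_mul_diagonal, ← Matrix.diagonal_one]
    congr 1; funext i; exact mul_inv_cancel₀ (hs i).ne'
  have h2 : Matrix.diagonal s' * Matrix.diagonal s = 1 := by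
    rw [Matrix.diagonal_mul_diagonal, ← Matrix.diagonal_one]
    congr 1; funext i; exact inv_mul_cancel₀ (hs i).ne'
  have hsl : Matrix.diagonal s * (Matrix.diagonal l)⁻¹ = Matrix.diagonal s' := by
    have : (Matrix.diagonal l)⁻¹ = Matrix.diagonal s' * Matrix.diagonal s' := by
      refine Matrix.inv_eq_right_inv ?_
      rw [Matrix.diagonal_mul_diagonal, Matrix.diagonal_mul_diagonal, ← Matrix.diagonal_one]
      congr 1; funext i
      have := (hs i).ne'
      simp only [s']
      rw [← hss i]
      field_simp
    rw [this, ← mul_assoc, h1, one_mul]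
  -- With `s` the square root of the diagonal of Λ, conjugation by `diagonal s` takes B to `S`,
  -- which is symmetric positive definite. `Q` applies `diagonal s` and then takes coordinates in an
  -- orthonormal eigenbasis of `S`.
  let S : Matrix (Fin d) (Fin d) ℝ :=
    (2 * δbar)⁻¹ • (Matrix.diagonal s' * Sig * Matrix.diagonal s')
  have hS : S.PosDef := by
    refine Matrix.PosDef.smul ?_ (by positivity)
    have hinj : Function.Injective (Matrix.diagonal s').mulVec := by
      intro v w hvw
      have := congrArg (Matrix.diagonal s).mulVec hvw
      simpa [Matrix.mulVec_mulVec, h1] using this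
    have := hSig.conjTranspose_mul_mul_same hinj
    rwa [Matrix.diagonal_conjTranspose, star_trivial] at this
  have hSB : Matrix.diagonal s * matB δbar Sig (Matrix.diagonal l) = S * Matrix.diagonal s := by
    simp only [matB, S, Matrix.mul_smul, Matrix.smul_mul]
    rw [← mul_assoc, hsl, mul_assoc, h2, mul_one]
  have hinv : ∀ {A B : Matrix (Fin d) (Fin d) ℝ}, A * B = 1 →
      (Matrix.toEuclideanLin A).comp (Matrix.toEuclideanLin B) = LinearMap.id := fun h => by
    rw [← Matrix.toLpLin_mul_same, h, Matrix.toLpLin_one]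
  let R : Vec d ≃ₗ[ℝ] Vec d := LinearEquiv.ofLinearMap (Matrix.toEuclideanLin (Matrix.diagonal s))
    (Matrix.toEuclideanLin (Matrix.diagonal s')) (hinv h1) (hinv h2)
  let b := hS.1.eigenvectorBasis
  refine ⟨R.toContinuousLinearEquiv.trans b.repr.toContinuousLinearEquiv, hS.1.eigenvalues,
    hS.1.posDef_iff_eigenvalues_pos.1 hS, fun v i => ?_⟩
  have hR : ∀ v, R v = Matrix.toEuclideanLin (Matrix.diagonal s) v := fun v => rfl
  change b.repr (R _) i = _ * b.repr (R v) i
  rw [hR, ← toEuclideanLin_mul_apply, hSB, toEuclideanLin_mul_apply, ← hR,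
    OrthonormalBasis.repr_apply_apply, OrthonormalBasis.repr_apply_apply]
  have hsym := Matrix.isSymmetric_toEuclideanLin_iff.2 hS.1
  rw [← hsym (b i) (R v)]
  have he : Matrix.toEuclideanLin S (b i) = hS.1.eigenvalues i • b i := by
    have := hS.1.mulVec_eigenvectorBasis i
    rw [Matrix.toLpLin_apply]
    ext j
    simpa using congrFun this j
  rw [he, real_inner_smul_left]

end Diagonalisation

/-! ### The vector system, solved coordinatewise in the eigenbasis. -/

section VectorExistence

variable {Ω : Type*} [mΩ : MeasurableSpace Ω] {T : ℝ≥0} {d : ℕ} {F : Filtration (Time T) mΩ}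
  {P : Measure Ω}

lemma martingale_clm {V V' : Type*} [NormedAddCommGroup V] [NormedSpace ℝ V] [CompleteSpace V]
    [NormedAddCommGroup V'] [NormedSpace ℝ V'] [CompleteSpace V'] {M : Time T → Ω → V}
    (hM : Martingale M F P) (L : V →L[ℝ] V') : Martingale (fun t ω => L (M t ω)) F P := by
  refine ⟨fun t => L.continuous.comp_stronglyMeasurable (hM.stronglyAdapted t),
    fun s t hst => ?_⟩
  have h1 := L.comp_condExp_comm (m := F s) (hM.integrable t)
  filter_upwards [h1, hM.2 s t hst] with ω h1 h2
  refine Eq.trans h1.symm ?_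
  simp [h2]

lemma martingale_sum {ι : Type*} {V : Type*} [NormedAddCommGroup V] [NormedSpace ℝ V]
    [CompleteSpace V] (s : Finset ι) {M : ι → Time T → Ω → V}
    (hM : ∀ i, Martingale (M i) F P) : Martingale (∑ i ∈ s, M i) F P := by
  classical
  induction s using Finset.induction_on with
  | empty => simpa using martingale_zero V F P
  | insert a s ha ih => rw [Finset.sum_insert ha]; exact (hM a).add ih

lemma martingale_vec [IsFiniteMeasure P] {m : Fin d → Time T → Ω → ℝ}
    (hm : ∀ i, Martingale (m i) F P) :
    Martingale (fun t ω => WithLp.toLp 2 fun i => m i t ω : Time T → Ω → Vec d) F P := by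
  have h := martingale_sum Finset.univ fun i => martingale_clm (hm i)
    ((ContinuousLinearMap.id ℝ ℝ).smulRight (EuclideanSpace.single i (1 : ℝ) : Vec d))
  convert h using 1
  funext t ω
  ext i
  simp [Finset.sum_apply, Pi.single_apply]

/-- Existence of a bounded solution of the linear forward-backward system. -/
lemma exists_fbsde_solution [IsProbabilityMeasure P]
    (hcv : ∀ (ξ : Ω → ℝ) (C : ℝ), StronglyMeasurable[F (tEnd T)] ξ → (∀ ω, ‖ξ ω‖ ≤ C) →
      HasContVersion F P ξ)
    (r : ℝ) (L : Vec d →L[ℝ] Vec d) (Q : Vec d ≃L[ℝ] Vec d) {D : Fin d → ℝ} (hD : ∀ i, 0 < D i)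
    (hQ : ∀ v i, Q (L v) i = D i * Q v i) {TP : Time T → Ω → Vec d} (hTP : MemHInf F P TP) :
    ∃ X M, MemHInf F P X ∧ IsBoundedContMartingale F P M ∧
      HasDynamics P X (fun t ω => L (primitive X t ω - TP t ω) + r • X t ω) M ∧
      ∀ᵐ ω ∂P, X (tEnd T) ω = 0 := by
  obtain ⟨TP', C, hTPo, hTPb, hTPe⟩ := hTP.exists_bounded
  have hfo : ∀ i, IsOpt F fun t ω => Q (TP' t ω) i := fun i =>
    hTPo.comp (((EuclideanSpace.proj (𝕜 := ℝ) i : Vec d →L[ℝ] ℝ).comp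
      (Q : Vec d →L[ℝ] Vec d)).measurable)
  have hfb : ∀ i t ω, ‖Q (TP' t ω) i‖ ≤ ‖(Q : Vec d →L[ℝ] Vec d)‖ * C := fun i t ω =>
    (PiLp.norm_apply_le _ i).trans
      (((Q : Vec d →L[ℝ] Vec d).le_opNorm _).trans
        (mul_le_mul_of_nonneg_left (hTPb t ω) (norm_nonneg _)))
  -- In the coordinates given by `Q` the system decouples: coordinate `i` has coefficient `D i` and
  -- target `Q (TP') i`.
  choose x m hxo hxc hxb hm hmc hmb hsol using fun i =>
    exists_scalar_solution hcv r (hD i) (hfo i) (hfb i)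
  choose Dx hDx using hxb
  choose Dm hDm using hmb
  let y : Time T → Ω → Vec d := fun t ω => WithLp.toLp 2 fun i => x i t ω
  let n : Time T → Ω → Vec d := fun t ω => WithLp.toLp 2 fun i => m i t ω
  have hvec : ∀ {z : Fin d → Time T → Ω → ℝ} {K : Fin d → ℝ}, (∀ i, IsOpt F (z i)) →
      (∀ i, ∀ᵐ ω ∂P, ∀ t, |z i t ω| ≤ K i) →
      MemHInf F P (fun t ω => WithLp.toLp 2 fun i => z i t ω : Time T → Ω → Vec d) :=
    fun {z K} h1 h2 => by
    refine memHInf_iff.2 ⟨isOpt_vec h1, ∑ i, |K i|, by positivity, ?_⟩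
    filter_upwards [ae_all_iff.2 h2] with ω hω
    refine .of_forall fun t => ?_
    have := (EuclideanSpace.basisFun (Fin d) ℝ).sum_repr (WithLp.toLp 2 fun i => z i t ω)
    rw [← this]
    refine (norm_sum_le _ _).trans (Finset.sum_le_sum fun i _ => ?_)
    rw [norm_smul, OrthonormalBasis.norm_eq_one, mul_one]
    exact (hω i t).trans (le_abs_self _)
  have hcvec : ∀ {z : Fin d → Time T → ℝ}, (∀ i, Continuous (z i)) →
      Continuous (fun t => WithLp.toLp 2 fun i => z i t : Time T → Vec d) := fun h =>
    (PiLp.continuous_toLp 2 _).comp (continuous_pi h)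
  have hy : MemHInf F P y := hvec hxo hDx
  have hmo : ∀ i, IsOpt F (m i) := fun i => isOpt_of_continuous (hm i).stronglyAdapted (hmc i)
  have hn : MemHInf F P n := hvec hmo hDm
  let R : Vec d →L[ℝ] Vec d := (Q.symm : Vec d →L[ℝ] Vec d)
  refine ⟨fun t ω => R (y t ω), fun t ω => R (n t ω), hy.clm R,
    ⟨martingale_clm (martingale_vec hm) R, .of_forall fun ω => R.continuous.comp (hcvec fun i => hmc i ω),
      hn.clm R⟩, ?_, ?_⟩
  · filter_upwards [ae_all_iff.2 hsol, hTPe] with ω hω hTω t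
    have cy : Continuous fun t => y t ω := hcvec fun i => hxc i ω
    have cX : Continuous fun t => R (y t ω) := R.continuous.comp cy
    have iX := integrable_leb_of_continuous cX
    have cpX : Continuous (pathPrim fun t => R (y t ω)) := continuous_pathPrim iX
    have iT : Integrable (fun t => TP' t ω) (leb T) :=
      hTPo.integrable_path (.of_forall fun t => hTPb t ω)
    have hcongr : primitive (fun t ω => L (primitive (fun t ω => R (y t ω)) t ω - TP t ω) +
        r • R (y t ω)) t ω =
        pathPrim (fun s => L (pathPrim (fun s => R (y s ω)) s - TP' s ω) + r • R (y s ω)) t := by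
      refine congrFun (pathPrim_congr ?_) t
      filter_upwards [hTω] with s hs
      rw [hs]; rfl
    rw [hcongr]
    have ig : Integrable (fun s => L (pathPrim (fun s => R (y s ω)) s - TP' s ω) + r • R (y s ω))
        (leb T) :=
      (L.integrable_comp ((integrable_leb_of_continuous cpX).sub iT)).add (iX.smul r)
    apply Q.injective
    ext i
    have hQR : ∀ v, Q (R v) = v := Q.apply_symm_apply
    let pr : Vec d →L[ℝ] ℝ :=
      (EuclideanSpace.proj (𝕜 := ℝ) i : Vec d →L[ℝ] ℝ).comp (Q : Vec d →L[ℝ] Vec d)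
    have hpr : ∀ v, Q v i = pr v := fun v => rfl
    have hprX : ∀ t, pr (R (y t ω)) = x i t ω := fun t => by rw [← hpr, hQR]
    have hprn : ∀ t, pr (R (n t ω)) = m i t ω := fun t => by rw [← hpr, hQR]
    have hprL : ∀ v, pr (L v) = D i * pr v := fun v => hQ v i
    rw [hpr, hpr, map_add, map_add, map_sub, ← pathPrim_clm pr ig, hprX, hprX, hprn, hprn,
      (hω i).1 t]
    congr 2
    refine congrFun (congrArg _ (funext fun s => ?_)) t
    rw [map_add, map_smul, hprL, map_sub, ← pathPrim_clm pr iX, hprX, smul_eq_mul]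
    congr 3
    exact congrFun (congrArg _ (funext fun s => (hprX s).symm)) s
  · filter_upwards [ae_all_iff.2 hsol] with ω hω
    have : y (tEnd T) ω = 0 := by ext i; exact (hω i).2
    rw [this, map_zero]

end VectorExistence

/-! ### Exact second-order expansion of the running reward. -/

section Quadratic

/-- A quadratic function equals its second-order Taylor polynomial; symmetry of `S` and `A` merges
the cross terms. The price impact term is itself quadratic in the position, so the curvatures `κ`
and `κ'` add. -/
lemma quadratic_sub {V : Type*} [NormedAddCommGroup V] [InnerProductSpace ℝ V] {S A : V →ₗ[ℝ] V}
    (hS : S.IsSymmetric) (hA : A.IsSymmetric) (κ κ' c : ℝ) (p H x h o z w : V) :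
    (⟪p + H, κ • S (o - (p + H)) + w⟫ - κ' * ⟪p + H + z, S (p + H + z)⟫ -
        c * ⟪x + h, A (x + h)⟫) -
      (⟪p, κ • S (o - p) + w⟫ - κ' * ⟪p + z, S (p + z)⟫ - c * ⟪x, A x⟫) =
    (⟪H, κ • S o + w - (2 * κ') • S z - (2 * (κ + κ')) • S p⟫ - 2 * c * ⟪h, A x⟫) -
      ((κ + κ') * ⟪H, S H⟫ + c * ⟪h, A h⟫) := by
  have e : ∀ {S : V →ₗ[ℝ] V}, S.IsSymmetric → ∀ u v, ⟪u, S v⟫ = ⟪v, S u⟫ := fun h u v => by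
    rw [← h u v, real_inner_comm]
  simp only [map_add, map_sub, inner_add_left, inner_add_right, inner_sub_right,
    real_inner_smul_right, smul_add, smul_sub]
  rw [e hS p H, e hS z H, e hA x h]
  ring

lemma inner_toEuclideanLin_pos {d : ℕ} {A : Matrix (Fin d) (Fin d) ℝ} (hA : A.PosDef) {v : Vec d}
    (hv : v ≠ 0) : 0 < ⟪v, Matrix.toEuclideanLin A v⟫ := by
  have h := hA.dotProduct_mulVec_pos (x := v.ofLp) (by simpa using hv)
  rw [EuclideanSpace.inner_eq_star_dotProduct, dotProduct_comm]
  simpa using h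

lemma inner_toEuclideanLin_nonneg {d : ℕ} {A : Matrix (Fin d) (Fin d) ℝ} (hA : A.PosDef)
    (v : Vec d) : 0 ≤ ⟪v, Matrix.toEuclideanLin A v⟫ := by
  rcases eq_or_ne v 0 with rfl | hv
  · simp
  · exact (inner_toEuclideanLin_pos hA hv).le

end Quadratic

/-! ### Essentially bounded functions. -/

section EssBounded

variable {α : Type*} {mα : MeasurableSpace α} {μ : Measure α} {V V' V'' : Type*}
  [NormedAddCommGroup V] [NormedAddCommGroup V'] [NormedAddCommGroup V'']

/-- Almost everywhere strongly measurable and essentially bounded functions. -/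
def EssBounded (μ : Measure α) (f : α → V) : Prop :=
  AEStronglyMeasurable f μ ∧ ∃ C : ℝ, ∀ᵐ p ∂μ, ‖f p‖ ≤ C

lemma EssBounded.integrable [IsFiniteMeasure μ] {f : α → V} (hf : EssBounded μ f) :
    Integrable f μ := by
  obtain ⟨h, C, hC⟩ := hf
  exact Integrable.of_bound h C hC

lemma EssBounded.congr {f g : α → V} (hf : EssBounded μ f) (h : f =ᵐ[μ] g) : EssBounded μ g := by
  obtain ⟨hm, C, hC⟩ := hf
  refine ⟨hm.congr h, C, ?_⟩
  filter_upwards [hC, h] with p h1 h2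
  rwa [← h2]

lemma EssBounded.add {f g : α → V} (hf : EssBounded μ f) (hg : EssBounded μ g) :
    EssBounded μ fun p => f p + g p := by
  obtain ⟨hm, C, hC⟩ := hf
  obtain ⟨hm', D, hD⟩ := hg
  refine ⟨hm.add hm', C + D, ?_⟩
  filter_upwards [hC, hD] with p h1 h2 using (norm_add_le _ _).trans (add_le_add h1 h2)

lemma EssBounded.sub {f g : α → V} (hf : EssBounded μ f) (hg : EssBounded μ g) :
    EssBounded μ fun p => f p - g p := by
  obtain ⟨hm, C, hC⟩ := hf
  obtain ⟨hm', D, hD⟩ := hg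
  refine ⟨hm.sub hm', C + D, ?_⟩
  filter_upwards [hC, hD] with p h1 h2 using (norm_sub_le _ _).trans (add_le_add h1 h2)

variable [NormedSpace ℝ V] [NormedSpace ℝ V'] [NormedSpace ℝ V'']

lemma EssBounded.clm {f : α → V} (hf : EssBounded μ f) (L : V →L[ℝ] V') :
    EssBounded μ fun p => L (f p) := by
  obtain ⟨hm, C, hC⟩ := hf
  refine ⟨L.continuous.comp_aestronglyMeasurable hm, ‖L‖ * C, ?_⟩
  filter_upwards [hC] with p h1
  exact (L.le_opNorm _).trans (mul_le_mul_of_nonneg_left h1 (norm_nonneg _))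

lemma EssBounded.bilin {f : α → V} {g : α → V'} (hf : EssBounded μ f) (hg : EssBounded μ g)
    (β : V →L[ℝ] V' →L[ℝ] V'') : EssBounded μ fun p => β (f p) (g p) := by
  obtain ⟨hm, C, hC⟩ := hf
  obtain ⟨hm', D, hD⟩ := hg
  refine ⟨β.aestronglyMeasurable_comp₂ hm hm', ‖β‖ * C * D, ?_⟩
  filter_upwards [hC, hD] with p h1 h2
  refine (β.le_opNorm₂ _ _).trans ?_
  have : 0 ≤ C := (norm_nonneg _).trans h1
  gcongr

lemma EssBounded.smul {k : α → ℝ} {f : α → V} (hk : EssBounded μ k) (hf : EssBounded μ f) :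
    EssBounded μ fun p => k p • f p :=
  hk.bilin hf (ContinuousLinearMap.lsmul ℝ ℝ)

end EssBounded

/-! ### Essential bounds on [0,T] × Ω. -/

section ProductBounds

variable {Ω : Type*} [mΩ : MeasurableSpace Ω] {T : ℝ≥0} {d : ℕ} {F : Filtration (Time T) mΩ}
  {P : Measure Ω}

lemma ae_prod_of_ae_forall {p : Time T → Ω → Prop} (h : ∀ᵐ ω ∂P, ∀ t, p t ω) :
    ∀ᵐ q ∂((leb T).prod P), p q.1 q.2 := by
  filter_upwards [Measure.quasiMeasurePreserving_snd.ae h] with q hq using hq q.1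

lemma essBounded_deterministic {k : Time T → ℝ} (hk : Continuous k) :
    EssBounded ((leb T).prod P) fun q => k q.1 := by
  obtain ⟨C, hC⟩ := exists_bound_of_continuous hk
  exact ⟨(hk.measurable.comp measurable_fst).aestronglyMeasurable, C, .of_forall fun q => hC q.1⟩

variable [IsFiniteMeasure P]

lemma MemHInf.essBounded {X : Time T → Ω → Vec d} (hX : MemHInf F P X) :
    EssBounded ((leb T).prod P) fun q => X q.1 q.2 := by
  obtain ⟨ho, C, hC, hX⟩ := memHInf_iff.1 hX
  exact ⟨ho.measurable_uncurry.aestronglyMeasurable, C, ho.ae_prod hX⟩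

lemma MemHInf.essBounded_primitive {X : Time T → Ω → Vec d} (hX : MemHInf F P X) :
    EssBounded ((leb T).prod P) fun q => primitive X q.1 q.2 := by
  obtain ⟨Y, hY, -, -, h⟩ := hX.exists_primitive
  exact hY.essBounded.congr (ae_prod_of_ae_forall h)

end ProductBounds

/-! ### Expansion and strict concavity of the objective. -/

section Objective

variable {Ω : Type*} [mΩ : MeasurableSpace Ω] {T : ℝ≥0} {d N : ℕ} {F : Filtration (Time T) mΩ}
  {P : Measure Ω} [IsProbabilityMeasure P] {r δbar : ℝ} {Sig Lam : Matrix (Fin d) (Fin d) ℝ}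
  {δ : Fin N → ℝ} {ζ : Fin N → Time T → Ω → Vec d} {ψ ψdot aψ : Time T → Ω → Vec d} {n : Fin N}

omit mΩ in
/-- The target portfolio in terms of the data of the objective. -/
lemma smul_toEuclideanLin_targetPortfolio (hN : 2 ≤ N) (hSig : Sig.PosDef) (hδbar : 0 < δbar)
    (hδ : ∀ m, δ m = δbar) (t : Time T) (ω : Ω) :
    (((N + 1) / (N - 1) : ℝ) / δbar) •
        Matrix.toEuclideanLin Sig (targetPortfolio r δbar Sig Lam δ ζ ψ ψdot aψ n t ω) =
      (δbar * ((N : ℝ) - 1))⁻¹ • Matrix.toEuclideanLin Sig (exposureOthers ζ n t ω - ψ t ω) +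
        Matrix.toEuclideanLin ((2 / ((N : ℝ) - 1)) • Lam) (aψ t ω - r • ψdot t ω) -
        (2 * (1 / (2 * δbar))) • Matrix.toEuclideanLin Sig (ζ n t ω) := by
  have hN' : (2 : ℝ) ≤ N := by exact_mod_cast hN
  have h1 : (N : ℝ) - 1 ≠ 0 := by linarith
  have h2 : (N : ℝ) + 1 ≠ 0 := by positivity
  have h3 : (N : ℝ) ≠ 0 := by positivity
  have hrel : relTolerance δ n = 1 / N := by
    simp only [relTolerance, hδ, Finset.sum_const, Finset.card_univ, Fintype.card_fin, nsmul_eq_mul]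
    field_simp
  have hSL : Matrix.toEuclideanLin Sig
      (Matrix.toEuclideanLin (Sig⁻¹ * Lam) (aψ t ω - r • ψdot t ω)) =
      Matrix.toEuclideanLin Lam (aψ t ω - r • ψdot t ω) := by
    rw [← toEuclideanLin_mul_apply, ← mul_assoc,
      Matrix.mul_nonsing_inv _ ((Matrix.isUnit_iff_isUnit_det _).1 hSig.isUnit), one_mul]
  simp only [targetPortfolio, bestResponse, hrel]
  rw [map_add, map_smul, map_smul, hSL, map_sub (Matrix.toEuclideanLin Sig) (_ • _), map_smul,
    map_smul, map_smul Matrix.toEuclideanLin, LinearMap.smul_apply]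
  generalize Matrix.toEuclideanLin Sig (exposureOthers ζ n t ω - ψ t ω) = u
  generalize Matrix.toEuclideanLin Lam (aψ t ω - r • ψdot t ω) = v
  generalize Matrix.toEuclideanLin Sig (ζ n t ω) = w
  match_scalars <;> field_simp <;> ring

omit mΩ in
/-- The objective integrand is quadratic in the position and the trading rate. -/
lemma objectiveIntegrand_sub (hN : 2 ≤ N) (hSig : Sig.PosDef) (hLam : Lam.PosDef)
    (hδbar : 0 < δbar) (hδ : ∀ m, δ m = δbar) {c : ℝ} (hc : c = (N + 1) / (N - 1))
    (X Y : Time T → Ω → Vec d) (t : Time T) (ω : Ω) :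
    objectiveIntegrand r δbar Sig Lam ζ ψ ψdot aψ n Y t ω -
        objectiveIntegrand r δbar Sig Lam ζ ψ ψdot aψ n X t ω =
      Real.exp (-r * t) * (⟪primitive Y t ω - primitive X t ω, (c / δbar) •
          Matrix.toEuclideanLin Sig
            (targetPortfolio r δbar Sig Lam δ ζ ψ ψdot aψ n t ω - primitive X t ω)⟫ -
          2 * c * ⟪Y t ω - X t ω, Matrix.toEuclideanLin Lam (X t ω)⟫) -
        Real.exp (-r * t) * (c / (2 * δbar) * ⟪primitive Y t ω - primitive X t ω,
          Matrix.toEuclideanLin Sig (primitive Y t ω - primitive X t ω)⟫ +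
          c * ⟪Y t ω - X t ω, Matrix.toEuclideanLin Lam (Y t ω - X t ω)⟫) := by
  have hN' : (2 : ℝ) ≤ N := by exact_mod_cast hN
  have h1 : (N : ℝ) - 1 ≠ 0 := by linarith
  have hS := Matrix.isSymmetric_toEuclideanLin_iff.2 hSig.1
  have hA := Matrix.isSymmetric_toEuclideanLin_iff.2 hLam.1
  -- Price impact and risk aversion add up to curvature c/(2δbar) in the position, while 1 + 2/(N-1)
  -- = c is the factor of the trading cost.
  have hcc : (δbar * ((N : ℝ) - 1))⁻¹ + 1 / (2 * δbar) = c / (2 * δbar) := by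
    rw [hc]; field_simp; ring
  have hcc' : 2 * (c / (2 * δbar)) = c / δbar := by field_simp
  have h3 : ∀ v : Vec d, Matrix.toEuclideanLin (Lam + (2 / ((N : ℝ) - 1)) • Lam) v =
      c • Matrix.toEuclideanLin Lam v := fun v => by
    rw [map_add, map_smul, LinearMap.add_apply, LinearMap.smul_apply, hc]
    match_scalars; field_simp; ring
  have key := quadratic_sub hS hA (δbar * ((N : ℝ) - 1))⁻¹ (1 / (2 * δbar)) c (primitive X t ω)
    (primitive Y t ω - primitive X t ω) (X t ω) (Y t ω - X t ω) (exposureOthers ζ n t ω - ψ t ω)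
    (ζ n t ω) (Matrix.toEuclideanLin ((2 / ((N : ℝ) - 1)) • Lam) (aψ t ω - r • ψdot t ω))
  have hTP := smul_toEuclideanLin_targetPortfolio (r := r) (Lam := Lam) (ζ := ζ) (ψ := ψ)
    (ψdot := ψdot) (aψ := aψ) (n := n) hN hSig hδbar hδ t ω
  rw [← hc] at hTP
  rw [add_sub_cancel, add_sub_cancel, hcc, hcc'] at key
  rw [map_sub (Matrix.toEuclideanLin Sig) (targetPortfolio _ _ _ _ _ _ _ _ _ _ _ _), smul_sub, hTP,
    ← mul_sub]
  rw [← key]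
  simp only [objectiveIntegrand, h3, real_inner_smul_right, sub_right_comm _ _ (ψ t ω)]
  ring

omit [IsProbabilityMeasure P] in
lemma essBounded_exp (r : ℝ) :
    EssBounded ((leb T).prod P) fun q => Real.exp (-r * (q.1 : ℝ)) :=
  essBounded_deterministic (k := fun t : Time T => Real.exp (-r * (t : ℝ))) (by fun_prop)

omit [IsProbabilityMeasure P] in
lemma EssBounded.inner_toEuclideanLin {f g : Time T × Ω → Vec d}
    (hf : EssBounded ((leb T).prod P) f) (hg : EssBounded ((leb T).prod P) g)
    (A : Matrix (Fin d) (Fin d) ℝ) :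
    EssBounded ((leb T).prod P) fun q => ⟪f q, Matrix.toEuclideanLin A (g q)⟫ :=
  hf.bilin (hg.clm (Matrix.toEuclideanLin A).toContinuousLinearMap) (innerSL ℝ)

omit [IsProbabilityMeasure P] in
lemma EssBounded.const_smul {V : Type*} [NormedAddCommGroup V] [NormedSpace ℝ V]
    {f : Time T × Ω → V} (hf : EssBounded ((leb T).prod P) f) (c : ℝ) :
    EssBounded ((leb T).prod P) fun q => c • f q :=
  hf.clm (c • ContinuousLinearMap.id ℝ V)

lemma essBounded_objectiveIntegrand (hζ : ∀ m, MemHInf F P (ζ m)) (hψdot : MemHInf F P ψdot)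
    (hψ : HasRate P ψ ψdot) (haψ : MemHInf F P aψ) {X : Time T → Ω → Vec d}
    (hX : MemHInf F P X) :
    EssBounded ((leb T).prod P) fun q =>
      objectiveIntegrand r δbar Sig Lam ζ ψ ψdot aψ n X q.1 q.2 := by
  have hp := hX.essBounded_primitive
  have hψb : EssBounded ((leb T).prod P) fun q => ψ q.1 q.2 := by
    refine hψdot.essBounded_primitive.congr (ae_prod_of_ae_forall
      (p := fun t ω => primitive ψdot t ω = ψ t ω) ?_)
    filter_upwards [hψ] with ω hω t
    rw [hω.2 t, hω.1, zero_add]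
  have ho : EssBounded ((leb T).prod P) fun q => exposureOthers ζ n q.1 q.2 :=
    (MemHInf.sum (Finset.univ.erase n) hζ).essBounded
  have h1 : EssBounded ((leb T).prod P) fun q => (δbar * ((N : ℝ) - 1))⁻¹ •
      Matrix.toEuclideanLin Sig (exposureOthers ζ n q.1 q.2 - primitive X q.1 q.2 - ψ q.1 q.2) :=
    (((ho.sub hp).sub hψb).clm (Matrix.toEuclideanLin Sig).toContinuousLinearMap).const_smul _
  have h2 : EssBounded ((leb T).prod P) fun q =>
      Matrix.toEuclideanLin ((2 / ((N : ℝ) - 1)) • Lam) (aψ q.1 q.2 - r • ψdot q.1 q.2) :=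
    (haψ.essBounded.sub (hψdot.essBounded.const_smul r)).clm
      (Matrix.toEuclideanLin ((2 / ((N : ℝ) - 1)) • Lam)).toContinuousLinearMap
  have h3 := hp.add (hζ n).essBounded
  exact (essBounded_exp r).smul (((hp.bilin (h1.add h2) (innerSL ℝ)).sub
    ((h3.inner_toEuclideanLin h3 Sig).const_smul _)).sub
    (hX.essBounded.inner_toEuclideanLin hX.essBounded _))

/-- The first variation of the objective at `X` in the direction `Y - X`. -/
noncomputable def firstVariation (P : Measure Ω) (r δbar c : ℝ) (Sig Lam : Matrix (Fin d) (Fin d) ℝ)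
    (TP X Y : Time T → Ω → Vec d) : ℝ :=
  ∫ q, Real.exp (-r * (q.1 : ℝ)) * (⟪primitive Y q.1 q.2 - primitive X q.1 q.2, (c / δbar) •
      Matrix.toEuclideanLin Sig (TP q.1 q.2 - primitive X q.1 q.2)⟫ -
      2 * c * ⟪Y q.1 q.2 - X q.1 q.2, Matrix.toEuclideanLin Lam (X q.1 q.2)⟫) ∂((leb T).prod P)

/-- The discounted quadratic loss of the difference of two trading rates. -/
noncomputable def quadraticLoss (r δbar c : ℝ) (Sig Lam : Matrix (Fin d) (Fin d) ℝ)
    (X Y : Time T → Ω → Vec d) (q : Time T × Ω) : ℝ :=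
  Real.exp (-r * (q.1 : ℝ)) * (c / (2 * δbar) * ⟪primitive Y q.1 q.2 - primitive X q.1 q.2,
    Matrix.toEuclideanLin Sig (primitive Y q.1 q.2 - primitive X q.1 q.2)⟫ +
    c * ⟪Y q.1 q.2 - X q.1 q.2, Matrix.toEuclideanLin Lam (Y q.1 q.2 - X q.1 q.2)⟫)

lemma essBounded_quadraticLoss {X Y : Time T → Ω → Vec d} (hX : MemHInf F P X)
    (hY : MemHInf F P Y) (c : ℝ) :
    EssBounded ((leb T).prod P) (quadraticLoss r δbar c Sig Lam X Y) := by
  have h1 := hY.essBounded_primitive.sub hX.essBounded_primitive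
  have h2 := hY.essBounded.sub hX.essBounded
  exact (essBounded_exp r).smul (((h1.inner_toEuclideanLin h1 Sig).const_smul _).add
    ((h2.inner_toEuclideanLin h2 Lam).const_smul _))

omit mΩ in
lemma quadraticLoss_nonneg (hSig : Sig.PosDef) (hLam : Lam.PosDef) (hδbar : 0 < δbar) {c : ℝ}
    (hc : 0 < c) (X Y : Time T → Ω → Vec d) (q : Time T × Ω) :
    0 ≤ quadraticLoss r δbar c Sig Lam X Y q :=
  mul_nonneg (Real.exp_pos _).le (add_nonneg
    (mul_nonneg (by positivity) (inner_toEuclideanLin_nonneg hSig _))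
    (mul_nonneg hc.le (inner_toEuclideanLin_nonneg hLam _)))

/-- Trading rates without quadratic loss relative to each other are indistinguishable. -/
lemma indistinguishable_of_integral_quadraticLoss (hT : 0 < T) (hSig : Sig.PosDef)
    (hLam : Lam.PosDef) (hδbar : 0 < δbar) {c : ℝ} (hc : 0 < c) {X Y : Time T → Ω → Vec d}
    (hX : X ∈ classA d F P) (hY : Y ∈ classA d F P)
    (h : ∫ q, quadraticLoss r δbar c Sig Lam X Y q ∂((leb T).prod P) ≤ 0) :
    Indistinguishable P X Y := by
  have hX' := hX.1.choose_spec.choose_spec.1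
  have hY' := hY.1.choose_spec.choose_spec.1
  have hint := (essBounded_quadraticLoss (r := r) (δbar := δbar) (Sig := Sig) (Lam := Lam)
    hX' hY' c).integrable
  have hnn := quadraticLoss_nonneg (r := r) hSig hLam hδbar hc X Y
  have h0 := (integral_eq_zero_iff_of_nonneg hnn hint).1 (le_antisymm h (integral_nonneg hnn))
  -- The Λ-term alone forces equality of the rates; the Σ-term need only be nonnegative.
  have h1 : ∀ᵐ q ∂((leb T).prod P), X q.1 q.2 = Y q.1 q.2 := by
    filter_upwards [h0] with q hq
    by_contra hne
    have h2 := mul_pos hc (inner_toEuclideanLin_pos hLam (sub_ne_zero.2 (Ne.symm hne)))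
    have h3 : 0 ≤ c / (2 * δbar) * ⟪primitive Y q.1 q.2 - primitive X q.1 q.2,
        Matrix.toEuclideanLin Sig (primitive Y q.1 q.2 - primitive X q.1 q.2)⟫ :=
      mul_nonneg (by positivity) (inner_toEuclideanLin_nonneg hSig _)
    exact (mul_pos (Real.exp_pos (-r * (q.1 : ℝ))) (add_pos_of_nonneg_of_pos h3 h2)).ne' hq
  have hm : MeasurableSet {q : Time T × Ω | X q.1 q.2 = Y q.1 q.2} :=
    measurableSet_eq_fun (IsOpt.measurable_uncurry (memHInf_iff.1 hX').1)
      (IsOpt.measurable_uncurry (memHInf_iff.1 hY').1)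
  rw [Measure.ae_prod_iff_ae_ae hm, Measure.ae_ae_comm hm] at h1
  have := leb_isOpenPosMeasure hT
  filter_upwards [h1, ae_continuous_of_mem_classA hX, ae_continuous_of_mem_classA hY]
    with ω h2 h3 h4 t
  exact congrFun (Continuous.ae_eq_iff_eq (leb T) h3 h4 |>.1 h2) t

lemma objective_eq_integral_prod (hζ : ∀ m, MemHInf F P (ζ m)) (hψdot : MemHInf F P ψdot)
    (hψ : HasRate P ψ ψdot) (haψ : MemHInf F P aψ) {X : Time T → Ω → Vec d}
    (hX : MemHInf F P X) :
    objective P r δbar Sig Lam ζ ψ ψdot aψ n X =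
      ∫ q, objectiveIntegrand r δbar Sig Lam ζ ψ ψdot aψ n X q.1 q.2 ∂((leb T).prod P) :=
  (integral_prod_symm _ (essBounded_objectiveIntegrand hζ hψdot hψ haψ hX).integrable).symm

/-- Second-order expansion of the objective. -/
lemma objective_sub (hN : 2 ≤ N) (hSig : Sig.PosDef) (hLam : Lam.PosDef) (hδbar : 0 < δbar)
    (hδ : ∀ m, δ m = δbar) {c : ℝ} (hc : c = (N + 1) / (N - 1))
    (hζ : ∀ m, MemHInf F P (ζ m)) (hψdot : MemHInf F P ψdot)
    (hψ : HasRate P ψ ψdot) (haψ : MemHInf F P aψ) {X Y : Time T → Ω → Vec d}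
    (hX : MemHInf F P X) (hY : MemHInf F P Y) :
    objective P r δbar Sig Lam ζ ψ ψdot aψ n Y - objective P r δbar Sig Lam ζ ψ ψdot aψ n X =
      firstVariation P r δbar c Sig Lam (targetPortfolio r δbar Sig Lam δ ζ ψ ψdot aψ n) X Y -
        ∫ q, quadraticLoss r δbar c Sig Lam X Y q ∂((leb T).prod P) := by
  have hJX := essBounded_objectiveIntegrand (r := r) (δbar := δbar) (Sig := Sig) (Lam := Lam)
    (n := n) hζ hψdot hψ haψ hX
  have hJY := essBounded_objectiveIntegrand (r := r) (δbar := δbar) (Sig := Sig) (Lam := Lam)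
    (n := n) hζ hψdot hψ haψ hY
  have hq := essBounded_quadraticLoss (r := r) (δbar := δbar) (Sig := Sig) (Lam := Lam) hX hY c
  rw [objective_eq_integral_prod hζ hψdot hψ haψ hX, objective_eq_integral_prod hζ hψdot hψ haψ hY,
    ← integral_sub hJY.integrable hJX.integrable, firstVariation, eq_sub_iff_add_eq,
    ← integral_add (hJY.sub hJX).integrable hq.integrable]
  refine integral_congr_ae (.of_forall fun q => ?_)
  change _ - _ + quadraticLoss r δbar c Sig Lam X Y q = _
  rw [objectiveIntegrand_sub (δ := δ) hN hSig hLam hδbar hδ hc, quadraticLoss, sub_add_cancel]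

omit [IsProbabilityMeasure P] in
lemma primitive_add_smul {X Y : Time T → Ω → Vec d} (hX : MemHInf F P X) (hY : MemHInf F P Y)
    (a b : ℝ) : ∀ᵐ ω ∂P, ∀ t,
      primitive (a • X + b • Y) t ω = a • primitive X t ω + b • primitive Y t ω := by
  filter_upwards [hX.ae_integrable, hY.ae_integrable] with ω h1 h2 t
  exact (pathPrim_add (h1.smul a) (h2.smul b) t).trans
    (congrArg₂ (· + ·) (pathPrim_smul a (fun s => X s ω) t) (pathPrim_smul b (fun s => Y s ω) t))

/-- Both values are expanded around Z = aX + bY, where X - Z = b(X - Y) and Y - Z = -a(X - Y). With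
weights a and b the linear terms cancel, so the concavity gap is a weighted sum of two losses. If it
vanished, X and Y would both be indistinguishable from Z. -/
lemma objective_strictConcave (hT : 0 < T) (hN : 2 ≤ N) (hSig : Sig.PosDef) (hLam : Lam.PosDef)
    (hδbar : 0 < δbar) (hδ : ∀ m, δ m = δbar) (hζ : ∀ m, MemHInf F P (ζ m))
    (hψdot : MemHInf F P ψdot) (hψ : HasRate P ψ ψdot) (haψ : MemHInf F P aψ)
    {X Y : Time T → Ω → Vec d} (hX : X ∈ classA d F P) (hY : Y ∈ classA d F P)
    (hXY : ¬ Indistinguishable P X Y) {a b : ℝ} (ha : 0 < a) (hb : 0 < b) (hab : a + b = 1) :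
    a * objective P r δbar Sig Lam ζ ψ ψdot aψ n X +
        b * objective P r δbar Sig Lam ζ ψ ψdot aψ n Y <
      objective P r δbar Sig Lam ζ ψ ψdot aψ n (a • X + b • Y) := by
  obtain ⟨c, hc⟩ : ∃ c : ℝ, c = (N + 1) / (N - 1) := ⟨_, rfl⟩
  have hN' : (2 : ℝ) ≤ N := by exact_mod_cast hN
  have hc0 : 0 < c := by
    rw [hc]; exact div_pos (by linarith) (by linarith)
  have hZ := add_smul_mem_classA hX hY a b
  set Z := a • X + b • Y with hZdef
  have hX' : MemHInf F P X := hX.1.choose_spec.choose_spec.1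
  have hY' : MemHInf F P Y := hY.1.choose_spec.choose_spec.1
  have hZ' : MemHInf F P Z := hZ.1.choose_spec.choose_spec.1
  have hJ := fun {V : Time T → Ω → Vec d} (hV : MemHInf F P V) =>
    (essBounded_objectiveIntegrand (r := r) (δbar := δbar) (Sig := Sig) (Lam := Lam)
      (n := n) hζ hψdot hψ haψ hV).integrable
  have hq := fun {V : Time T → Ω → Vec d} (hV : MemHInf F P V) =>
    (essBounded_quadraticLoss (r := r) (δbar := δbar) (Sig := Sig) (Lam := Lam)
      hZ' hV c).integrable
  have iJ : Integrable (fun q : Time T × Ω =>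
      a * objectiveIntegrand r δbar Sig Lam ζ ψ ψdot aψ n X q.1 q.2 +
        b * objectiveIntegrand r δbar Sig Lam ζ ψ ψdot aψ n Y q.1 q.2) ((leb T).prod P) :=
    ((hJ hX').const_mul a).add ((hJ hY').const_mul b)
  have iq : Integrable (fun q => a * quadraticLoss r δbar c Sig Lam Z X q +
      b * quadraticLoss r δbar c Sig Lam Z Y q) ((leb T).prod P) :=
    ((hq hX').const_mul a).add ((hq hY').const_mul b)
  have key : a * objective P r δbar Sig Lam ζ ψ ψdot aψ n X +
      b * objective P r δbar Sig Lam ζ ψ ψdot aψ n Y +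
      (a * ∫ q, quadraticLoss r δbar c Sig Lam Z X q ∂((leb T).prod P) +
        b * ∫ q, quadraticLoss r δbar c Sig Lam Z Y q ∂((leb T).prod P)) =
      objective P r δbar Sig Lam ζ ψ ψdot aψ n Z := by
    rw [objective_eq_integral_prod hζ hψdot hψ haψ hX',
      objective_eq_integral_prod hζ hψdot hψ haψ hY',
      objective_eq_integral_prod hζ hψdot hψ haψ hZ', ← integral_const_mul, ← integral_const_mul,
      ← integral_const_mul, ← integral_const_mul,
      ← integral_add ((hJ hX').const_mul a) ((hJ hY').const_mul b),
      ← integral_add ((hq hX').const_mul a) ((hq hY').const_mul b),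
      ← integral_add iJ iq]
    refine integral_congr_ae ?_
    filter_upwards [ae_prod_of_ae_forall (primitive_add_smul hX' hY' a b)] with q hqp
    have h1 := objectiveIntegrand_sub (r := r) (ζ := ζ) (ψ := ψ) (ψdot := ψdot) (aψ := aψ)
      (n := n) hN hSig hLam hδbar hδ hc Z X q.1 q.2
    have h2 := objectiveIntegrand_sub (r := r) (ζ := ζ) (ψ := ψ) (ψdot := ψdot) (aψ := aψ)
      (n := n) hN hSig hLam hδbar hδ hc Z Y q.1 q.2
    have hb' : b = 1 - a := by linarith
    have e1 : b • (X q.1 q.2 - Y q.1 q.2) = X q.1 q.2 - Z q.1 q.2 := by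
      simp only [hZdef, Pi.add_apply, Pi.smul_apply, hb']; module
    have e2 : (-a) • (X q.1 q.2 - Y q.1 q.2) = Y q.1 q.2 - Z q.1 q.2 := by
      simp only [hZdef, Pi.add_apply, Pi.smul_apply, hb']; module
    have e3 : b • (primitive X q.1 q.2 - primitive Y q.1 q.2) =
        primitive X q.1 q.2 - primitive Z q.1 q.2 := by
      rw [hqp, hb']; module
    have e4 : (-a) • (primitive X q.1 q.2 - primitive Y q.1 q.2) =
        primitive Y q.1 q.2 - primitive Z q.1 q.2 := by
      rw [hqp, hb']; module
    change a * _ + b * _ + (a * quadraticLoss r δbar c Sig Lam Z X q +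
      b * quadraticLoss r δbar c Sig Lam Z Y q) = _
    unfold quadraticLoss
    rw [← e1, ← e3, real_inner_smul_left _ _ b, real_inner_smul_left _ _ b] at h1
    rw [← e2, ← e4, real_inner_smul_left _ _ (-a), real_inner_smul_left _ _ (-a)] at h2
    rw [← e1, ← e2, ← e3, ← e4]
    linear_combination a * h1 + b * h2 +
      hab * objectiveIntegrand r δbar Sig Lam ζ ψ ψdot aψ n Z q.1 q.2
  by_contra! hcon
  refine hXY ?_
  have hnn : ∀ V, 0 ≤ ∫ q, quadraticLoss r δbar c Sig Lam Z V q ∂((leb T).prod P) := fun V =>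
    integral_nonneg (quadraticLoss_nonneg hSig hLam hδbar hc0 Z V)
  have h1 : ∫ q, quadraticLoss r δbar c Sig Lam Z X q ∂((leb T).prod P) ≤ 0 := by
    have := mul_nonneg hb.le (hnn Y)
    by_contra! h
    linarith [mul_pos ha h]
  have h2 : ∫ q, quadraticLoss r δbar c Sig Lam Z Y q ∂((leb T).prod P) ≤ 0 := by
    have := mul_nonneg ha.le (hnn X)
    by_contra! h
    linarith [mul_pos hb h]
  filter_upwards [indistinguishable_of_integral_quadraticLoss hT hSig hLam hδbar hc0 hZ hX h1,
    indistinguishable_of_integral_quadraticLoss hT hSig hLam hδbar hc0 hZ hY h2] with ω h3 h4 t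
  rw [← h3 t, h4 t]

end Objective

/-! ### The first-order condition along a single path. -/

section VariationPath

variable {T : ℝ≥0} {V : Type*} [NormedAddCommGroup V] [NormedSpace ℝ V] [CompleteSpace V]

/-- The martingale part of the discounted trading rate. -/
noncomputable def discountedPart (r : ℝ) (M : Time T → V) (t : Time T) : V :=
  Real.exp (-r * (t : ℝ)) • M t -
    pathPrim (fun s : Time T => (-r * Real.exp (-r * (s : ℝ))) • M s) t

lemma hasDerivAt_exp_neg_mul (r t : ℝ) :
    HasDerivAt (fun t => Real.exp (-r * t)) (-r * Real.exp (-r * t)) t := by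
  have := ((hasDerivAt_id t).const_mul (-r)).exp
  simpa [mul_comm] using this

omit [CompleteSpace V] in
lemma continuous_discountedPart (r : ℝ) {M : Time T → V} (hM : Continuous M) :
    Continuous (discountedPart r M) := by
  have h1 : Continuous fun t : Time T => Real.exp (-r * (t : ℝ)) := by fun_prop
  have h2 : Continuous fun t : Time T => -r * Real.exp (-r * (t : ℝ)) := by fun_prop
  exact (h1.smul hM).sub (continuous_pathPrim (integrable_leb_of_continuous (h2.smul hM)))

/-- Discounting cancels the drift `r • x`. As `M` need not have finite variation, the product rule
is applied to `x - M`, whose increments are a primitive, and the contribution of `M` is collected in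
`discountedPart`, which is M(0) + ∫e^{-rs}dM written by parts. -/
lemma exp_smul_eq {r : ℝ} {x M g : Time T → V} (hx : Continuous x) (hM : Continuous M)
    (hg : Integrable g (leb T))
    (hd : ∀ t, x t = x (tStart T) + pathPrim (fun s => g s + r • x s) t + (M t - M (tStart T)))
    (t : Time T) :
    Real.exp (-r * (t : ℝ)) • x t = (x (tStart T) - M (tStart T)) + discountedPart r M t +
      pathPrim (fun s : Time T => Real.exp (-r * (s : ℝ)) • g s) t := by
  have ck : Continuous fun t : Time T => Real.exp (-r * (t : ℝ)) := by fun_prop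
  have ck' : Continuous fun t : Time T => -r * Real.exp (-r * (t : ℝ)) := by fun_prop
  set U := x (tStart T) - M (tStart T) with hU
  have iv : Integrable (fun s => g s + r • x s) (leb T) :=
    hg.add ((integrable_leb_of_continuous hx).smul r)
  have h1 := pathPrim_deriv_smul (hasDerivAt_exp_neg_mul r) (by fun_prop) iv t
  have h2 := pathPrim_deriv (k := fun t => Real.exp (-r * t) • U)
    (fun t => (hasDerivAt_exp_neg_mul r t).smul_const U) (by fun_prop) t
  have i1 : Integrable (fun s : Time T => Real.exp (-r * (s : ℝ)) • g s) (leb T) :=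
    integrable_continuous_smul ck hg
  have i2 : Integrable (fun s : Time T => (-r * Real.exp (-r * (s : ℝ))) • U) (leb T) :=
    integrable_leb_of_continuous (ck'.smul continuous_const)
  have i3 : Integrable (fun s : Time T => (-r * Real.exp (-r * (s : ℝ))) • M s) (leb T) :=
    integrable_leb_of_continuous (ck'.smul hM)
  have i12 : Integrable (fun s : Time T => Real.exp (-r * (s : ℝ)) • g s -
      (-r * Real.exp (-r * (s : ℝ))) • U) (leb T) := i1.sub i2
  have h3 : pathPrim (fun s : Time T => (-r * Real.exp (-r * (s : ℝ))) •
      pathPrim (fun s => g s + r • x s) s + Real.exp (-r * (s : ℝ)) • (g s + r • x s)) t =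
      pathPrim (fun s : Time T => Real.exp (-r * (s : ℝ)) • g s) t -
        (Real.exp (-r * (t : ℝ)) • U - Real.exp (-r * 0) • U) -
        pathPrim (fun s : Time T => (-r * Real.exp (-r * (s : ℝ))) • M s) t := by
    rw [← h2, ← pathPrim_sub i1 i2, ← pathPrim_sub i12 i3]
    congr 1
    funext s
    have : pathPrim (fun s => g s + r • x s) s = x s - U - M s := by
      rw [hd s, hU]; abel
    rw [this]
    module
  rw [h3] at h1
  have h4 : x t = U + M t + pathPrim (fun s => g s + r • x s) t := by
    rw [hd t, hU]; abel
  conv_lhs => rw [h4, smul_add, ← h1]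
  rw [mul_zero, Real.exp_zero, discountedPart]
  module

/-- The first-order condition along a path, by integration by parts. -/
lemma integral_variation {r : ℝ} (β : V →L[ℝ] V →L[ℝ] ℝ) {x M g h : Time T → V}
    (hx : Continuous x) (hM : Continuous M) (hg : Integrable g (leb T))
    (hh : Integrable h (leb T))
    (hd : ∀ t, x t = x (tStart T) + pathPrim (fun s => g s + r • x s) t + (M t - M (tStart T)))
    (hT : x (tEnd T) = 0) :
    ∫ s : Time T, Real.exp (-r * (s : ℝ)) * (β (pathPrim h s) (g s) + β (h s) (x s)) ∂(leb T) =
      ∫ s, β (h s) (discountedPart r M s - discountedPart r M (tEnd T)) ∂(leb T) := by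
  have ck : Continuous fun t : Time T => Real.exp (-r * (t : ℝ)) := by fun_prop
  let G : Time T → V := fun s => Real.exp (-r * (s : ℝ)) • g s
  have iG : Integrable G (leb T) := integrable_continuous_smul ck hg
  have key := exp_smul_eq hx hM hg hd
  have hend := key (tEnd T)
  rw [hT, smul_zero] at hend
  -- Subtracting the identity at T, where `x` vanishes, eliminates the unknown initial value: the
  -- discounted rate is the martingale increment minus the integral of `G` over (s,T].
  have hZ : ∀ s : Time T, Real.exp (-r * (s : ℝ)) • x s =
      (discountedPart r M s - discountedPart r M (tEnd T)) + pathPrim G s -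
        pathPrim G (tEnd T) := fun s => by
    rw [key s, ← sub_eq_zero]
    refine Eq.trans ?_ hend.symm
    simp only [G]
    abel
  -- By parts, the pairing of the primitive of `h` with `G` cancels the contribution of the integral
  -- of `G` over (s,T], so only the martingale increment survives.
  have hbp := pathPrim_by_parts β hh iG (tEnd T)
  have bd : ∀ {z : Time T → V}, Continuous z → Integrable (fun s => β (h s) (z s)) (leb T) :=
    fun {z} hz => by
    obtain ⟨C, hC⟩ := exists_bound_of_continuous hz
    refine (hh.norm.mul_const (‖β‖ * C)).mono'
      (β.aestronglyMeasurable_comp₂ hh.1 hz.aestronglyMeasurable) (.of_forall fun s => ?_)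
    refine (β.le_opNorm₂ _ _).trans ?_
    have := mul_le_mul_of_nonneg_left (hC s) (mul_nonneg (norm_nonneg β) (norm_nonneg (h s)))
    linarith
  have bd' : Integrable (fun s => β (pathPrim h s) (G s)) (leb T) := by
    obtain ⟨C, hC⟩ := exists_bound_of_continuous (continuous_pathPrim hh)
    refine (iG.norm.const_mul (‖β‖ * C)).mono'
      (β.aestronglyMeasurable_comp₂ (continuous_pathPrim hh).aestronglyMeasurable iG.1)
      (.of_forall fun s => ?_)
    refine (β.le_opNorm₂ _ _).trans ?_
    have := mul_le_mul_of_nonneg_right (mul_le_mul_of_nonneg_left (hC s) (norm_nonneg β))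
      (norm_nonneg (G s))
    linarith
  have j1 : Integrable (fun s => β (h s) (discountedPart r M s - discountedPart r M (tEnd T)))
      (leb T) := bd ((continuous_discountedPart r hM).sub continuous_const)
  have j2 : Integrable (fun s => β (h s) (pathPrim G s)) (leb T) := bd (continuous_pathPrim iG)
  have j3 : Integrable (fun s => β (h s) (pathPrim G (tEnd T))) (leb T) := bd continuous_const
  have h3 := pathPrim_clm (β.flip (pathPrim G (tEnd T))) hh (tEnd T)
  simp only [ContinuousLinearMap.flip_apply] at h3
  rw [pathPrim_end] at h3
  rw [pathPrim_end, pathPrim_end, ← h3, ← integral_add j2 bd', ← sub_eq_zero] at hbp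
  have j12 : Integrable (fun s => β (h s) (pathPrim G s) + β (pathPrim h s) (G s)) (leb T) :=
    j2.add bd'
  rw [← integral_sub j12 j3] at hbp
  have j123 : Integrable (fun s => β (h s) (pathPrim G s) + β (pathPrim h s) (G s) -
      β (h s) (pathPrim G (tEnd T))) (leb T) := j12.sub j3
  have hadd := integral_add j1 j123
  rw [hbp, add_zero] at hadd
  rw [← hadd]
  refine integral_congr_ae (.of_forall fun s => ?_)
  have e1 : Real.exp (-r * (s : ℝ)) * β (h s) (x s) =
      β (h s) (Real.exp (-r * (s : ℝ)) • x s) := by simp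
  have e2 : Real.exp (-r * (s : ℝ)) * β (pathPrim h s) (g s) = β (pathPrim h s) (G s) := by
    simp [G]
  change _ * (_ + _) = _
  rw [mul_add, e1, e2, hZ s, map_sub, map_add]
  ring

end VariationPath

/-! ### Adapted processes are orthogonal to future martingale increments. -/

section Orthogonality

variable {Ω : Type*} [mΩ : MeasurableSpace Ω] {T : ℝ≥0} {d : ℕ} {F : Filtration (Time T) mΩ}
  {P : Measure Ω} [IsProbabilityMeasure P]

omit [IsProbabilityMeasure P] in
lemma EssBounded.comp_snd [SFinite P] {V : Type*} [NormedAddCommGroup V] {ξ : Ω → V}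
    (hξ : EssBounded P ξ) : EssBounded ((leb T).prod P) fun q => ξ q.2 := by
  obtain ⟨hm, C, hC⟩ := hξ
  exact ⟨hm.comp_quasiMeasurePreserving Measure.quasiMeasurePreserving_snd, C,
    Measure.quasiMeasurePreserving_snd.ae hC⟩

/-- Predictions based on present information are orthogonal to future martingale increments. -/
lemma integral_bilin_martingale_increment (β : Vec d →L[ℝ] Vec d →L[ℝ] ℝ)
    {h Z : Time T → Ω → Vec d} (hh : MemHInf F P h) (hZ : Martingale Z F P)
    (hZb : EssBounded ((leb T).prod P) fun q => Z q.1 q.2 - Z (tEnd T) q.2) :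
    ∫ q, β (h q.1 q.2) (Z q.1 q.2 - Z (tEnd T) q.2) ∂((leb T).prod P) = 0 := by
  have hint := (hh.essBounded.bilin hZb β).integrable
  obtain ⟨ho, C, hC0, hC⟩ := memHInf_iff.1 hh
  -- The essential bound on `h` is turned into a bound at almost every fixed time, where
  -- conditioning on `F t` takes place.
  have hC' := Measure.ae_ae_of_ae_prod (ho.ae_prod hC)
  rw [integral_prod _ hint]
  refine integral_eq_zero_of_ae ?_
  filter_upwards [hC'] with t ht
  have hm : StronglyMeasurable[F t] (h t) := (ho.adapted t).stronglyMeasurable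
  have hm' : AEStronglyMeasurable (h t) P := (hm.mono (F.le t)).aestronglyMeasurable
  have hi : ∀ s, Integrable (fun ω => β (h t ω) (Z s ω)) P := fun s => by
    refine ((hZ.integrable s).norm.const_mul (‖β‖ * C)).mono'
      (β.aestronglyMeasurable_comp₂ hm' (hZ.integrable s).1) ?_
    filter_upwards [ht] with ω hω
    refine (β.le_opNorm₂ _ _).trans ?_
    have := mul_le_mul_of_nonneg_right (mul_le_mul_of_nonneg_left hω (norm_nonneg β))
      (norm_nonneg (Z s ω))
    linarith
  -- `h t` is known at time `t` and can be pulled out of the conditional expectation, which replaces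
  -- the terminal value of `Z` by `Z t`.
  have h1 := condExp_bilin_of_stronglyMeasurable_left (B := β) hm (hi (tEnd T))
    (hZ.integrable (tEnd T))
  have h2 : ∫ ω, β (h t ω) (Z (tEnd T) ω) ∂P = ∫ ω, β (h t ω) (Z t ω) ∂P := by
    rw [← integral_condExp (F.le t)]
    refine integral_congr_ae ?_
    filter_upwards [h1, hZ.2 t (tEnd T) (le_tEnd t)] with ω h3 h4
    rw [h3, h4]
  change ∫ ω, β (h t ω) (Z t ω - Z (tEnd T) ω) ∂P = 0
  simp only [map_sub]
  rw [integral_sub (hi t) (hi _), h2, sub_self]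

end Orthogonality

/-! ### Vanishing of the first variation at solutions of the FBSDE. -/

section Verification

variable {Ω : Type*} [mΩ : MeasurableSpace Ω] {T : ℝ≥0} {d : ℕ} {F : Filtration (Time T) mΩ}
  {P : Measure Ω} [IsProbabilityMeasure P] {r δbar : ℝ} {Sig Lam : Matrix (Fin d) (Fin d) ℝ}

/-- This identity matches the FBSDE drift with the Σ-term of the first variation. -/
lemma toEuclideanLin_matB (hLam : Lam.PosDef) (v : Vec d) :
    Matrix.toEuclideanLin Lam (Matrix.toEuclideanLin (matB δbar Sig Lam) v) =
      (2 * δbar)⁻¹ • Matrix.toEuclideanLin Sig v := by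
  rw [← toEuclideanLin_mul_apply, matB, Matrix.mul_smul, ← mul_assoc,
    Matrix.mul_nonsing_inv _ ((Matrix.isUnit_iff_isUnit_det _).1 hLam.isUnit), one_mul, map_smul,
    LinearMap.smul_apply]

/-- The first variation of the objective vanishes at solutions of the forward-backward system. -/
lemma firstVariation_eq_zero (hT : 0 < T) (hLam : Lam.PosDef) (hδbar : 0 < δbar) (c : ℝ)
    {TP TP' X Y M : Time T → Ω → Vec d} (hTP : MemHInf F P TP')
    (hTPe : ∀ᵐ ω ∂P, ∀ t, TP' t ω = TP t ω) (hX : MemHInf F P X) (hY : MemHInf F P Y)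
    (hM : IsBoundedContMartingale F P M)
    (hd : HasDynamics P X
      (fun t ω => Matrix.toEuclideanLin (matB δbar Sig Lam) (primitive X t ω - TP t ω) +
        r • X t ω) M)
    (hXc : ∀ᵐ ω ∂P, Continuous fun t => X t ω) (hXT : ∀ᵐ ω ∂P, X (tEnd T) ω = 0) :
    firstVariation P r δbar c Sig Lam TP X Y = 0 := by
  let L : Vec d →L[ℝ] Vec d := (Matrix.toEuclideanLin (matB δbar Sig Lam)).toContinuousLinearMap
  let A : Vec d →L[ℝ] Vec d := (Matrix.toEuclideanLin Lam).toContinuousLinearMap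
  let β : Vec d →L[ℝ] Vec d →L[ℝ] ℝ := (innerSL ℝ).bilinearComp (.id ℝ _) A
  have hβ : ∀ u v, β u v = ⟪u, Matrix.toEuclideanLin Lam v⟫ := fun u v => rfl
  have hh : MemHInf F P fun t ω => Y t ω - X t ω := hY.sub hX
  have hprim : ∀ᵐ ω ∂P, ∀ t, pathPrim (fun s => Y s ω - X s ω) t =
      primitive Y t ω - primitive X t ω := by
    filter_upwards [hX.ae_integrable, hY.ae_integrable] with ω h1 h2 t using pathPrim_sub h2 h1 t
  let f : Time T × Ω → ℝ := fun q => Real.exp (-r * (q.1 : ℝ)) *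
    (β (primitive Y q.1 q.2 - primitive X q.1 q.2) (L (primitive X q.1 q.2 - TP q.1 q.2)) +
      β (Y q.1 q.2 - X q.1 q.2) (X q.1 q.2))
  have hTPb : EssBounded ((leb T).prod P) fun q => TP q.1 q.2 :=
    hTP.essBounded.congr (ae_prod_of_ae_forall (p := fun t ω => TP' t ω = TP t ω) hTPe)
  have hf : EssBounded ((leb T).prod P) f :=
    (essBounded_exp r).smul
      (((hY.essBounded_primitive.sub hX.essBounded_primitive).bilin
        ((hX.essBounded_primitive.sub hTPb).clm L) β).add (hh.essBounded.bilin hX.essBounded β))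
  -- Since ΛB = Σ/(2δbar), the integrand is -2c times the discounted pairing of `h` and its
  -- primitive with `X` and the drift, measured in the inner product of Λ.
  have hfv : firstVariation P r δbar c Sig Lam TP X Y = (-2 * c) * ∫ q, f q ∂((leb T).prod P) := by
    rw [firstVariation, ← integral_const_mul]
    refine integral_congr_ae (.of_forall fun q => ?_)
    simp only [f, hβ]
    change _ = -2 * c * (_ * (⟪_, Matrix.toEuclideanLin Lam
      (Matrix.toEuclideanLin (matB δbar Sig Lam) _)⟫ + _))
    rw [toEuclideanLin_matB hLam, real_inner_smul_right, real_inner_smul_right,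
      ← neg_sub (primitive X q.1 q.2) (TP q.1 q.2), map_neg, inner_neg_right]
    field_simp
    ring
  obtain ⟨C, hC0, hC⟩ := hM.2.2.ae_bound hT hM.2.1
  have hmart : Martingale (fun t ω => discountedPart r (fun s => M s ω) t) F P := by
    refine martingale_by_parts (k := fun t => Real.exp (-r * (t : ℝ))) hM.1
      (memHInf_iff.1 hM.2.2).1 (C := C) ?_ (by fun_prop) fun t => ?_
    · filter_upwards [hC] with ω hω using .of_forall hω
    · rw [pathPrim_deriv (hasDerivAt_exp_neg_mul r) (by fun_prop)]
      simp [tStart]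
  have hZo : EssBounded ((leb T).prod P) fun q =>
      discountedPart r (fun s => M s q.2) q.1 - discountedPart r (fun s => M s q.2) (tEnd T) := by
    have hk : Continuous fun t : Time T => -r * Real.exp (-r * (t : ℝ)) := by fun_prop
    have hk' : Continuous fun t : Time T => Real.exp (-r * (t : ℝ)) := by fun_prop
    obtain ⟨D, hD⟩ := exists_bound_of_continuous hk
    obtain ⟨D', hD'⟩ := exists_bound_of_continuous hk'
    have hub : ∀ᵐ ω ∂P, ∀ t : Time T, ‖(-r * Real.exp (-r * (t : ℝ))) • M t ω‖ ≤ D * C := by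
      filter_upwards [hC] with ω hω t
      exact (norm_smul_le _ _).trans
        (mul_le_mul (hD t) (hω t) (norm_nonneg _) ((norm_nonneg _).trans (hD t)))
    have hu : MemHInf F P fun t ω => (-r * Real.exp (-r * (t : ℝ))) • M t ω := by
      refine memHInf_iff.2 ⟨(isOpt_deterministic hk).comp₂ (memHInf_iff.1 hM.2.2).1
        measurable_smul, |D * C|, abs_nonneg _, ?_⟩
      filter_upwards [hub] with ω hω
      exact .of_forall fun t => (hω t).trans (le_abs_self _)
    refine (((essBounded_exp r).smul hM.2.2.essBounded).sub hu.essBounded_primitive).sub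
      (EssBounded.comp_snd ⟨(hmart.integrable (tEnd T)).1, D' * C + D * C * T, ?_⟩)
    filter_upwards [hC, hub] with ω h1 h2
    exact (norm_sub_le _ _).trans (add_le_add ((norm_smul_le _ _).trans
      (mul_le_mul (hD' _) (h1 _) (norm_nonneg _) ((norm_nonneg _).trans (hD' (tEnd T)))))
        (norm_pathPrim_le (.of_forall h2) _))
  rw [hfv, integral_prod_symm _ hf.integrable]
  have hω : ∀ᵐ ω ∂P, ∫ t, f (t, ω) ∂(leb T) = ∫ t, β (Y t ω - X t ω)
      (discountedPart r (fun s => M s ω) t - discountedPart r (fun s => M s ω) (tEnd T))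
        ∂(leb T) := by
    filter_upwards [hd, hXc, hXT, hM.2.1, hh.ae_integrable, hTP.ae_integrable, hTPe,
      hX.ae_integrable, hprim] with ω h1 h2 h3 h4 h5 h6 h7 h8 h9
    have h6' : Integrable (fun t => TP t ω) (leb T) := h6.congr (.of_forall h7)
    have hg : Integrable (fun t => L (primitive X t ω - TP t ω)) (leb T) :=
      L.integrable_comp ((integrable_leb_of_continuous (continuous_pathPrim h8)).sub h6')
    rw [← integral_variation β h2 h4 hg h5 h1 h3]
    refine integral_congr_ae (.of_forall fun t => ?_)
    simp only [f, h9]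
  rw [integral_congr_ae hω]
  have hZi := (hh.essBounded.bilin hZo β).integrable
  rw [← integral_prod_symm (fun q : Time T × Ω => β (Y q.1 q.2 - X q.1 q.2)
    (discountedPart r (fun s => M s q.2) q.1 - discountedPart r (fun s => M s q.2) (tEnd T))) hZi,
    integral_bilin_martingale_increment β hh hmart hZo, mul_zero]

end Verification

/-! ### Solutions of the FBSDE and maximizers. -/

section Characterisation

variable {Ω : Type*} [mΩ : MeasurableSpace Ω] {T : ℝ≥0} {d N : ℕ} {F : Filtration (Time T) mΩ}
  {P : Measure Ω} {r δbar : ℝ} {Sig Lam : Matrix (Fin d) (Fin d) ℝ}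
  {δ : Fin N → ℝ} {ζ : Fin N → Time T → Ω → Vec d} {ψ ψdot aψ : Time T → Ω → Vec d} {n : Fin N}

lemma HasDynamics.congr {X Y a b M : Time T → Ω → Vec d} (h : HasDynamics P X a M)
    (hXY : Indistinguishable P X Y) (hab : Indistinguishable P a b) : HasDynamics P Y b M := by
  filter_upwards [h, hXY, hab] with ω h1 h2 h3 t
  have : primitive a t ω = primitive b t ω :=
    congrFun (pathPrim_congr (.of_forall fun s => h3 s)) t
  rw [← h2 t, ← h2 (tStart T), h1 t, this]

lemma primitive_congr {X Y : Time T → Ω → Vec d} (hXY : Indistinguishable P X Y) :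
    Indistinguishable P (primitive X) (primitive Y) := by
  filter_upwards [hXY] with ω h t
  exact congrFun (pathPrim_congr (.of_forall fun s => h s)) t

lemma HasRate.indistinguishable {φ φdot : Time T → Ω → Vec d} (h : HasRate P φ φdot) :
    Indistinguishable P φ (primitive φdot) := by
  filter_upwards [h] with ω hω t
  rw [hω.2 t, hω.1, zero_add]

/-- The target portfolio is indistinguishable from a process of class `H^∞`. -/
lemma exists_memHInf_targetPortfolio (hζ : ∀ m, MemHInf F P (ζ m)) (hψdot : MemHInf F P ψdot)
    (hψ : HasRate P ψ ψdot) (haψ : MemHInf F P aψ) :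
    ∃ TP', MemHInf F P TP' ∧
      Indistinguishable P TP' (targetPortfolio r δbar Sig Lam δ ζ ψ ψdot aψ n) := by
  -- `ψ` is determined only up to indistinguishability and need not be optional; it is replaced by
  -- an optional version of the primitive of its rate.
  obtain ⟨ψ', hψ', -, -, he⟩ := hψdot.exists_primitive
  refine ⟨targetPortfolio r δbar Sig Lam δ ζ ψ' ψdot aψ n, ?_, ?_⟩
  · have ho : MemHInf F P (exposureOthers ζ n) := MemHInf.sum (Finset.univ.erase n) hζ
    exact ((((ho.sub hψ').smul _).sub ((hζ n).smul _)).smul _).add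
      (((haψ.sub (hψdot.smul r)).clm
        (Matrix.toEuclideanLin (Sig⁻¹ * Lam)).toContinuousLinearMap).smul _)
  · filter_upwards [he, hψ.indistinguishable] with ω h1 h2 t
    simp only [targetPortfolio, bestResponse, h1, h2]

/-- The FBSDE drift involves a primitive and a target not assumed to be optional. Both are replaced
by indistinguishable processes of class H^∞, which leaves the dynamics unchanged. -/
lemma mem_classA_of_fbsde {L : Vec d →L[ℝ] Vec d} {TP TP' X M : Time T → Ω → Vec d}
    (hTP : MemHInf F P TP') (hTPe : Indistinguishable P TP' TP) (hX : MemHInf F P X)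
    (hM : IsBoundedContMartingale F P M)
    (hd : HasDynamics P X (fun t ω => L (primitive X t ω - TP t ω) + r • X t ω) M)
    (hXT : ∀ᵐ ω ∂P, X (tEnd T) ω = 0) : X ∈ classA d F P := by
  obtain ⟨Φ, hΦ, -, -, he⟩ := hX.exists_primitive
  refine ⟨⟨fun t ω => L (Φ t ω - TP' t ω) + r • X t ω, M, hX, ((hΦ.sub hTP).clm L).add (hX.smul r),
    hM, hd.congr (.of_forall fun _ _ => rfl) ?_⟩, hXT⟩
  filter_upwards [he, hTPe] with ω h1 h2 t
  rw [h1, h2]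

variable [IsProbabilityMeasure P]

/-- Solutions of the forward-backward system maximise the objective. -/
lemma isMaxOn_of_fbsde (hT : 0 < T) (hN : 2 ≤ N) (hSig : Sig.PosDef) (hLam : Lam.PosDef)
    (hδbar : 0 < δbar) (hδ : ∀ m, δ m = δbar) (hζ : ∀ m, MemHInf F P (ζ m))
    (hψdot : MemHInf F P ψdot) (hψ : HasRate P ψ ψdot) (haψ : MemHInf F P aψ)
    {X M : Time T → Ω → Vec d} (hX : X ∈ classA d F P) (hM : IsBoundedContMartingale F P M)
    (hd : HasDynamics P X (fun t ω => Matrix.toEuclideanLin (matB δbar Sig Lam)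
      (primitive X t ω - targetPortfolio r δbar Sig Lam δ ζ ψ ψdot aψ n t ω) + r • X t ω) M) :
    IsMaxOn (objective P r δbar Sig Lam ζ ψ ψdot aψ n) (classA d F P) X := by
  intro Y hY
  have hX' : MemHInf F P X := hX.1.choose_spec.choose_spec.1
  have hY' : MemHInf F P Y := hY.1.choose_spec.choose_spec.1
  obtain ⟨TP', hTP', hTPe⟩ := exists_memHInf_targetPortfolio (r := r) (δbar := δbar) (Sig := Sig)
    (Lam := Lam) (δ := δ) (n := n) hζ hψdot hψ haψ
  have hN' : (2 : ℝ) ≤ N := by exact_mod_cast hN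
  have hc0 : 0 < ((N : ℝ) + 1) / (N - 1) := div_pos (by linarith) (by linarith)
  have h1 := objective_sub (r := r) (n := n) hN hSig hLam hδbar hδ rfl hζ hψdot hψ haψ hX' hY'
  rw [firstVariation_eq_zero hT hLam hδbar _ hTP' hTPe hX' hY' hM hd
    (ae_continuous_of_mem_classA hX) hX.2] at h1
  have h2 := integral_nonneg (μ := (leb T).prod P) (f := quadraticLoss r δbar _ Sig Lam X Y)
    (quadraticLoss_nonneg (r := r) hSig hLam hδbar hc0 X Y)
  change objective P r δbar Sig Lam ζ ψ ψdot aψ n Y ≤ objective P r δbar Sig Lam ζ ψ ψdot aψ n X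
  linarith

/-- Maximisers of the objective are unique up to indistinguishability. -/
lemma indistinguishable_of_isMaxOn (hT : 0 < T) (hN : 2 ≤ N) (hSig : Sig.PosDef)
    (hLam : Lam.PosDef) (hδbar : 0 < δbar) (hδ : ∀ m, δ m = δbar) (hζ : ∀ m, MemHInf F P (ζ m))
    (hψdot : MemHInf F P ψdot) (hψ : HasRate P ψ ψdot) (haψ : MemHInf F P aψ)
    {X Y : Time T → Ω → Vec d} (hX : X ∈ classA d F P) (hY : Y ∈ classA d F P)
    (hXm : IsMaxOn (objective P r δbar Sig Lam ζ ψ ψdot aψ n) (classA d F P) X)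
    (hYm : IsMaxOn (objective P r δbar Sig Lam ζ ψ ψdot aψ n) (classA d F P) Y) :
    Indistinguishable P X Y := by
  by_contra hne
  have h1 := objective_strictConcave (r := r) (n := n) hT hN hSig hLam hδbar hδ hζ hψdot hψ haψ
    hX hY hne (a := 1 / 2) (b := 1 / 2) (by norm_num) (by norm_num) (by norm_num)
  have hZ := add_smul_mem_classA hX hY (1 / 2) (1 / 2)
  have h2 := isMaxOn_iff.1 hXm _ hZ
  have h3 := isMaxOn_iff.1 hYm _ hZ
  linarith

end Characterisation

end PriceImpact

/-! ### Assembly of the proposition. -/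

theorem proposition4p2
    {Ω : Type*} [MeasurableSpace Ω] (P : Measure Ω) [IsProbabilityMeasure P]
    (T : ℝ≥0) (hT : 0 < T) (r : ℝ) (hr : 0 ≤ r) (d N : ℕ) (hN : 2 ≤ N)
    (W : Time T → Ω → Fin d → ℝ) (hW : IsStandardBrownian W P)
    (F : Filtration (Time T) ‹MeasurableSpace Ω›)
    (hF : F = augmentedFiltration W hW.measurable P)
    (Sig Lam : Matrix (Fin d) (Fin d) ℝ) (hSig : Sig.PosDef)
    (hLam : Lam.PosDef) (hLamDiag : Lam.IsDiag)
    (δ : Fin N → ℝ) (δbar : ℝ) (hδbar : 0 < δbar) (hδ : ∀ m, δ m = δbar)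
    (ζ : Fin N → Time T → Ω → Vec d) (hζ : ∀ m, MemHInf F P (ζ m))
    (ψ ψdot aψ Mψ : Time T → Ω → Vec d) (hψ : MemW F P ψ ψdot)
    (haψ : HasDecomposition F P ψdot aψ Mψ) (n : Fin N) :
    -- the objective is a well-defined real number on the admissible class
    (∀ X ∈ classA d F P,
      Integrable (fun p : Time T × Ω =>
        objectiveIntegrand r δbar Sig Lam ζ ψ ψdot aψ n X p.1 p.2) ((leb T).prod P)) ∧
    -- strict concavity on the (convex) admissible class
    Convex ℝ (classA d F P) ∧
    (∀ X ∈ classA d F P, ∀ Y ∈ classA d F P, ¬ Indistinguishable P X Y →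
      ∀ a b : ℝ, 0 < a → 0 < b → a + b = 1 →
        a * objective P r δbar Sig Lam ζ ψ ψdot aψ n X +
            b * objective P r δbar Sig Lam ζ ψ ψdot aψ n Y <
          objective P r δbar Sig Lam ζ ψ ψdot aψ n (a • X + b • Y)) ∧
    -- there is a maximizer, unique up to indistinguishability
    (∃ X ∈ classA d F P,
      IsMaxOn (objective P r δbar Sig Lam ζ ψ ψdot aψ n) (classA d F P) X ∧
      ∀ Y ∈ classA d F P,
        IsMaxOn (objective P r δbar Sig Lam ζ ψ ψdot aψ n) (classA d F P) Y →
          Indistinguishable P X Y) ∧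
    -- the optimal position and trading rate are characterized by the FBSDE
    (∀ φ φdot : Time T → Ω → Vec d,
      (MemW F P φ φdot ∧
          IsMaxOn (objective P r δbar Sig Lam ζ ψ ψdot aψ n) (classA d F P) φdot) ↔
        SolvesFBSDE F P r (matB δbar Sig Lam)
          (targetPortfolio r δbar Sig Lam δ ζ ψ ψdot aψ n) φ φdot) := by
  subst hF
  have hψdot : MemHInf _ P ψdot := haψ.1
  have ha : MemHInf _ P aψ := haψ.2.1
  -- The only use of the Brownian nature of the filtration.
  have hcv := fun (ξ : Ω → ℝ) (C : ℝ) h1 h2 =>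
    hasContVersion_of_bounded (C := C) hT hW (ξ := ξ) h1 h2
  have hunique := fun {X Y : Time T → Ω → Vec d} => indistinguishable_of_isMaxOn (r := r) (n := n)
    (X := X) (Y := Y) hT hN hSig hLam hδbar hδ hζ hψdot hψ.2 ha
  obtain ⟨TP', hTP', hTPe⟩ := exists_memHInf_targetPortfolio (r := r) (δbar := δbar) (Sig := Sig)
    (Lam := Lam) (δ := δ) (n := n) hζ hψdot hψ.2 ha
  obtain ⟨Q, D, hD, hQ⟩ := exists_diagonalisation hSig hLam hLamDiag hδbar
  obtain ⟨X₀, M₀, hX₀, hM₀, hd', hX₀T⟩ := exists_fbsde_solution hcv r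
    (Matrix.toEuclideanLin (matB δbar Sig Lam)).toContinuousLinearMap Q hD hQ hTP'
  have hd₀ : HasDynamics P X₀ (fun t ω => Matrix.toEuclideanLin (matB δbar Sig Lam)
      (primitive X₀ t ω - targetPortfolio r δbar Sig Lam δ ζ ψ ψdot aψ n t ω) + r • X₀ t ω) M₀ := by
    refine hd'.congr (.of_forall fun _ _ => rfl) ?_
    filter_upwards [hTPe] with ω h t
    rw [h t]; rfl
  have hA₀ := mem_classA_of_fbsde
    (L := (Matrix.toEuclideanLin (matB δbar Sig Lam)).toContinuousLinearMap)
    hTP' hTPe hX₀ hM₀ hd₀ hX₀T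
  have hmax₀ := isMaxOn_of_fbsde hT hN hSig hLam hδbar hδ hζ hψdot hψ.2 ha hA₀ hM₀ hd₀
  refine ⟨fun X hX => (essBounded_objectiveIntegrand hζ hψdot hψ.2 ha
      hX.1.choose_spec.choose_spec.1).integrable, convex_classA,
    fun X hX Y hY hXY a b h1 h2 h3 => objective_strictConcave hT hN hSig hLam hδbar hδ hζ hψdot
      hψ.2 ha hX hY hXY h1 h2 h3,
    ⟨X₀, hA₀, hmax₀, fun Y hY hYm => hunique hA₀ hY hmax₀ hYm⟩, fun φ φdot => ⟨?_, ?_⟩⟩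
  · rintro ⟨⟨hA, hrate⟩, hmax⟩
    -- The given maximizer is indistinguishable from the constructed solution and inherits its
    -- dynamics with the same martingale `M₀`.
    have he := hunique hA₀ hA hmax₀ hmax
    refine ⟨hA.1.choose_spec.choose_spec.1, hrate, ⟨M₀, hM₀, hd₀.congr he ?_⟩, hA.2⟩
    filter_upwards [he, primitive_congr he, hrate.indistinguishable] with ω h1 h2 h3 t
    rw [h1, h2, h3]
  · rintro ⟨hX, hrate, ⟨M, hM, hd⟩, hXT⟩
    have hd1 : HasDynamics P φdot (fun t ω => Matrix.toEuclideanLin (matB δbar Sig Lam)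
        (primitive φdot t ω - targetPortfolio r δbar Sig Lam δ ζ ψ ψdot aψ n t ω) +
          r • φdot t ω) M := by
      refine hd.congr (.of_forall fun _ _ => rfl) ?_
      filter_upwards [hrate.indistinguishable] with ω h t
      rw [h t]
    have hA := mem_classA_of_fbsde
      (L := (Matrix.toEuclideanLin (matB δbar Sig Lam)).toContinuousLinearMap)
      hTP' hTPe hX hM hd1 hXT
    exact ⟨⟨hA, hrate⟩, isMaxOn_of_fbsde hT hN hSig hLam hδbar hδ hζ hψdot hψ.2 ha hA hM hd1⟩
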